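/- **Theorem (Learning halfspaces from positive examples under Gaussian marginals).** Let $\mathcal N(\mu^\star,\Sigma^\star)$ denote a $d$-dimensional Gaussian with $\Sigma^\star$ positive definite, let a halfspace be a set $\{x\in\mathbb R^d : \langle w,x\rangle\ge\tau\}$ with $\|w\|_2=1$ and $\tau\in\mathbb R$, and let $\mathcal N(\mu^\star,\Sigma^\star,S^\star)$ be the law of $x\sim\mathcal N(\mu^\star,\Sigma^\star)$ conditioned on $x\in S^\star$. There are a deterministic algorithm (a single real-RAM program, using the operations $+,-,\times,/$ and comparisons on real numbers at unit cost) and natural numbers $C,a,b,K,k$ such that the following holds for all $d\ge 1$, $\alpha>0$, $\varepsilon,\delta\in(0,1/2)$ and every number of samples $$n\ \ge\ C\,(d/\varepsilon)^{a}\,\bigl(\log(1/\delta)\bigr)^{b}.$$ 1. (Running time.) Given $n$, $d$, $\alpha$, $\varepsilon$, $\delta$ and any $n$ points $x_1,\dots,x_n\in\mathbb R^d$, the algorithm halts after at most $K n^{k}$ steps and outputs a vector $w\in\mathbb R^d$ and a number $\tau\in\mathbb R$, which describe the set $S=\{x\in\mathbb R^d:\langle w,x\rangle\ge\tau\}$ (where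 $w=0$ is allowed, so that $S$ can be all of $\mathbb R^d$). 2. (Correctness.) For every Gaussian $\mathcal N(\mu^\star,\Sigma^\star)$ on $\mathbb R^d$ and every halfspace $S^\star$, both unknown to the algorithm, with $\Pr_{x\sim\mathcal N(\mu^\star,\Sigma^\star)}[x\in S^\star]\ge\alpha$: if $x_1,\dots,x_n$ are drawn independently from $\mathcal N(\mu^\star,\Sigma^\star,S^\star)$, then with probability at least $1-\delta$ the output satisfies $$\Pr_{x\sim\mathcal N(\mu^\star,\Sigma^\star)}\bigl[x\in S\triangle S^\star\bigr]\le\varepsilon .$$ -/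

import Mathlib

open MeasureTheory ProbabilityTheory
open scoped symmDiff ENNReal

/-! ## Halfspaces -/

/-- The set `{x ∈ ℝᵈ : ⟨w, x⟩ ≥ τ}`. -/
def superlevelSet {d : ℕ} (w : EuclideanSpace ℝ (Fin d)) (τ : ℝ) : Set (EuclideanSpace ℝ (Fin d)) :=
  {x | τ ≤ inner ℝ w x}

/-- A (closed) halfspace of `ℝᵈ`: a set `{x : ⟨w, x⟩ ≥ τ}` with a unit normal vector `w`. -/
def IsHalfspace {d : ℕ} (S : Set (EuclideanSpace ℝ (Fin d))) : Prop :=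
  ∃ (w : EuclideanSpace ℝ (Fin d)) (τ : ℝ), ‖w‖ = 1 ∧ S = superlevelSet w τ

/-! ## The real RAM

The memory consists of integer cells and real cells, organised in arrays. The name of an array is
fixed in the program text; the index of a cell is computed at run time (indirect addressing). The
unit-cost operations are addition and truncated subtraction of integers, the four arithmetic
operations on reals (with `x / 0 = 0`), the conversion of an integer to a real, and comparisons.
There is no operation that rounds reals, and the only constants are natural numbers. -/

namespace RealRAM

/-- The contents of the memory: `int a i` and `real a i` are the contents of cell `i` of the
integer array, respectively real array, with name `a`. -/
@[ext]
structure Store where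
  int : ℕ → ℕ → ℕ
  real : ℕ → ℕ → ℝ

/-- Write the integer `v` into cell `i` of the integer array `a`. -/
def Store.setInt (s : Store) (a i v : ℕ) : Store where
  int := fun a' i' => if a' = a ∧ i' = i then v else s.int a' i'
  real := s.real

/-- Write the real `v` into cell `i` of the real array `a`. -/
noncomputable def Store.setReal (s : Store) (a i : ℕ) (v : ℝ) : Store where
  int := s.int
  real := fun a' i' => if a' = a ∧ i' = i then v else s.real a' i'

/-- Integer expressions. -/
inductive IntExpr : Type
  | const (k : ℕ)
  | load (a : ℕ) (i : IntExpr)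
  | add (e₁ e₂ : IntExpr)
  | sub (e₁ e₂ : IntExpr)

/-- The value of an integer expression. -/
def IntExpr.eval : IntExpr → Store → ℕ
  | const k, _ => k
  | load a i, s => s.int a (i.eval s)
  | add e₁ e₂, s => e₁.eval s + e₂.eval s
  | sub e₁ e₂, s => e₁.eval s - e₂.eval s

/-- The number of steps that the evaluation of an integer expression takes. -/
def IntExpr.cost : IntExpr → ℕ
  | const _ => 1
  | load _ i => i.cost + 1
  | add e₁ e₂ => e₁.cost + e₂.cost + 1
  | sub e₁ e₂ => e₁.cost + e₂.cost + 1

/-- Real expressions. -/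
inductive RealExpr : Type
  | ofInt (e : IntExpr)
  | load (a : ℕ) (i : IntExpr)
  | add (e₁ e₂ : RealExpr)
  | sub (e₁ e₂ : RealExpr)
  | mul (e₁ e₂ : RealExpr)
  | div (e₁ e₂ : RealExpr)

/-- The value of a real expression. -/
noncomputable def RealExpr.eval : RealExpr → Store → ℝ
  | ofInt e, s => (e.eval s : ℝ)
  | load a i, s => s.real a (i.eval s)
  | add e₁ e₂, s => e₁.eval s + e₂.eval s
  | sub e₁ e₂, s => e₁.eval s - e₂.eval s
  | mul e₁ e₂, s => e₁.eval s * e₂.eval s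
  | div e₁ e₂, s => e₁.eval s / e₂.eval s

/-- The number of steps that the evaluation of a real expression takes. -/
def RealExpr.cost : RealExpr → ℕ
  | ofInt e => e.cost + 1
  | load _ i => i.cost + 1
  | add e₁ e₂ => e₁.cost + e₂.cost + 1
  | sub e₁ e₂ => e₁.cost + e₂.cost + 1
  | mul e₁ e₂ => e₁.cost + e₂.cost + 1
  | div e₁ e₂ => e₁.cost + e₂.cost + 1

/-- Tests: comparisons of integers or of reals, and their negations. -/
inductive Test : Type
  | intLE (e₁ e₂ : IntExpr)
  | realLE (e₁ e₂ : RealExpr)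
  | not (b : Test)

/-- The truth value of a test. -/
def Test.Holds : Test → Store → Prop
  | intLE e₁ e₂, s => e₁.eval s ≤ e₂.eval s
  | realLE e₁ e₂, s => e₁.eval s ≤ e₂.eval s
  | not b, s => ¬ b.Holds s

/-- The number of steps that the evaluation of a test takes. -/
def Test.cost : Test → ℕ
  | intLE e₁ e₂ => e₁.cost + e₂.cost + 1
  | realLE e₁ e₂ => e₁.cost + e₂.cost + 1
  | not b => b.cost + 1

/-- Programs. -/
inductive Program : Type
  | skip
  | setInt (a : ℕ) (i e : IntExpr)
  | setReal (a : ℕ) (i : IntExpr) (e : RealExpr)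
  | seq (p q : Program)
  | ite (b : Test) (p q : Program)
  | while (b : Test) (p : Program)

/-- `Runs p s t s'`: started in the memory `s`, the program `p` halts after exactly `t` steps, and
the memory then is `s'`. -/
inductive Runs : Program → Store → ℕ → Store → Prop
  | skip (s : Store) : Runs .skip s 1 s
  | setInt (a : ℕ) (i e : IntExpr) (s : Store) :
      Runs (.setInt a i e) s (i.cost + e.cost + 1) (s.setInt a (i.eval s) (e.eval s))
  | setReal (a : ℕ) (i : IntExpr) (e : RealExpr) (s : Store) :
      Runs (.setReal a i e) s (i.cost + e.cost + 1) (s.setReal a (i.eval s) (e.eval s))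
  | seq {p q : Program} {s s' s'' : Store} {t t' : ℕ} :
      Runs p s t s' → Runs q s' t' s'' → Runs (.seq p q) s (t + t') s''
  | ite_true {b : Test} {p q : Program} {s s' : Store} {t : ℕ} :
      b.Holds s → Runs p s t s' → Runs (.ite b p q) s (b.cost + t + 1) s'
  | ite_false {b : Test} {p q : Program} {s s' : Store} {t : ℕ} :
      ¬ b.Holds s → Runs q s t s' → Runs (.ite b p q) s (b.cost + t + 1) s'
  | while_true {b : Test} {p : Program} {s s' s'' : Store} {t t' : ℕ} :
      b.Holds s → Runs p s t s' → Runs (.while b p) s' t' s'' →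
        Runs (.while b p) s (b.cost + t + t' + 1) s''
  | while_false {b : Test} {p : Program} {s : Store} :
      ¬ b.Holds s → Runs (.while b p) s (b.cost + 1) s

/-- Programs are deterministic: the memory determines the running time and the final memory. -/
theorem Runs.deterministic {p : Program} {s s₁ : Store} {t₁ : ℕ} (h₁ : Runs p s t₁ s₁) :
    ∀ {t₂ : ℕ} {s₂ : Store}, Runs p s t₂ s₂ → t₁ = t₂ ∧ s₁ = s₂ := by
  induction h₁ with
  | skip s => intro t₂ s₂ h; cases h; exact ⟨rfl, rfl⟩
  | setInt a i e s => intro t₂ s₂ h; cases h; exact ⟨rfl, rfl⟩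
  | setReal a i e s => intro t₂ s₂ h; cases h; exact ⟨rfl, rfl⟩
  | seq _ _ ih₁ ih₂ =>
    intro t₂ s₂ h
    cases h with
    | seq hp hq =>
      obtain ⟨rfl, rfl⟩ := ih₁ hp
      obtain ⟨rfl, rfl⟩ := ih₂ hq
      exact ⟨rfl, rfl⟩
  | ite_true hb _ ih =>
    intro t₂ s₂ h
    cases h with
    | ite_true _ hp => obtain ⟨rfl, rfl⟩ := ih hp; exact ⟨rfl, rfl⟩
    | ite_false hb' _ => exact absurd hb hb'
  | ite_false hb _ ih =>
    intro t₂ s₂ h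
    cases h with
    | ite_true hb' _ => exact absurd hb' hb
    | ite_false _ hp => obtain ⟨rfl, rfl⟩ := ih hp; exact ⟨rfl, rfl⟩
  | while_true hb _ _ ih₁ ih₂ =>
    intro t₂ s₂ h
    cases h with
    | while_true _ hp hq =>
      obtain ⟨rfl, rfl⟩ := ih₁ hp
      obtain ⟨rfl, rfl⟩ := ih₂ hq
      exact ⟨rfl, rfl⟩
    | while_false hb' => exact absurd hb hb'
  | while_false hb =>
    intro t₂ s₂ h
    cases h with
    | while_true hb' _ _ => exact absurd hb' hb
    | while_false _ => exact ⟨rfl, rfl⟩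

/-- The initial memory of a learner. Cells `0, 1` of integer array `0` hold the number `n` of
samples and the dimension `d`; cells `0, 1, 2` of real array `0` hold `α, ε, δ`; cell `i * d + j` of
real array `1` holds the `j`-th coordinate of the `i`-th sample (`i < n`, `j < d`). All other cells
hold `0`. -/
noncomputable def input {n d : ℕ} (α ε δ : ℝ) (x : Fin n → EuclideanSpace ℝ (Fin d)) : Store where
  int := fun a i => if a = 0 ∧ i = 0 then n else if a = 0 ∧ i = 1 then d else 0
  real := fun a i =>
    if a = 0 ∧ i = 0 then α
    else if a = 0 ∧ i = 1 then ε
    else if a = 0 ∧ i = 2 then δ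
    else if h : a = 1 ∧ i / d < n ∧ i % d < d then x ⟨i / d, h.2.1⟩ ⟨i % d, h.2.2⟩
    else 0

/-- The set that a learner outputs: cells `0, …, d - 1` of real array `2` hold a vector `w` and
cell `d` holds a number `τ`, and the output is `{x : ⟨w, x⟩ ≥ τ}`. (For `w = 0` this is the whole
space or the empty set.) -/
noncomputable def outputSet (d : ℕ) (s : Store) : Set (EuclideanSpace ℝ (Fin d)) :=
  superlevelSet (WithLp.toLp 2 fun j : Fin d => s.real 2 j) (s.real 2 d)

end RealRAM

/-- The truncated Gaussian `N(μ, Σ, S)`: the law of `x ∼ N(μ, Σ)` conditioned on `x ∈ S`. -/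
noncomputable def truncatedGaussian {d : ℕ} (μ : EuclideanSpace ℝ (Fin d))
    (Sig : Matrix (Fin d) (Fin d) ℝ) (S : Set (EuclideanSpace ℝ (Fin d))) :
    Measure (EuclideanSpace ℝ (Fin d)) :=
  ProbabilityTheory.cond (multivariateGaussian μ Sig) S

namespace RealRAM

/-- A constant factor for the running time. -/
def Program.size : Program → ℕ
  | skip => 1
  | setInt _ i e => i.cost + e.cost + 1
  | setReal _ i e => i.cost + e.cost + 1
  | seq p q => p.size + q.size
  | ite b p q => b.cost + p.size + q.size + 1
  | .while b p => 2 * b.cost + p.size + 2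

/-- Started in `s`, the program `P` halts within `P.size * m ^ j` steps in a memory satisfying
`Q`. -/
def Ex (m j : ℕ) (P : Program) (s : Store) (Q : Store → Prop) : Prop :=
  ∃ t s', Runs P s t s' ∧ t ≤ P.size * m ^ j ∧ Q s'

theorem Ex.mono {m j j' : ℕ} {P : Program} {s : Store} {Q Q' : Store → Prop}
    (h : Ex m j P s Q) (hm : 1 ≤ m) (hj : j ≤ j') (hQ : ∀ s', Q s' → Q' s') : Ex m j' P s Q' := by
  obtain ⟨t, s', hr, ht, hq⟩ := h
  exact ⟨t, s', hr, ht.trans (Nat.mul_le_mul_left _ (Nat.pow_le_pow_right hm hj)), hQ s' hq⟩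

theorem Ex.imp {m j : ℕ} {P : Program} {s : Store} {Q Q' : Store → Prop}
    (h : Ex m j P s Q) (hQ : ∀ s', Q s' → Q' s') : Ex m j P s Q' := by
  obtain ⟨t, s', hr, ht, hq⟩ := h
  exact ⟨t, s', hr, ht, hQ s' hq⟩

theorem Ex.seq {m j : ℕ} {P P' : Program} {s : Store} {Q Q' : Store → Prop}
    (h : Ex m j P s Q) (h' : ∀ s', Q s' → Ex m j P' s' Q') : Ex m j (.seq P P') s Q' := by
  obtain ⟨t, s', hr, ht, hq⟩ := h
  obtain ⟨t', s'', hr', ht', hq'⟩ := h' s' hq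
  refine ⟨_, _, .seq hr hr', ?_, hq'⟩
  rw [Program.size, Nat.add_mul]
  exact Nat.add_le_add ht ht'

theorem ex_skip {m : ℕ} {s : Store} {Q : Store → Prop} (h : Q s) : Ex m 0 .skip s Q :=
  ⟨_, _, .skip s, by simp [Program.size], h⟩

theorem ex_setInt {m a : ℕ} {i e : IntExpr} {s : Store} {Q : Store → Prop}
    (h : Q (s.setInt a (i.eval s) (e.eval s))) : Ex m 0 (.setInt a i e) s Q :=
  ⟨_, _, .setInt a i e s, by simp [Program.size], h⟩

theorem ex_setReal {m a : ℕ} {i : IntExpr} {e : RealExpr} {s : Store} {Q : Store → Prop}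
    (h : Q (s.setReal a (i.eval s) (e.eval s))) : Ex m 0 (.setReal a i e) s Q :=
  ⟨_, _, .setReal a i e s, by simp [Program.size], h⟩

theorem ex_ite {m : ℕ} {b : Test} {P P' : Program} {s : Store} {Q : Store → Prop}
    (h : b.Holds s → Ex m 0 P s Q) (h' : ¬ b.Holds s → Ex m 0 P' s Q) :
    Ex m 0 (.ite b P P') s Q := by
  by_cases hb : b.Holds s
  · obtain ⟨t, s', hr, ht, hq⟩ := h hb
    refine ⟨_, s', .ite_true hb hr, ?_, hq⟩
    simp only [Program.size, pow_zero, mul_one] at ht ⊢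
    omega
  · obtain ⟨t, s', hr, ht, hq⟩ := h' hb
    refine ⟨_, s', .ite_false hb hr, ?_, hq⟩
    simp only [Program.size, pow_zero, mul_one] at ht ⊢
    omega

/-- The loop variable `v`: cell `0` of the integer array `v`. -/
def var (v : ℕ) : IntExpr := .load v (.const 0)

/-- `for v < N do body`. -/
def forLoop (v : ℕ) (N : IntExpr) (body : Program) : Program :=
  .seq (.setInt v (.const 0) (.const 0))
    (.while (.not (.intLE N (var v)))
      (.seq body (.setInt v (.const 0) (.add (var v) (.const 1)))))

theorem var_eval (v : ℕ) (s : Store) : (var v).eval s = s.int v 0 := rfl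

theorem loop_cost_le {n m T c j N : ℕ} (hn : n ≤ m) (hm : 1 ≤ m) (hT : T ≤ c * m ^ j) :
    n * (T + N + 11) + N + 8 ≤ (c + 2 * N + 19) * m ^ (j + 1) := by
  have h1 : 1 ≤ m ^ j := Nat.one_le_pow _ _ hm
  have h2 : 1 ≤ m ^ (j + 1) := Nat.one_le_pow _ _ hm
  calc n * (T + N + 11) + N + 8 ≤ m * (c * m ^ j + (N + 11) * m ^ j) + (N + 8) * m ^ (j + 1) := by
        have : N + 11 ≤ (N + 11) * m ^ j := Nat.le_mul_of_pos_right _ h1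
        have h3 : N + 8 ≤ (N + 8) * m ^ (j + 1) := Nat.le_mul_of_pos_right _ h2
        have : n * (T + N + 11) ≤ m * (c * m ^ j + (N + 11) * m ^ j) :=
          Nat.mul_le_mul hn (by omega)
        omega
    _ = _ := by ring

theorem ex_forLoop {v : ℕ} {N : IntExpr} {body : Program} {s : Store} {n m e : ℕ}
    (hn : n ≤ m) (hm : 1 ≤ m)
    {Inv : ℕ → Store → Prop} (h0 : Inv 0 (s.setInt v 0 0))
    (hN : ∀ k s', Inv k s' → N.eval s' = n ∧ s'.int v 0 = k)
    (hb : ∀ k < n, ∀ s', Inv k s' →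
      Ex m e body s' fun s'' => s''.int v 0 = k ∧ Inv (k + 1) (s''.setInt v 0 (k + 1))) :
    Ex m (e + 1) (forLoop v N body) s (Inv n) := by
  obtain ⟨T, hT⟩ : ∃ T, T = body.size * m ^ e := ⟨_, rfl⟩
  have key : ∀ j k, k + j = n → ∀ s', Inv k s' → ∃ t s'',
      Runs (.while (.not (.intLE N (var v)))
        (.seq body (.setInt v (.const 0) (.add (var v) (.const 1))))) s' t s'' ∧
        t ≤ j * (T + N.cost + 11) + N.cost + 5 ∧ Inv n s'' := by
    intro j
    induction j with
    | zero =>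
      intro k hk s' hs
      obtain ⟨h1, h2⟩ := hN k s' hs
      obtain rfl : k = n := by omega
      refine ⟨_, s', .while_false ?_, ?_, hs⟩
      · simp [Test.Holds, var_eval, h1, h2]
      · simp [Test.cost, var, IntExpr.cost]
    | succ j ih =>
      intro k hk s' hs
      obtain ⟨h1, h2⟩ := hN k s' hs
      obtain ⟨t, s'', hr, ht, hv, hi⟩ := hb k (by omega) s' hs
      obtain ⟨t', s₃, hr', ht', hq⟩ := ih (k + 1) (by omega) _ hi
      have hset : Runs (.setInt v (.const 0) (.add (var v) (.const 1))) s'' 6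
          (s''.setInt v 0 (k + 1)) := by
        have := Runs.setInt v (.const 0) (.add (var v) (.const 1)) s''
        simpa [IntExpr.eval, IntExpr.cost, var, hv] using this
      refine ⟨_, s₃, .while_true ?_ (.seq hr hset) hr', ?_, hq⟩
      · simp [Test.Holds, var_eval, h1, h2]; omega
      · simp only [Test.cost, var, IntExpr.cost]
        rw [Nat.succ_mul]; omega
  obtain ⟨t, s', hr, ht, hq⟩ := key n 0 (by omega) _ h0
  have hset : Runs (.setInt v (.const 0) (.const 0)) s 3 (s.setInt v 0 0) :=
    Runs.setInt v (.const 0) (.const 0) s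
  refine ⟨_, s', .seq hset hr, ?_, hq⟩
  have h1 := loop_cost_le (N := N.cost) hn hm hT.le
  have h2 : body.size + 2 * N.cost + 19 ≤ (forLoop v N body).size := by
    simp only [forLoop, Program.size, Test.cost, IntExpr.cost, var]; omega
  have h3 := Nat.mul_le_mul_right (m ^ (e + 1)) h2
  omega

/-- The memories `s` and `s'` agree except for the integer arrays `≥ l` and the real array `R`. -/
def Agree (l R : ℕ) (s s' : Store) : Prop :=
  (∀ a < l, s'.int a = s.int a) ∧ ∀ a, a ≠ R → s'.real a = s.real a

theorem Agree.refl (l R : ℕ) (s : Store) : Agree l R s s := ⟨fun _ _ => rfl, fun _ _ => rfl⟩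

theorem Agree.trans {l R : ℕ} {s s' s'' : Store} (h : Agree l R s s') (h' : Agree l R s' s'') :
    Agree l R s s'' :=
  ⟨fun a ha => (h'.1 a ha).trans (h.1 a ha), fun a ha => (h'.2 a ha).trans (h.2 a ha)⟩

theorem Agree.mono {l l' R : ℕ} {s s' : Store} (h : Agree l' R s s') (hl : l ≤ l') :
    Agree l R s s' := ⟨fun a ha => h.1 a (ha.trans_le hl), h.2⟩

theorem Agree.setInt {l R : ℕ} {s s' : Store} (h : Agree l R s s') {v : ℕ} (hv : l ≤ v)
    (i k : ℕ) : Agree l R s (s'.setInt v i k) := by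
  refine ⟨fun a ha => ?_, h.2⟩
  rw [← h.1 a ha]
  funext j
  simp [Store.setInt, show a ≠ v by omega]

/-- Started in `s`, the program `P` adds `g` to the real array `R`, and changes no other real array
and no integer array below `l`. -/
def Acc (m j l R : ℕ) (P : Program) (s : Store) (g : ℕ → ℝ) : Prop :=
  Ex m j P s fun s' => Agree l R s s' ∧ ∀ c, s'.real R c = s.real R c + g c

/-- `R[i] += e`. -/
def addTo (R : ℕ) (i : IntExpr) (e : RealExpr) : Program :=
  .setReal R i (.add (.load R i) e)

theorem acc_addTo {m l R : ℕ} {i : IntExpr} {e : RealExpr} {s : Store} {k : ℕ} {v : ℝ}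
    (hi : i.eval s = k) (he : e.eval s = v) :
    Acc m 0 l R (addTo R i e) s (fun c => if c = k then v else 0) := by
  refine ex_setReal ⟨⟨fun a _ => rfl, fun a ha => ?_⟩, fun c => ?_⟩
  · funext j; simp [Store.setReal, ha]
  · by_cases hc : c = k
    · simp [Store.setReal, RealExpr.eval, hi, he, hc]
    · simp [Store.setReal, hi, hc]

theorem Acc.forLoop {l R : ℕ} {N : IntExpr} {body : Program} {s : Store} {n m j : ℕ}
    {g : ℕ → ℕ → ℝ} (hN : ∀ s', Agree l R s s' → N.eval s' = n) (hn : n ≤ m) (hm : 1 ≤ m)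
    (hb : ∀ k < n, ∀ s', Agree l R s s' → s'.int l 0 = k → Acc m j (l + 1) R body s' (g k)) :
    Acc m (j + 1) l R (forLoop l N body) s (fun x => ∑ k ∈ Finset.range n, g k x) := by
  refine (ex_forLoop (n := n) hn hm (Inv := fun k s' => Agree l R s s' ∧ s'.int l 0 = k ∧
    ∀ x, s'.real R x = s.real R x + ∑ k ∈ Finset.range k, g k x) ?_ ?_ ?_).imp
      fun s' h => ⟨h.1, h.2.2⟩
  · exact ⟨(Agree.refl _ _ _).setInt le_rfl _ _, by simp [Store.setInt], by simp [Store.setInt]⟩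
  · exact fun k s' h => ⟨hN s' h.1, h.2.1⟩
  · rintro k hk s' ⟨h1, h2, h3⟩
    refine (hb k hk s' h1 h2).imp ?_
    rintro s'' ⟨h4, h5⟩
    refine ⟨by rw [h4.1 l (by omega), h2], (h1.trans (h4.mono (by omega))).setInt le_rfl _ _,
      by simp [Store.setInt], fun x => ?_⟩
    rw [Finset.sum_range_succ, ← add_assoc, ← h3]
    exact h5 x

theorem acc_nest1 {m l R n : ℕ} {N i : IntExpr} {e : RealExpr} {s : Store} {k : ℕ → ℕ} {v : ℕ → ℝ}
    (hm : 1 ≤ m) (hn : n ≤ m) (hN : ∀ s', Agree l R s s' → N.eval s' = n)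
    (h : ∀ a < n, ∀ s', Agree l R s s' → (var l).eval s' = a →
      i.eval s' = k a ∧ e.eval s' = v a) :
    Acc m 1 l R (RealRAM.forLoop l N (addTo R i e)) s
      (fun x => ∑ a ∈ Finset.range n, if x = k a then v a else 0) :=
  Acc.forLoop hN hn hm fun a ha s' h' hv => acc_addTo (h a ha s' h' hv).1 (h a ha s' h' hv).2

theorem acc_nest2 {m l R n n' : ℕ} {N N' i : IntExpr} {e : RealExpr} {s : Store} {k : ℕ → ℕ → ℕ}
    {v : ℕ → ℕ → ℝ} (hm : 1 ≤ m) (hn : n ≤ m) (hn' : n' ≤ m)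
    (hN : ∀ s', Agree l R s s' → N.eval s' = n) (hN' : ∀ s', Agree l R s s' → N'.eval s' = n')
    (h : ∀ a < n, ∀ b < n', ∀ s', Agree l R s s' → (var l).eval s' = a → (var (l + 1)).eval s' = b →
      i.eval s' = k a b ∧ e.eval s' = v a b) :
    Acc m 2 l R (RealRAM.forLoop l N (RealRAM.forLoop (l + 1) N' (addTo R i e))) s
      (fun x => ∑ a ∈ Finset.range n, ∑ b ∈ Finset.range n', if x = k a b then v a b else 0) :=
  Acc.forLoop hN hn hm fun a ha s' h' hv =>
    acc_nest1 hm hn' (fun s'' h'' => hN' s'' (h'.trans (h''.mono (by omega))))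
      fun b hb s'' h'' hv' => h a ha b hb s'' (h'.trans (h''.mono (by omega)))
        (by rw [var_eval, h''.1 l (by omega), hv]) hv'

theorem acc_nest3 {m l R n n' n'' : ℕ} {N N' N'' i : IntExpr} {e : RealExpr} {s : Store}
    {k : ℕ → ℕ → ℕ → ℕ} {v : ℕ → ℕ → ℕ → ℝ} (hm : 1 ≤ m) (hn : n ≤ m) (hn' : n' ≤ m) (hn'' : n'' ≤ m)
    (hN : ∀ s', Agree l R s s' → N.eval s' = n) (hN' : ∀ s', Agree l R s s' → N'.eval s' = n')
    (hN'' : ∀ s', Agree l R s s' → N''.eval s' = n'')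
    (h : ∀ a < n, ∀ b < n', ∀ c < n'', ∀ s', Agree l R s s' → (var l).eval s' = a →
      (var (l + 1)).eval s' = b → (var (l + 2)).eval s' = c →
      i.eval s' = k a b c ∧ e.eval s' = v a b c) :
    Acc m 3 l R (RealRAM.forLoop l N (RealRAM.forLoop (l + 1) N'
      (RealRAM.forLoop (l + 2) N'' (addTo R i e)))) s
      (fun x => ∑ a ∈ Finset.range n, ∑ b ∈ Finset.range n', ∑ c ∈ Finset.range n'',
        if x = k a b c then v a b c else 0) :=
  Acc.forLoop hN hn hm fun a ha s' h' hv =>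
    acc_nest2 hm hn' hn'' (fun _ h'' => hN' _ (h'.trans (h''.mono (by omega))))
      (fun _ h'' => hN'' _ (h'.trans (h''.mono (by omega))))
      fun b hb c hc s'' h'' hv' hv'' => h a ha b hb c hc s'' (h'.trans (h''.mono (by omega)))
        (by rw [var_eval, h''.1 l (by omega), hv]) hv' hv''

theorem row_index_inj {D a b a' b' : ℕ} (hb : b < D) (hb' : b' < D)
    (h : a * D + b = a' * D + b') : a = a' ∧ b = b' := by
  have hb2 : b = b' := by
    have := congrArg (· % D) h
    simpa [Nat.add_mod, Nat.mod_eq_of_lt hb, Nat.mod_eq_of_lt hb'] using this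
  subst hb2
  exact ⟨Nat.eq_of_mul_eq_mul_right (by omega) (by omega : a * D = a' * D), rfl⟩

theorem sum_ite_row_index {D A a b E : ℕ} (ha : a < A) (hE : E ≤ D) (hb : b < E) (f : ℕ → ℕ → ℝ) :
    ∑ a' ∈ Finset.range A, ∑ b' ∈ Finset.range E,
      (if a * D + b = a' * D + b' then f a' b' else 0) = f a b := by
  rw [Finset.sum_eq_single_of_mem a (by simpa), Finset.sum_eq_single_of_mem b (by simpa)]
  · simp
  · intro b' hb' hne
    rw [if_neg]; intro h; exact hne (by omega)
  · intro a' _ hne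
    refine Finset.sum_eq_zero fun b' hb' => if_neg fun h => hne ?_
    simp at hb'
    exact (row_index_inj (by omega) (by omega) h).1.symm

theorem sum_ite_index {A a : ℕ} (ha : a < A) (f : ℕ → ℝ) :
    ∑ a' ∈ Finset.range A, (if a = a' then f a' else 0) = f a := by
  simp [ha]

end RealRAM

/-! ## The learner as a function of the samples -/

/-- The Gram matrix of the first `m` rows of `X`. -/
def rowGram (m : ℕ) (X : ℕ → ℕ → ℝ) (a b : ℕ) : ℝ := ∑ i ∈ Finset.range m, X i a * X i b

def kron (a b : ℕ) : ℝ := if a = b then 1 else 0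

/-- The principal pivot transform of `N` at the pivot `k`. -/
noncomputable def sweepStep (N : ℕ → ℕ → ℝ) (k a b : ℕ) : ℝ :=
  N a b - (N a k + kron a k) * ((N k b - kron k b) / N k k)

/-- The principal pivot transform of `N` at the pivots `0, …, k - 1`. -/
noncomputable def sweep (N : ℕ → ℕ → ℝ) : ℕ → ℕ → ℕ → ℝ
  | 0 => N
  | k + 1 => sweepStep (sweep N k) k

/-- The value of the quadratic form `Q` at the `i`-th row of `X`. -/
def leverage (D : ℕ) (X Q : ℕ → ℕ → ℝ) (i : ℕ) : ℝ :=
  ∑ a ∈ Finset.range D, ∑ b ∈ Finset.range D, X i a * Q a b * X i b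

/-- The rows of `X` weighted with their leverages. -/
def leverageSum (D m : ℕ) (X Q : ℕ → ℕ → ℝ) (b : ℕ) : ℝ :=
  ∑ i ∈ Finset.range m, X i b * leverage D X Q i

/-- The affine functional that is fitted to the leverages. -/
noncomputable def fitted (D m : ℕ) (X : ℕ → ℕ → ℝ) (a : ℕ) : ℝ :=
  ∑ b ∈ Finset.range D, sweep (rowGram m X) D a b * leverageSum D m X (sweep (rowGram m X) D) b

/-- The value of the fitted linear functional at the `i`-th row. -/
noncomputable def score (d m : ℕ) (X : ℕ → ℕ → ℝ) (i : ℕ) : ℝ :=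
  ∑ j ∈ Finset.range d, fitted (d + 1) m X j * X i j

/-- The minimum of `f` over `[m, k)`, and `v`. -/
noncomputable def minFrom (m : ℕ) (f : ℕ → ℝ) (v : ℝ) : ℕ → ℝ
  | 0 => v
  | k + 1 => if m ≤ k ∧ f k ≤ minFrom m f v k then f k else minFrom m f v k

theorem minFrom_le (m : ℕ) (f : ℕ → ℝ) (v : ℝ) {k i : ℕ} (hi : m ≤ i) (hk : i < k) :
    minFrom m f v k ≤ f i := by
  induction k with
  | zero => omega
  | succ k ih =>
    rw [minFrom]
    split_ifs with h
    · rcases Nat.lt_succ_iff_lt_or_eq.1 hk with hk | rfl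
      · exact h.2.trans (ih hk)
      · exact le_rfl
    · rcases Nat.lt_succ_iff_lt_or_eq.1 hk with hk | rfl
      · exact ih hk
      · exact (not_le.1 fun h' => h ⟨hi, h'⟩).le

theorem minFrom_mem (m : ℕ) (f : ℕ → ℝ) (v : ℝ) (k : ℕ) :
    minFrom m f v k = v ∨ ∃ i, m ≤ i ∧ i < k ∧ minFrom m f v k = f i := by
  induction k with
  | zero => exact .inl rfl
  | succ k ih =>
    rw [minFrom]
    split_ifs with h
    · exact .inr ⟨k, h.1, by omega, rfl⟩
    · exact ih.imp id fun ⟨i, h1, h2, h3⟩ => ⟨i, h1, by omega, h3⟩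

/-- The threshold: the smallest score of the rows from `m` on. -/
noncomputable def threshold (d m n : ℕ) (X : ℕ → ℕ → ℝ) : ℝ :=
  minFrom m (score d m X) (score d m X (n - 1)) n

/-! ## The learner as a program -/

namespace RealRAM

/-- The integer cells that are fixed after the initialisation. -/
structure Ints (n d m : ℕ) (s : Store) : Prop where
  int_n : s.int 0 0 = n
  int_d : s.int 0 1 = d
  off : ∀ i ≤ n, s.int 1 i = i * (d + 1)
  offd : ∀ i ≤ n, s.int 2 i = i * d
  int_m : s.int 3 0 = m

theorem Ints.agree {n d m R : ℕ} {s s' : Store} (h : Ints n d m s) (h' : Agree 10 R s s') :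
    Ints n d m s' := by
  constructor
  · rw [h'.1 0 (by omega), h.int_n]
  · rw [h'.1 0 (by omega), h.int_d]
  · rw [h'.1 1 (by omega)]; exact h.off
  · rw [h'.1 2 (by omega)]; exact h.offd
  · rw [h'.1 3 (by omega), h.int_m]

def nE : IntExpr := .load 0 (.const 0)
def dE : IntExpr := .load 0 (.const 1)
def DE : IntExpr := .add dE (.const 1)
def mE : IntExpr := .load 3 (.const 0)
/-- The index of the entry in row `i` and column `j` of a matrix with `d + 1` columns. -/
def entry (i j : IntExpr) : IntExpr := .add (.load 1 i) j

theorem Ints.nE {n d m : ℕ} {s : Store} (h : Ints n d m s) : nE.eval s = n := h.int_n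
theorem Ints.dE {n d m : ℕ} {s : Store} (h : Ints n d m s) : dE.eval s = d := h.int_d
theorem Ints.DE {n d m : ℕ} {s : Store} (h : Ints n d m s) : DE.eval s = d + 1 := by
  simp [RealRAM.DE, RealRAM.dE, IntExpr.eval, h.int_d]
theorem Ints.mE {n d m : ℕ} {s : Store} (h : Ints n d m s) : mE.eval s = m := h.int_m
theorem Ints.entry {n d m : ℕ} {s : Store} (h : Ints n d m s) {i j : IntExpr} {a b : ℕ}
    (hi : i.eval s = a) (hj : j.eval s = b) (ha : a ≤ n) :
    (entry i j).eval s = a * (d + 1) + b := by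
  simp [RealRAM.entry, IntExpr.eval, hi, hj, h.off a ha]

/-- Transcribes the samples with a last coordinate `1`. -/
def copyPhase : Program :=
  forLoop 10 nE (forLoop 11 dE
    (addTo 3 (entry (var 10) (var 11)) (.load 1 (.add (.load 2 (var 10)) (var 11)))))

def onesPhase : Program :=
  forLoop 10 nE (addTo 3 (entry (var 10) dE) (.ofInt (.const 1)))

def gramPhase : Program :=
  forLoop 10 mE (forLoop 11 DE (forLoop 12 DE
    (addTo 4 (entry (var 11) (var 12))
      (.mul (.load 3 (entry (var 10) (var 11))) (.load 3 (entry (var 10) (var 12)))))))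

def onePhase : Program :=
  forLoop 10 DE (addTo 5 (entry (var 10) (var 10)) (.ofInt (.const 1)))

/-- One principal pivot transform, with pivot `var 10`. -/
def pivotPhase : Program :=
  .seq (forLoop 11 DE (addTo 6 (entry (var 10) (var 11))
      (.add (.load 4 (entry (var 11) (var 10))) (.load 5 (entry (var 11) (var 10))))))
  (.seq (forLoop 11 DE (addTo 7 (entry (var 10) (var 11))
      (.div (.sub (.load 4 (entry (var 10) (var 11))) (.load 5 (entry (var 10) (var 11))))
        (.load 4 (entry (var 10) (var 10))))))
    (forLoop 11 DE (forLoop 12 DE (addTo 4 (entry (var 11) (var 12))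
      (.sub (.ofInt (.const 0)) (.mul (.load 6 (entry (var 10) (var 11)))
        (.load 7 (entry (var 10) (var 12)))))))))

def sweepPhase : Program := forLoop 10 DE pivotPhase

def leveragePhase : Program :=
  forLoop 10 mE (forLoop 11 DE (forLoop 12 DE
    (addTo 8 (var 10) (.mul (.mul (.load 3 (entry (var 10) (var 11)))
      (.load 4 (entry (var 11) (var 12)))) (.load 3 (entry (var 10) (var 12)))))))

def leverageSumPhase : Program :=
  forLoop 10 mE (forLoop 11 DE (addTo 9 (var 11)
    (.mul (.load 3 (entry (var 10) (var 11))) (.load 8 (var 10)))))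

def fittedPhase : Program :=
  forLoop 10 DE (forLoop 11 DE (addTo 2 (var 10)
    (.mul (.load 4 (entry (var 10) (var 11))) (.load 9 (var 11)))))

def scorePhase : Program :=
  forLoop 10 nE (forLoop 11 dE (addTo 10 (var 10)
    (.mul (.load 2 (var 11)) (.load 3 (entry (var 10) (var 11))))))

theorem Agree.var {l R v : ℕ} {s s' : Store} (h : Agree l R s s') (hv : v < l) :
    (RealRAM.var v).eval s' = (RealRAM.var v).eval s := by
  rw [var_eval, var_eval, h.1 v hv]

theorem copyPhase_spec {n d m : ℕ} {s : Store} {x : ℕ → ℕ → ℝ} (hs : Ints n d m s)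
    (hn : 1 ≤ n) (hdn : d + 1 ≤ n) (hx : ∀ i < n, ∀ a < d, s.real 1 (i * d + a) = x i a) :
    Ex n 2 copyPhase s fun s' => Agree 10 3 s s' ∧
      (∀ i < n, ∀ a < d, s'.real 3 (i * (d + 1) + a) = s.real 3 (i * (d + 1) + a) + x i a) ∧
      ∀ i < n, s'.real 3 (i * (d + 1) + d) = s.real 3 (i * (d + 1) + d) := by
  refine (acc_nest2 (k := fun i a => i * (d + 1) + a) (v := fun i a => x i a) hn le_rfl
    (by omega) (fun s' h => (hs.agree h).nE) (fun s' h => (hs.agree h).dE)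
    fun i hi a ha s' h v1 v2 => ?_).imp fun s' h => ⟨h.1, fun i hi a ha => ?_, fun i hi => ?_⟩
  · have hs' := hs.agree h
    refine ⟨hs'.entry v1 v2 (by omega), ?_⟩
    simp [RealExpr.eval, IntExpr.eval, v1, v2, hs'.offd i hi.le, h.2 1, hx i hi a ha]
  · rw [h.2]; beta_reduce; rw [sum_ite_row_index (D := d + 1) hi (by omega) ha (fun i a => x i a)]
  · rw [h.2]; beta_reduce; rw [add_eq_left]
    refine Finset.sum_eq_zero fun i' _ => Finset.sum_eq_zero fun a ha => if_neg fun h => ?_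
    simp only [Finset.mem_range] at ha
    have := (row_index_inj (by omega) (by omega) h).2
    omega

theorem onesPhase_spec {n d m : ℕ} {s : Store} (hs : Ints n d m s) (hn : 1 ≤ n) :
    Ex n 1 onesPhase s fun s' => Agree 10 3 s s' ∧
      (∀ i < n, ∀ a < d, s'.real 3 (i * (d + 1) + a) = s.real 3 (i * (d + 1) + a)) ∧
      ∀ i < n, s'.real 3 (i * (d + 1) + d) = s.real 3 (i * (d + 1) + d) + 1 := by
  refine (acc_nest1 (k := fun i => i * (d + 1) + d) (v := fun _ => 1) hn le_rfl
    (fun s' h => (hs.agree h).nE) fun i hi s' h v1 => ?_).imp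
    fun s' h => ⟨h.1, fun i hi a ha => ?_, fun i hi => ?_⟩
  · have hs' := hs.agree h
    exact ⟨hs'.entry v1 hs'.dE (by omega), by simp [RealExpr.eval, IntExpr.eval]⟩
  · rw [h.2]; beta_reduce; rw [add_eq_left]
    refine Finset.sum_eq_zero fun i' _ => if_neg fun h => ?_
    have := (row_index_inj (by omega) (by omega) h).2
    omega
  · rw [h.2]; beta_reduce; rw [Finset.sum_eq_single_of_mem i (by simpa)]
    · simp
    · intro i' _ hne
      exact if_neg fun h => hne (row_index_inj (by omega) (by omega) h).1.symm

theorem gramPhase_spec {n d m : ℕ} {s : Store} {X : ℕ → ℕ → ℝ} (hs : Ints n d m s)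
    (hn : 1 ≤ n) (hdn : d + 1 ≤ n) (hmn : m ≤ n)
    (hX : ∀ i < n, ∀ a < d + 1, s.real 3 (i * (d + 1) + a) = X i a) :
    Ex n 3 gramPhase s fun s' => Agree 10 4 s s' ∧
      ∀ a < d + 1, ∀ b < d + 1,
        s'.real 4 (a * (d + 1) + b) = s.real 4 (a * (d + 1) + b) + rowGram m X a b := by
  refine (acc_nest3 (k := fun _ a b => a * (d + 1) + b) (v := fun i a b => X i a * X i b) hn hmn
    hdn hdn (fun s' h => (hs.agree h).mE) (fun s' h => (hs.agree h).DE)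
    (fun s' h => (hs.agree h).DE) fun i hi a ha b hb s' h v1 v2 v3 => ?_).imp
    fun s' h => ⟨h.1, fun a ha b hb => ?_⟩
  · have hs' := hs.agree h
    refine ⟨hs'.entry v2 v3 (by omega), ?_⟩
    simp only [RealExpr.eval, hs'.entry v1 v2 (by omega), hs'.entry v1 v3 (by omega),
      h.2 3 (by omega), hX i (by omega) a ha, hX i (by omega) b hb]
  · rw [h.2]; beta_reduce; rw [rowGram]
    congr 1
    refine Finset.sum_congr rfl fun i _ => ?_
    exact sum_ite_row_index (f := fun a b => X i a * X i b) ha le_rfl hb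

theorem onePhase_spec {n d m : ℕ} {s : Store} (hs : Ints n d m s) (hn : 1 ≤ n) (hdn : d + 1 ≤ n) :
    Ex n 1 onePhase s fun s' => Agree 10 5 s s' ∧
      ∀ a < d + 1, ∀ b < d + 1,
        s'.real 5 (a * (d + 1) + b) = s.real 5 (a * (d + 1) + b) + kron a b := by
  refine (acc_nest1 (k := fun a => a * (d + 1) + a) (v := fun _ => 1) hn hdn
    (fun s' h => (hs.agree h).DE) fun a ha s' h v1 => ?_).imp
    fun s' h => ⟨h.1, fun a ha b hb => ?_⟩
  · exact ⟨(hs.agree h).entry v1 v1 (by omega), by simp [RealExpr.eval, IntExpr.eval]⟩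
  · rw [h.2]; beta_reduce; rw [kron]
    rw [add_right_inj, Finset.sum_eq_single_of_mem a (Finset.mem_range.2 ha)]
    · simp [eq_comm]
    · intro a' ha' hne
      simp only [Finset.mem_range] at ha'
      exact if_neg fun h => hne (row_index_inj hb ha' h).1.symm

theorem leveragePhase_spec {n d m : ℕ} {s : Store} {X Q : ℕ → ℕ → ℝ} (hs : Ints n d m s)
    (hn : 1 ≤ n) (hdn : d + 1 ≤ n) (hmn : m ≤ n)
    (hX : ∀ i < n, ∀ a < d + 1, s.real 3 (i * (d + 1) + a) = X i a)
    (hQ : ∀ a < d + 1, ∀ b < d + 1, s.real 4 (a * (d + 1) + b) = Q a b) :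
    Ex n 3 leveragePhase s fun s' => Agree 10 8 s s' ∧
      ∀ i < m, s'.real 8 i = s.real 8 i + leverage (d + 1) X Q i := by
  refine (acc_nest3 (k := fun i _ _ => i) (v := fun i a b => X i a * Q a b * X i b) hn hmn
    hdn hdn (fun s' h => (hs.agree h).mE) (fun s' h => (hs.agree h).DE)
    (fun s' h => (hs.agree h).DE) fun i hi a ha b hb s' h v1 v2 v3 => ⟨v1, ?_⟩).imp
    fun s' h => ⟨h.1, fun i hi => ?_⟩
  · have hs' := hs.agree h
    simp only [RealExpr.eval, hs'.entry v1 v2 (by omega), hs'.entry v1 v3 (by omega),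
      hs'.entry v2 v3 (by omega),
      h.2 3 (by omega), h.2 4 (by omega), hX i (by omega) a ha, hX i (by omega) b hb, hQ a ha b hb]
  · rw [h.2]; beta_reduce; rw [leverage]
    rw [add_right_inj, Finset.sum_eq_single_of_mem i (by simpa)]
    · simp
    · intro i' _ hne
      exact Finset.sum_eq_zero fun a _ => Finset.sum_eq_zero fun b _ => if_neg hne.symm

theorem leverageSumPhase_spec {n d m : ℕ} {s : Store} {X : ℕ → ℕ → ℝ} {f : ℕ → ℝ}
    (hs : Ints n d m s) (hn : 1 ≤ n) (hdn : d + 1 ≤ n) (hmn : m ≤ n)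
    (hX : ∀ i < n, ∀ a < d + 1, s.real 3 (i * (d + 1) + a) = X i a)
    (hf : ∀ i < m, s.real 8 i = f i) :
    Ex n 2 leverageSumPhase s fun s' => Agree 10 9 s s' ∧
      ∀ b < d + 1, s'.real 9 b = s.real 9 b + ∑ i ∈ Finset.range m, X i b * f i := by
  refine (acc_nest2 (k := fun _ b => b) (v := fun i b => X i b * f i) hn hmn
    hdn (fun s' h => (hs.agree h).mE) (fun s' h => (hs.agree h).DE)
    fun i hi b hb s' h v1 v2 => ⟨v2, ?_⟩).imp fun s' h => ⟨h.1, fun b hb => ?_⟩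
  · have hs' := hs.agree h
    simp only [RealExpr.eval, hs'.entry v1 v2 (by omega), v1,
      h.2 3 (by omega), h.2 8 (by omega), hX i (by omega) b hb, hf i hi]
  · rw [h.2]; beta_reduce
    congr 1
    exact Finset.sum_congr rfl fun i _ => sum_ite_index hb fun b => X i b * f i

theorem fittedPhase_spec {n d m : ℕ} {s : Store} {Q : ℕ → ℕ → ℝ} {f : ℕ → ℝ}
    (hs : Ints n d m s) (hn : 1 ≤ n) (hdn : d + 1 ≤ n)
    (hQ : ∀ a < d + 1, ∀ b < d + 1, s.real 4 (a * (d + 1) + b) = Q a b)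
    (hf : ∀ b < d + 1, s.real 9 b = f b) :
    Ex n 2 fittedPhase s fun s' => Agree 10 2 s s' ∧
      ∀ a < d + 1, s'.real 2 a = s.real 2 a + ∑ b ∈ Finset.range (d + 1), Q a b * f b := by
  refine (acc_nest2 (k := fun a _ => a) (v := fun a b => Q a b * f b) hn hdn
    hdn (fun s' h => (hs.agree h).DE) (fun s' h => (hs.agree h).DE)
    fun a ha b hb s' h v1 v2 => ⟨v1, ?_⟩).imp fun s' h => ⟨h.1, fun a ha => ?_⟩
  · have hs' := hs.agree h
    simp only [RealExpr.eval, hs'.entry v1 v2 (by omega), v2,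
      h.2 4 (by omega), h.2 9 (by omega), hQ a ha b hb, hf b hb]
  · rw [h.2]; beta_reduce; rw [Finset.sum_comm]
    congr 1
    exact Finset.sum_congr rfl fun b _ => sum_ite_index ha fun a => Q a b * f b

theorem scorePhase_spec {n d m : ℕ} {s : Store} {X : ℕ → ℕ → ℝ} {w : ℕ → ℝ}
    (hs : Ints n d m s) (hn : 1 ≤ n) (hdn : d + 1 ≤ n)
    (hX : ∀ i < n, ∀ a < d + 1, s.real 3 (i * (d + 1) + a) = X i a)
    (hw : ∀ j < d, s.real 2 j = w j) :
    Ex n 2 scorePhase s fun s' => Agree 10 10 s s' ∧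
      ∀ i < n, s'.real 10 i = s.real 10 i + ∑ j ∈ Finset.range d, w j * X i j := by
  refine (acc_nest2 (k := fun i _ => i) (v := fun i j => w j * X i j) hn le_rfl
    (by omega) (fun s' h => (hs.agree h).nE) (fun s' h => (hs.agree h).dE)
    fun i hi j hj s' h v1 v2 => ⟨v1, ?_⟩).imp fun s' h => ⟨h.1, fun i hi => ?_⟩
  · have hs' := hs.agree h
    simp only [RealExpr.eval, hs'.entry v1 v2 (by omega), v2,
      h.2 2 (by omega), h.2 3 (by omega), hX i hi j (by omega), hw j hj]
  · rw [h.2]; beta_reduce; rw [Finset.sum_comm]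
    congr 1
    exact Finset.sum_congr rfl fun j _ => sum_ite_index hi fun i => w j * X i j

end RealRAM

namespace RealRAM

theorem rowAcc_spec {R n d m k : ℕ} {s : Store} {e : RealExpr} {v : ℕ → ℝ} (hs : Ints n d m s)
    (hn : 1 ≤ n) (hdn : d + 1 ≤ n) (hk : k < d + 1) (hv : (var 10).eval s = k)
    (h0 : ∀ c, k * (d + 1) ≤ c → s.real R c = 0)
    (he : ∀ a < d + 1, ∀ s', Agree 11 R s s' → (var 11).eval s' = a → e.eval s' = v a) :
    Ex n 1 (forLoop 11 DE (addTo R (entry (var 10) (var 11)) e)) s fun s' => Agree 11 R s s' ∧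
      (∀ a < d + 1, s'.real R (k * (d + 1) + a) = v a) ∧
      ∀ c, (k + 1) * (d + 1) ≤ c → s'.real R c = 0 := by
  refine (acc_nest1 (k := fun a => k * (d + 1) + a) (v := v) hn hdn
    (fun s' h => (hs.agree (h.mono (by omega))).DE)
    fun a ha s' h v1 => ⟨?_, he a ha s' h v1⟩).imp
    fun s' h => ⟨h.1, fun a ha => ?_, fun c hc => ?_⟩
  · exact (hs.agree (h.mono (by omega))).entry ((h.var (by omega)).trans hv) v1 (by omega)
  · rw [h.2, h0 _ (by omega), zero_add]; beta_reduce
    rw [Finset.sum_eq_single_of_mem a (Finset.mem_range.2 ha)]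
    · simp
    · exact fun b _ hne => if_neg fun h => hne (by omega)
  · rw [h.2, h0 c (by rw [Nat.succ_mul] at hc; omega), zero_add]; beta_reduce
    refine Finset.sum_eq_zero fun b hb => if_neg fun h => ?_
    simp only [Finset.mem_range] at hb
    rw [Nat.succ_mul] at hc; omega

theorem pivotPhase_spec {n d m k : ℕ} {s : Store} {N : ℕ → ℕ → ℝ} (hs : Ints n d m s)
    (hn : 1 ≤ n) (hdn : d + 1 ≤ n) (hk : k < d + 1) (hv : (var 10).eval s = k)
    (hN : ∀ a < d + 1, ∀ b < d + 1, s.real 4 (a * (d + 1) + b) = N a b)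
    (hI : ∀ a < d + 1, ∀ b < d + 1, s.real 5 (a * (d + 1) + b) = kron a b)
    (h6 : ∀ c, k * (d + 1) ≤ c → s.real 6 c = 0) (h7 : ∀ c, k * (d + 1) ≤ c → s.real 7 c = 0) :
    Ex n 2 pivotPhase s fun s' => (∀ a < 11, s'.int a = s.int a) ∧
      (∀ R, R ≠ 4 → R ≠ 6 → R ≠ 7 → s'.real R = s.real R) ∧
      (∀ a < d + 1, ∀ b < d + 1, s'.real 4 (a * (d + 1) + b) = sweepStep N k a b) ∧
      (∀ c, (k + 1) * (d + 1) ≤ c → s'.real 6 c = 0) ∧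
      ∀ c, (k + 1) * (d + 1) ≤ c → s'.real 7 c = 0 := by
  have e1 := rowAcc_spec (R := 6) (v := fun a => N a k + kron a k)
    (e := .add (.load 4 (entry (var 11) (var 10))) (.load 5 (entry (var 11) (var 10)))) hs hn hdn hk
    hv h6 fun a ha s' h v1 => by
      have hs' := hs.agree (h.mono (show 10 ≤ 11 by omega))
      simp only [RealExpr.eval, hs'.entry v1 ((h.var (by omega)).trans hv) (by omega),
        h.2 4 (by omega), h.2 5 (by omega), hN a ha k hk, hI a ha k hk]
  refine (e1.mono hn (by omega) fun _ => id).seq ?_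
  rintro s₁ ⟨g₁, r₁, z₁⟩
  have hs₁ := hs.agree (g₁.mono (show 10 ≤ 11 by omega))
  have hv₁ := (g₁.var (show 10 < 11 by omega)).trans hv
  have e2 := rowAcc_spec (R := 7) (v := fun b => (N k b - kron k b) / N k k)
    (e := .div (.sub (.load 4 (entry (var 10) (var 11))) (.load 5 (entry (var 10) (var 11))))
        (.load 4 (entry (var 10) (var 10)))) hs₁ hn hdn hk
    hv₁ (by rwa [g₁.2 7 (by omega)]) fun a ha s' h v1 => by
      have hs' := hs₁.agree (h.mono (show 10 ≤ 11 by omega))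
      have v0 := (h.var (show 10 < 11 by omega)).trans hv₁
      simp only [RealExpr.eval, hs'.entry v0 v1 (by omega), hs'.entry v0 v0 (by omega),
        h.2 4 (by omega), h.2 5 (by omega), g₁.2 4 (by omega), g₁.2 5 (by omega),
        hN k hk a ha, hI k hk a ha, hN k hk k hk]
  refine (e2.mono hn (by omega) fun _ => id).seq ?_
  rintro s₂ ⟨g₂, r₂, z₂⟩
  have hs₂ := hs₁.agree (g₂.mono (show 10 ≤ 11 by omega))
  have hv₂ := (g₂.var (show 10 < 11 by omega)).trans hv₁
  have e3 := acc_nest2 (l := 11) (R := 4) (s := s₂) (k := fun a b => a * (d + 1) + b)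
    (v := fun a b => 0 - (N a k + kron a k) * ((N k b - kron k b) / N k k))
    (i := entry (var 11) (var 12))
    (e := .sub (.ofInt (.const 0)) (.mul (.load 6 (entry (var 10) (var 11)))
        (.load 7 (entry (var 10) (var 12))))) hn hdn hdn
    (fun s' h => (hs₂.agree (h.mono (by omega))).DE)
    (fun s' h => (hs₂.agree (h.mono (by omega))).DE) fun a ha b hb s' h v1 v2 => by
      have hs' := hs₂.agree (h.mono (show 10 ≤ 11 by omega))
      have v0 := (h.var (show 10 < 11 by omega)).trans hv₂
      refine ⟨hs'.entry v1 v2 (by omega), ?_⟩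
      simp only [RealExpr.eval, IntExpr.eval, hs'.entry v0 v1 (by omega), hs'.entry v0 v2 (by omega),
        h.2 6 (by omega), h.2 7 (by omega), g₂.2 6 (by omega), r₁ a ha, r₂ b hb, Nat.cast_zero]
  refine e3.imp ?_
  rintro s₃ ⟨g₃, r₃⟩
  refine ⟨fun a ha => ?_, fun R h4 h6 h7 => ?_, fun a ha b hb => ?_, fun c hc => ?_, fun c hc => ?_⟩
  · rw [g₃.1 a ha, g₂.1 a ha, g₁.1 a ha]
  · rw [g₃.2 R h4, g₂.2 R h7, g₁.2 R h6]
  · rw [r₃, g₂.2 4 (by omega), g₁.2 4 (by omega), hN a ha b hb]; beta_reduce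
    rw [sum_ite_row_index ha le_rfl hb
      fun a b => 0 - (N a k + kron a k) * ((N k b - kron k b) / N k k), sweepStep]
    ring
  · rw [g₃.2 6 (by omega), g₂.2 6 (by omega), z₁ c hc]
  · rw [g₃.2 7 (by omega), z₂ c hc]

theorem Ints.congr {n d m : ℕ} {s s' : Store} (h : Ints n d m s)
    (h' : ∀ a < 10, s'.int a = s.int a) : Ints n d m s' :=
  h.agree (s' := ⟨s'.int, s.real⟩) (R := 0) ⟨h', fun _ _ => rfl⟩ |> fun h =>
    ⟨h.int_n, h.int_d, h.off, h.offd, h.int_m⟩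

theorem sweepPhase_spec {n d m : ℕ} {s : Store} {N : ℕ → ℕ → ℝ} (hs : Ints n d m s)
    (hn : 1 ≤ n) (hdn : d + 1 ≤ n)
    (hN : ∀ a < d + 1, ∀ b < d + 1, s.real 4 (a * (d + 1) + b) = N a b)
    (hI : ∀ a < d + 1, ∀ b < d + 1, s.real 5 (a * (d + 1) + b) = kron a b)
    (h6 : ∀ c, s.real 6 c = 0) (h7 : ∀ c, s.real 7 c = 0) :
    Ex n 3 sweepPhase s fun s' => (∀ a < 10, s'.int a = s.int a) ∧
      (∀ R, R ≠ 4 → R ≠ 6 → R ≠ 7 → s'.real R = s.real R) ∧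
      (∀ a < d + 1, ∀ b < d + 1, s'.real 4 (a * (d + 1) + b) = sweep N (d + 1) a b) := by
  refine (ex_forLoop hdn hn (Inv := fun k s' => s'.int 10 0 = k ∧ (∀ a < 10, s'.int a = s.int a) ∧
      (∀ R, R ≠ 4 → R ≠ 6 → R ≠ 7 → s'.real R = s.real R) ∧
      (∀ a < d + 1, ∀ b < d + 1, s'.real 4 (a * (d + 1) + b) = sweep N k a b) ∧
      (∀ c, k * (d + 1) ≤ c → s'.real 6 c = 0) ∧
      ∀ c, k * (d + 1) ≤ c → s'.real 7 c = 0) ?_ ?_ ?_).imp fun s' h => ⟨h.2.1, h.2.2.1, h.2.2.2.1⟩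
  · refine ⟨by simp [Store.setInt], fun a ha => ?_, fun _ _ _ _ => rfl, hN, fun c _ => h6 c,
      fun c _ => h7 c⟩
    funext j; simp [Store.setInt, show a ≠ 10 by omega]
  · rintro k s' ⟨h1, h2, h3⟩
    exact ⟨(hs.congr h2).DE, h1⟩
  · rintro k hk s' ⟨h1, h2, h3, h4, h5, h5'⟩
    refine (pivotPhase_spec (hs.congr h2) hn hdn hk h1 h4 (by
      rwa [h3 5 (by omega) (by omega) (by omega)]) h5 h5').imp ?_
    rintro s'' ⟨g1, g2, g3, g4, g5⟩
    refine ⟨by rw [g1 10 (by omega), h1], by simp [Store.setInt], fun a ha => ?_,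
      fun R h4 h6 h7 => (g2 R h4 h6 h7).trans (h3 R h4 h6 h7), g3, g4, g5⟩
    rw [← h2 a ha, ← g1 a (by omega)]
    funext j; simp [Store.setInt, show a ≠ 10 by omega]

/-- Fills the integer array `a` with the multiples of `e`. -/
def multiplesPhase (a : ℕ) (e : IntExpr) : Program :=
  forLoop 10 nE (.setInt a (.add (var 10) (.const 1)) (.add (.load a (var 10)) e))

theorem multiplesPhase_spec {a n E : ℕ} {e : IntExpr} {s : Store} (ha : a = 1 ∨ a = 2) (hn : 1 ≤ n)
    (hsn : s.int 0 0 = n) (h0 : s.int a 0 = 0)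
    (he : ∀ s', s'.int 0 = s.int 0 → e.eval s' = E) :
    Ex n 1 (multiplesPhase a e) s fun s' => (∀ b < 10, b ≠ a → s'.int b = s.int b) ∧
      s'.real = s.real ∧ ∀ i ≤ n, s'.int a i = i * E := by
  refine (ex_forLoop le_rfl hn (Inv := fun k s' => s'.int 10 0 = k ∧
    (∀ b < 10, b ≠ a → s'.int b = s.int b) ∧ s'.real = s.real ∧ ∀ i ≤ k, s'.int a i = i * E)
    ?_ ?_ ?_).imp fun s' h => h.2
  · refine ⟨by simp [Store.setInt], fun b hb _ => ?_, rfl, fun i hi => ?_⟩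
    · funext j; simp [Store.setInt, show b ≠ 10 by omega]
    · obtain rfl : i = 0 := by omega
      simp [Store.setInt, show a ≠ 10 by omega, h0]
  · rintro k s' ⟨h1, h2, h3⟩
    exact ⟨by rw [nE, IntExpr.eval, IntExpr.eval, h2 0 (by omega) (by omega), hsn], h1⟩
  · rintro k hk s' ⟨h1, h2, h3, h4⟩
    have e0 : e.eval s' = E := he s' (h2 0 (by omega) (by omega))
    refine ex_setInt ?_
    refine ⟨?_, ?_, fun b hb hba => ?_, h3, fun i hi => ?_⟩
    · simp [Store.setInt, h1, show 10 ≠ a by omega]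
    · simp [Store.setInt]
    · rw [← h2 b hb hba]
      funext j; simp [Store.setInt, show b ≠ 10 by omega, hba]
    · simp only [Store.setInt, IntExpr.eval, var_eval, h1, e0, h4 k le_rfl,
        show a ≠ 10 by omega, false_and, if_false, true_and]
      split_ifs with hik
      · rw [hik]; ring
      · exact h4 i (by omega)

/-- Computes `⌈n / 2⌉`. -/
def halfPhase : Program :=
  forLoop 10 nE (.setInt 3 (.const 0) (.sub (.add (var 10) (.const 1)) mE))

theorem halfPhase_spec {n : ℕ} {s : Store} (hn : 1 ≤ n) (hsn : s.int 0 0 = n)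
    (h0 : s.int 3 0 = 0) :
    Ex n 1 halfPhase s fun s' => (∀ b < 10, b ≠ 3 → s'.int b = s.int b) ∧
      s'.real = s.real ∧ s'.int 3 0 = (n + 1) / 2 := by
  refine (ex_forLoop le_rfl hn (Inv := fun k s' => s'.int 10 0 = k ∧
    (∀ b < 10, b ≠ 3 → s'.int b = s.int b) ∧ s'.real = s.real ∧ s'.int 3 0 = (k + 1) / 2)
    ?_ ?_ ?_).imp fun s' h => h.2
  · refine ⟨by simp [Store.setInt], fun b hb _ => ?_, rfl, by simp [Store.setInt, h0]⟩
    funext j; simp [Store.setInt, show b ≠ 10 by omega]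
  · rintro k s' ⟨h1, h2, h3⟩
    exact ⟨by rw [nE, IntExpr.eval, IntExpr.eval, h2 0 (by omega) (by omega), hsn], h1⟩
  · rintro k hk s' ⟨h1, h2, h3, h4⟩
    refine ex_setInt ?_
    refine ⟨by simp [Store.setInt, h1], by simp [Store.setInt], fun b hb hba => ?_, h3, ?_⟩
    · rw [← h2 b hb hba]
      funext j; simp [Store.setInt, show b ≠ 10 by omega, hba]
    · simp [Store.setInt, IntExpr.eval, var_eval, h1, mE, h4]; omega

/-- Replaces `out[d]` by the smallest score of the rows from `m` on. -/
def thresholdPhase : Program :=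
  .seq (.setReal 2 dE (.load 10 (.sub nE (.const 1))))
    (forLoop 10 nE (.ite (.intLE mE (var 10))
      (.ite (.realLE (.load 10 (var 10)) (.load 2 dE)) (.setReal 2 dE (.load 10 (var 10))) .skip)
      .skip))

theorem thresholdPhase_spec {n d m : ℕ} {s : Store} {f : ℕ → ℝ} (hs : Ints n d m s)
    (hn : 1 ≤ n) (hf : ∀ i < n, s.real 10 i = f i) :
    Ex n 1 thresholdPhase s fun s' => (∀ j < d, s'.real 2 j = s.real 2 j) ∧
      s'.real 2 d = minFrom m f (f (n - 1)) n := by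
  refine Ex.seq (Q := fun s' => (∀ a, s'.int a = s.int a) ∧ (∀ j < d, s'.real 2 j = s.real 2 j) ∧
    s'.real 2 d = f (n - 1) ∧ s'.real 10 = s.real 10) ?_ ?_
  · refine Ex.mono (ex_setReal ⟨fun _ => rfl, fun j hj => ?_, ?_, ?_⟩) hn (Nat.zero_le 1) fun _ => id
    · simp [Store.setReal, hs.dE, hj.ne]
    · simp [Store.setReal, hs.dE, RealExpr.eval, IntExpr.eval, hs.nE, hf (n - 1) (by omega)]
    · funext j; simp [Store.setReal]
  rintro s₁ ⟨g1, g2, g3, g4⟩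
  refine (ex_forLoop le_rfl hn (Inv := fun k s' => s'.int 10 0 = k ∧
    (∀ a < 10, s'.int a = s.int a) ∧ (∀ j < d, s'.real 2 j = s.real 2 j) ∧
    s'.real 10 = s.real 10 ∧ s'.real 2 d = minFrom m f (f (n - 1)) k) ?_ ?_ ?_).imp
    fun s' h => ⟨h.2.2.1, h.2.2.2.2⟩
  · refine ⟨by simp [Store.setInt], fun a ha => ?_, g2, g4, g3⟩
    rw [← g1]
    funext j; simp [Store.setInt, show a ≠ 10 by omega]
  · rintro k s' ⟨h1, h2, h3⟩
    exact ⟨(hs.congr h2).nE, h1⟩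
  · rintro k hk s' ⟨h1, h2, h3, h4, h5⟩
    have hs' := hs.congr h2
    have keep : s'.int 10 0 = k → minFrom m f (f (n - 1)) (k + 1) = minFrom m f (f (n - 1)) k →
        s'.int 10 0 = k ∧ (fun s' : Store => (s'.int 10 0 = k + 1 ∧
          (∀ a < 10, s'.int a = s.int a) ∧ (∀ j < d, s'.real 2 j = s.real 2 j) ∧
          s'.real 10 = s.real 10 ∧ s'.real 2 d = minFrom m f (f (n - 1)) (k + 1)))
          (s'.setInt 10 0 (k + 1)) := by
      intro _ hmin
      refine ⟨h1, by simp [Store.setInt], fun a ha => ?_, h3, h4, by rw [hmin]; exact h5⟩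
      rw [← h2 a ha]
      funext j; simp [Store.setInt, show a ≠ 10 by omega]
    refine ex_ite (fun hb => ex_ite (fun hb' => ex_setReal ?_) fun hb' => ex_skip (keep h1 ?_))
      fun hb => ex_skip (keep h1 ?_)
    · simp only [Test.Holds, hs'.mE, var_eval, h1, RealExpr.eval, hs'.dE, h4, h5, hf k hk]
        at hb hb' ⊢
      refine ⟨h1, by simp [Store.setInt], fun a ha => ?_, fun j hj => ?_, ?_, ?_⟩
      · rw [← h2 a ha]
        funext j; simp [Store.setInt, Store.setReal, show a ≠ 10 by omega]
      · simp [Store.setInt, Store.setReal, hj.ne, h3 j hj]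
      · rw [← h4]; funext j; simp [Store.setInt, Store.setReal]
      · simp [Store.setInt, Store.setReal, minFrom, hb, hb']
    · simp only [Test.Holds, var_eval, h1, RealExpr.eval, hs'.dE, h4, h5, hf k hk] at hb'
      rw [minFrom, if_neg fun h => hb' h.2]
    · simp only [Test.Holds, hs'.mE, var_eval, h1] at hb
      rw [minFrom, if_neg fun h => hb h.1]

/-- The learner. -/
def learner : Program :=
  .seq (multiplesPhase 1 DE) <| .seq (multiplesPhase 2 dE) <| .seq halfPhase <|
  .seq copyPhase <| .seq onesPhase <| .seq gramPhase <| .seq onePhase <| .seq sweepPhase <|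
  .seq leveragePhase <| .seq leverageSumPhase <| .seq fittedPhase <| .seq scorePhase
  thresholdPhase

theorem learner_spec {n d : ℕ} {s : Store} {X : ℕ → ℕ → ℝ} (hn : 1 ≤ n) (hdn : d + 1 ≤ n)
    (h00 : s.int 0 0 = n) (h01 : s.int 0 1 = d) (hint : ∀ a i, 1 ≤ a → s.int a i = 0)
    (hreal : ∀ a i, 2 ≤ a → s.real a i = 0)
    (hX : ∀ i < n, ∀ j < d, s.real 1 (i * d + j) = X i j) (hX1 : ∀ i < n, X i d = 1) :
    Ex n 3 learner s fun s' => (∀ j < d, s'.real 2 j = fitted (d + 1) ((n + 1) / 2) X j) ∧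
      s'.real 2 d = threshold d ((n + 1) / 2) n X := by
  have hm : (n + 1) / 2 ≤ n := by omega
  refine Ex.seq ((multiplesPhase_spec (E := d + 1) (.inl rfl) hn h00 (hint 1 0 le_rfl) ?_).mono hn
    (by omega) fun _ => id) ?_
  · intro s' h'; simp [DE, dE, IntExpr.eval, h', h01]
  rintro s₁ ⟨i₁, r₁, o₁⟩
  refine Ex.seq ((multiplesPhase_spec (E := d) (.inr rfl) hn
    (by rw [i₁ 0 (by omega) (by omega), h00])
    (by rw [i₁ 2 (by omega) (by omega), hint 2 0 (by omega)]) ?_).mono hn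
    (by omega) fun _ => id) ?_
  · intro s' h'; simp [dE, IntExpr.eval, h', i₁ 0, h01]
  rintro s₂ ⟨i₂, r₂, o₂⟩
  refine Ex.seq ((halfPhase_spec hn
    (by rw [i₂ 0 (by omega) (by omega), i₁ 0 (by omega) (by omega), h00])
    (by rw [i₂ 3 (by omega) (by omega), i₁ 3 (by omega) (by omega), hint 3 0 (by omega)])).mono hn
    (by omega) fun _ => id) ?_
  rintro s₃ ⟨i₃, r₃, o₃⟩
  obtain ⟨m, hmdef⟩ : ∃ m, m = (n + 1) / 2 := ⟨_, rfl⟩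
  rw [← hmdef] at hm o₃ ⊢
  have I₃ : Ints n d m s₃ := by
    constructor
    · rw [i₃ 0 (by omega) (by omega), i₂ 0 (by omega) (by omega), i₁ 0 (by omega) (by omega), h00]
    · rw [i₃ 0 (by omega) (by omega), i₂ 0 (by omega) (by omega), i₁ 0 (by omega) (by omega), h01]
    · rw [i₃ 1 (by omega) (by omega), i₂ 1 (by omega) (by omega)]; exact o₁
    · rw [i₃ 2 (by omega) (by omega)]; exact o₂
    · exact o₃
  have R₃ : s₃.real = s.real := by rw [r₃, r₂, r₁]
  refine Ex.seq ((copyPhase_spec (x := X) I₃ hn hdn (by rwa [R₃])).mono hn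
    (by omega) fun _ => id) ?_
  rintro s₄ ⟨g₄, x₄, y₄⟩
  have I₄ := I₃.agree g₄
  refine Ex.seq ((onesPhase_spec I₄ hn).mono hn (by omega) fun _ => id) ?_
  rintro s₅ ⟨g₅, x₅, y₅⟩
  have I₅ := I₄.agree g₅
  have hX₅ : ∀ i < n, ∀ a < d + 1, s₅.real 3 (i * (d + 1) + a) = X i a := by
    intro i hi a ha
    rcases Nat.lt_succ_iff_lt_or_eq.1 ha with ha | rfl
    · rw [x₅ i hi a ha, x₄ i hi a ha, R₃, hreal 3 _ (by omega), zero_add]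
    · rw [y₅ i hi, y₄ i hi, R₃, hreal 3 _ (by omega), zero_add, hX1 i hi]
  refine Ex.seq (gramPhase_spec I₅ hn hdn hm hX₅) ?_
  rintro s₆ ⟨g₆, x₆⟩
  have I₆ := I₅.agree g₆
  refine Ex.seq ((onePhase_spec I₆ hn hdn).mono hn (by omega) fun _ => id) ?_
  rintro s₇ ⟨g₇, x₇⟩
  have I₇ := I₆.agree g₇
  have z (R : ℕ) (hR : 8 ≤ R ∨ R = 2 ∨ R = 6 ∨ R = 7) (c : ℕ) : s₇.real R c = 0 := by
    rw [g₇.2 R (by omega), g₆.2 R (by omega), g₅.2 R (by omega), g₄.2 R (by omega), R₃,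
      hreal R c (by omega)]
  have hN₇ : ∀ a < d + 1, ∀ b < d + 1, s₇.real 4 (a * (d + 1) + b) = rowGram m X a b := by
    intro a ha b hb
    rw [g₇.2 4 (by omega), x₆ a ha b hb, g₅.2 4 (by omega), g₄.2 4 (by omega), R₃,
      hreal 4 _ (by omega), zero_add]
  have hI₇ : ∀ a < d + 1, ∀ b < d + 1, s₇.real 5 (a * (d + 1) + b) = kron a b := by
    intro a ha b hb
    rw [x₇ a ha b hb, g₆.2 5 (by omega), g₅.2 5 (by omega), g₄.2 5 (by omega), R₃,
      hreal 5 _ (by omega), zero_add]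
  refine Ex.seq (sweepPhase_spec I₇ hn hdn hN₇ hI₇ (z 6 (by omega)) (z 7 (by omega))) ?_
  rintro s₈ ⟨g₈, g₈', x₈⟩
  have I₈ := I₇.congr g₈
  have hX₈ : ∀ i < n, ∀ a < d + 1, s₈.real 3 (i * (d + 1) + a) = X i a := by
    rw [g₈' 3 (by omega) (by omega) (by omega), g₇.2 3 (by omega), g₆.2 3 (by omega)]
    exact hX₅
  refine Ex.seq (leveragePhase_spec I₈ hn hdn hm hX₈ x₈) ?_
  rintro s₉ ⟨g₉, x₉⟩
  have I₉ := I₈.agree g₉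
  refine Ex.seq ((leverageSumPhase_spec (X := X) I₉ hn hdn hm (by rwa [g₉.2 3 (by omega)])
    (f := leverage (d + 1) X (sweep (rowGram m X) (d + 1))) fun i hi => by
      rw [x₉ i hi, g₈' 8 (by omega) (by omega) (by omega), z 8 (by omega), zero_add]).mono hn
    (by omega) fun _ => id) ?_
  rintro s₁₀ ⟨g₁₀, x₁₀⟩
  have I₁₀ := I₉.agree g₁₀
  refine Ex.seq ((fittedPhase_spec (Q := sweep (rowGram m X) (d + 1)) I₁₀ hn hdn
    (by rwa [g₁₀.2 4 (by omega), g₉.2 4 (by omega)])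
    (f := leverageSum (d + 1) m X (sweep (rowGram m X) (d + 1))) fun b hb => by
      rw [x₁₀ b hb, g₉.2 9 (by omega), g₈' 9 (by omega) (by omega) (by omega), z 9 (by omega),
        zero_add]; rfl).mono hn (by omega) fun _ => id) ?_
  rintro s₁₁ ⟨g₁₁, x₁₁⟩
  have I₁₁ := I₁₀.agree g₁₁
  have hw : ∀ j < d + 1, s₁₁.real 2 j = fitted (d + 1) m X j := by
    intro j hj
    rw [x₁₁ j hj, g₁₀.2 2 (by omega), g₉.2 2 (by omega), g₈' 2 (by omega) (by omega) (by omega),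
      z 2 (by omega), zero_add]; rfl
  refine Ex.seq ((scorePhase_spec (X := X) I₁₁ hn hdn
    (by rwa [g₁₁.2 3 (by omega), g₁₀.2 3 (by omega), g₉.2 3 (by omega)])
    fun j hj => hw j (by omega)).mono hn (by omega) fun _ => id) ?_
  rintro s₁₂ ⟨g₁₂, x₁₂⟩
  have I₁₂ := I₁₁.agree g₁₂
  refine ((thresholdPhase_spec (f := score d m X) I₁₂ hn fun i hi => ?_).mono hn
    (by omega) fun s' h => ⟨fun j hj => ?_, h.2⟩)
  · rw [x₁₂ i hi, g₁₁.2 10 (by omega), g₁₀.2 10 (by omega), g₉.2 10 (by omega),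
      g₈' 10 (by omega) (by omega) (by omega), z 10 (by omega), zero_add]; rfl
  · rw [h.1 j hj, g₁₂.2 2 (by omega), hw j (by omega)]

/-- The samples as the rows of a matrix with last column `1`. -/
def homogeneous {n d : ℕ} (x : Fin n → EuclideanSpace ℝ (Fin d)) (i a : ℕ) : ℝ :=
  if h : i < n ∧ a < d then x ⟨i, h.1⟩ ⟨a, h.2⟩ else 1

theorem learner_runs {n d : ℕ} (hd : 1 ≤ d) (hdn : d + 1 ≤ n) (α ε δ : ℝ)
    (x : Fin n → EuclideanSpace ℝ (Fin d)) :
    ∃ t s, Runs learner (input α ε δ x) t s ∧ t ≤ learner.size * n ^ 3 ∧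
      outputSet d s = superlevelSet
        (WithLp.toLp 2 fun j : Fin d => fitted (d + 1) ((n + 1) / 2) (homogeneous x) j)
        (threshold d ((n + 1) / 2) n (homogeneous x)) := by
  obtain ⟨t, s, hr, ht, hw, hτ⟩ := learner_spec (s := input α ε δ x) (X := homogeneous x)
    (by omega) hdn (by simp [input]) (by simp [input])
    (fun a i ha => by simp [input, show a ≠ 0 by omega])
    (fun a i ha => by
      simp only [input, show a ≠ 0 by omega, show a ≠ 1 by omega, false_and, if_false, dite_false])
    (fun i hi j hj => by
      have e1 : (i * d + j) / d = i := by
        rw [Nat.mul_comm, Nat.mul_add_div (by omega), Nat.div_eq_of_lt hj, add_zero]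
      have e2 : (i * d + j) % d = j := by
        rw [Nat.mul_comm, Nat.mul_add_mod, Nat.mod_eq_of_lt hj]
      simp [input, homogeneous, e1, e2, hi, hj])
    (fun i hi => by simp [homogeneous])
  refine ⟨t, s, hr, ht, ?_⟩
  rw [outputSet, hτ]
  congr 2
  funext j
  exact hw j j.2

end RealRAM

/-! ## Principal pivot transforms invert positive definite matrices -/

theorem sum_mul_kron {D k : ℕ} (hk : k < D) (u : ℕ → ℝ) :
    ∑ b ∈ Finset.range D, kron k b * u b = u k := by
  simp [kron, hk]

theorem eq_mulVec_of_sweepStep {D k : ℕ} (hk : k < D) {N : ℕ → ℕ → ℝ} (hN : N k k ≠ 0)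
    {u v : ℕ → ℝ} (h : ∀ a < D, v a = ∑ b ∈ Finset.range D, sweepStep N k a b * u b) :
    ∀ a < D, Function.update v k (u k) a =
      ∑ b ∈ Finset.range D, N a b * Function.update u k (v k) b := by
  have hupd : ∀ a, ∑ b ∈ Finset.range D, N a b * Function.update u k (v k) b =
      ∑ b ∈ Finset.range D, N a b * u b + N a k * (v k - u k) := by
    intro a
    rw [← Finset.add_sum_erase _ _ (Finset.mem_range.2 hk),
      ← Finset.add_sum_erase _ (fun b => N a b * u b) (Finset.mem_range.2 hk)]
    have : ∑ b ∈ (Finset.range D).erase k, N a b * Function.update u k (v k) b =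
        ∑ b ∈ (Finset.range D).erase k, N a b * u b :=
      Finset.sum_congr rfl fun b hb => by
        rw [Function.update_of_ne (Finset.ne_of_mem_erase hb)]
    rw [this, Function.update_self]
    ring
  obtain ⟨t, ht⟩ : ∃ t, t = ∑ b ∈ Finset.range D, N k b * u b := ⟨_, rfl⟩
  have hv : ∀ a < D, v a = ∑ b ∈ Finset.range D, N a b * u b -
      (N a k + kron a k) * ((t - u k) / N k k) := by
    intro a ha
    rw [h a ha]
    simp only [sweepStep, sub_mul, Finset.sum_sub_distrib]
    congr 1
    rw [ht, ← sum_mul_kron hk u, ← Finset.sum_sub_distrib, Finset.sum_div, Finset.mul_sum]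
    exact Finset.sum_congr rfl fun b _ => by ring
  have hvk := hv k hk
  rw [← ht, show kron k k = 1 by simp [kron]] at hvk
  have hq : (t - u k) / N k k = u k - v k := by
    rw [hvk]; field_simp; ring
  intro a ha
  rw [hupd]
  have := hv a ha
  rw [hq] at this
  by_cases hak : a = k
  · subst hak
    rw [Function.update_self]
    rw [show kron a a = 1 by simp [kron]] at this
    linarith
  · rw [Function.update_of_ne hak]
    rw [show kron a k = 0 by simp [kron, hak]] at this
    linarith

theorem sweep_spec {D : ℕ} {M : ℕ → ℕ → ℝ}
    (hM : ∀ x : ℕ → ℝ, ∑ a ∈ Finset.range D, x a * ∑ b ∈ Finset.range D, M a b * x b = 0 →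
      ∀ a < D, x a = 0) :
    ∀ k ≤ D, ∀ u v : ℕ → ℝ, (∀ a < D, v a = ∑ b ∈ Finset.range D, sweep M k a b * u b) →
      ∀ a < D, (if a < k then u a else v a) =
        ∑ b ∈ Finset.range D, M a b * if b < k then v b else u b := by
  intro k
  induction k with
  | zero => intro _ u v h; simpa [sweep] using h
  | succ k ih =>
    intro hk u v h
    have hpiv : sweep M k k k ≠ 0 := by
      intro h0
      obtain ⟨e, he⟩ : ∃ e : ℕ → ℝ, e = fun b => if b = k then 1 else 0 := ⟨_, rfl⟩
      obtain ⟨y, hy⟩ : ∃ y : ℕ → ℝ, y = fun a => ∑ b ∈ Finset.range D, sweep M k a b * e b :=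
        ⟨_, rfl⟩
      have h1 := ih (by omega) e y (fun a _ => by rw [hy])
      have hyk : y k = 0 := by simp [hy, he, h0]
      have h2 := hM (fun b => if b < k then y b else e b) ?_ k (by omega)
      · simp [he] at h2
      · refine Finset.sum_eq_zero fun a ha => ?_
        rw [← h1 a (Finset.mem_range.1 ha)]
        rcases lt_trichotomy a k with hak | hak | hak
        · simp [hak, he, hak.ne]
        · simp [hak, hyk]
        · simp [he, show ¬ a < k by omega, hak.ne']
    have h1 := eq_mulVec_of_sweepStep (by omega) hpiv h
    have h2 := ih (by omega) _ _ h1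
    intro a ha
    have e1 : ∀ b, (if b < k + 1 then v b else u b) =
        if b < k then Function.update v k (u k) b else Function.update u k (v k) b := by
      intro b
      rcases lt_trichotomy b k with hb | hb | hb
      · simp [hb, hb.ne, show b < k + 1 by omega]
      · simp [hb]
      · simp [hb.ne', show ¬ b < k by omega, show ¬ b < k + 1 by omega]
    have e2 : (if a < k + 1 then u a else v a) =
        if a < k then Function.update u k (v k) a else Function.update v k (u k) a := by
      rcases lt_trichotomy a k with hb | hb | hb
      · simp [hb, hb.ne, show a < k + 1 by omega]
      · simp [hb]
      · simp [hb.ne', show ¬ a < k by omega, show ¬ a < k + 1 by omega]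
    rw [e2, h2 a ha]
    simp only [e1]

/-- The `D × D` matrix with entries given by `f`. -/
def finMatrix (D : ℕ) (f : ℕ → ℕ → ℝ) : Matrix (Fin D) (Fin D) ℝ := Matrix.of fun a b => f a b

theorem finMatrix_mul_sweep {D : ℕ} {M : ℕ → ℕ → ℝ}
    (hM : ∀ x : Fin D → ℝ, dotProduct x ((finMatrix D M).mulVec x) = 0 → x = 0) :
    finMatrix D M * finMatrix D (sweep M D) = 1 := by
  have h := sweep_spec (M := M) (D := D) (fun x hx a ha => by
    have := hM (fun a => x a) (by
      rw [← hx, Finset.sum_range]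
      simp only [dotProduct, Matrix.mulVec, finMatrix, Matrix.of_apply]
      exact Finset.sum_congr rfl fun a _ => by rw [Finset.sum_range])
    exact congrFun this ⟨a, ha⟩) D le_rfl
  ext a c
  have h1 := h (fun b => if b = c then 1 else 0)
    (fun a => ∑ b ∈ Finset.range D, sweep M D a b * if b = c then 1 else 0) (fun _ _ => rfl) a a.2
  rw [if_pos a.2, Finset.sum_range] at h1
  simp only [Matrix.mul_apply, finMatrix, Matrix.of_apply, Matrix.one_apply, Fin.ext_iff]
  rw [h1]
  refine Finset.sum_congr rfl fun b _ => ?_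
  simp

/-! ## The fitted functional in matrix form -/

section fit
open Matrix

/-- The Gram matrix of the vectors `X 0, …, X (m - 1)`. -/
def gramMatrix {D : ℕ} (m : ℕ) (X : ℕ → Fin D → ℝ) : Matrix (Fin D) (Fin D) ℝ :=
  ∑ i ∈ Finset.range m, vecMulVec (X i) (X i)

noncomputable def fitVector {D : ℕ} (m : ℕ) (X : ℕ → Fin D → ℝ) : Fin D → ℝ :=
  (gramMatrix m X)⁻¹ *ᵥ ∑ i ∈ Finset.range m, (X i ⬝ᵥ ((gramMatrix m X)⁻¹ *ᵥ X i)) • X i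

theorem dotProduct_gramMatrix {D : ℕ} (m : ℕ) (X : ℕ → Fin D → ℝ) (x : Fin D → ℝ) :
    x ⬝ᵥ (gramMatrix m X *ᵥ x) = ∑ i ∈ Finset.range m, (X i ⬝ᵥ x) ^ 2 := by
  rw [gramMatrix, sum_mulVec, dotProduct_sum]
  refine Finset.sum_congr rfl fun i _ => ?_
  rw [vecMulVec_mulVec, dotProduct_smul, dotProduct_comm x]
  simp [sq]

theorem eq_zero_of_dotProduct_gramMatrix {D m : ℕ} {X : ℕ → Fin D → ℝ}
    (h : IsUnit (gramMatrix m X).det) {x : Fin D → ℝ} (hx : x ⬝ᵥ (gramMatrix m X *ᵥ x) = 0) :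
    x = 0 := by
  rw [dotProduct_gramMatrix, Finset.sum_eq_zero_iff_of_nonneg fun _ _ => sq_nonneg _] at hx
  have h0 : gramMatrix m X *ᵥ x = 0 := by
    rw [gramMatrix, sum_mulVec]
    refine Finset.sum_eq_zero fun i hi => ?_
    rw [vecMulVec_mulVec, pow_eq_zero_iff (two_ne_zero) |>.1 (hx i hi)]
    simp
  have := congrArg (fun y => (gramMatrix m X)⁻¹ *ᵥ y) h0
  simpa [Matrix.mulVec_mulVec, Matrix.nonsing_inv_mul _ h] using this

theorem finMatrix_gram {D m : ℕ} (X : ℕ → ℕ → ℝ) :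
    finMatrix D (rowGram m X) = gramMatrix m fun i (a : Fin D) => X i a := by
  ext a b
  simp [finMatrix, rowGram, gramMatrix, Matrix.sum_apply, vecMulVec_apply]

theorem fitted_eq_fitVector {D m : ℕ} {X : ℕ → ℕ → ℝ}
    (h : IsUnit (gramMatrix m fun i (a : Fin D) => X i a).det) (a : Fin D) :
    fitted D m X a = fitVector m (fun i (a : Fin D) => X i a) a := by
  have hQ : finMatrix D (sweep (rowGram m X) D) = (gramMatrix m fun i (a : Fin D) => X i a)⁻¹ := by
    refine (Matrix.inv_eq_right_inv ?_).symm
    rw [← finMatrix_gram]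
    refine finMatrix_mul_sweep fun x hx => ?_
    rw [finMatrix_gram] at hx
    exact eq_zero_of_dotProduct_gramMatrix h hx
  rw [fitted, fitVector, ← hQ, Finset.sum_range, mulVec, dotProduct]
  refine Finset.sum_congr rfl fun b _ => ?_
  rw [finMatrix, of_apply, Finset.sum_apply, leverageSum]
  congr 1
  refine Finset.sum_congr rfl fun i _ => ?_
  rw [Pi.smul_apply, smul_eq_mul, mul_comm, leverage, Finset.sum_range]
  congr 1
  rw [dotProduct]
  refine Finset.sum_congr rfl fun a _ => ?_
  rw [Finset.sum_range, mulVec, dotProduct, Finset.mul_sum]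
  exact Finset.sum_congr rfl fun b _ => by rw [of_apply]; ring

theorem gramMatrix_mulVec {D m : ℕ} (B : Matrix (Fin D) (Fin D) ℝ) (Z : ℕ → Fin D → ℝ) :
    gramMatrix m (fun i => B *ᵥ Z i) = B * gramMatrix m Z * Bᵀ := by
  rw [gramMatrix, gramMatrix, Matrix.mul_sum, Matrix.sum_mul]
  refine Finset.sum_congr rfl fun i _ => ?_
  rw [mul_vecMulVec, vecMulVec_mul, vecMul_transpose]

theorem fitVector_dotProduct_mulVec {D m : ℕ} {B : Matrix (Fin D) (Fin D) ℝ} (hB : IsUnit B.det)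
    {Z : ℕ → Fin D → ℝ} (z : Fin D → ℝ) :
    fitVector m (fun i => B *ᵥ Z i) ⬝ᵥ (B *ᵥ z) = fitVector m Z ⬝ᵥ z := by
  have hBt : IsUnit Bᵀ.det := by rwa [det_transpose]
  have key : ∀ x y : Fin D → ℝ, (B *ᵥ x) ⬝ᵥ ((B * gramMatrix m Z * Bᵀ)⁻¹ *ᵥ (B *ᵥ y)) =
      x ⬝ᵥ ((gramMatrix m Z)⁻¹ *ᵥ y) := by
    intro x y
    rw [Matrix.mul_inv_rev, Matrix.mul_inv_rev, mulVec_mulVec, Matrix.mul_assoc, Matrix.mul_assoc,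
      nonsing_inv_mul _ hB, Matrix.mul_one, dotProduct_mulVec, vecMul_mulVec,
      ← Matrix.mul_assoc, mul_nonsing_inv _ hBt, Matrix.one_mul, ← dotProduct_mulVec]
  rw [fitVector, fitVector, gramMatrix_mulVec]
  simp only [key]
  have e : ∑ i ∈ Finset.range m, (Z i ⬝ᵥ ((gramMatrix m Z)⁻¹ *ᵥ Z i)) • (B *ᵥ Z i) =
      B *ᵥ ∑ i ∈ Finset.range m, (Z i ⬝ᵥ ((gramMatrix m Z)⁻¹ *ᵥ Z i)) • Z i := by
    rw [mulVec_sum]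
    exact Finset.sum_congr rfl fun i _ => (mulVec_smul _ _ _).symm
  rw [e, dotProduct_comm, key, dotProduct_comm]

end fit

/-! ## Perturbation of the fitted functional -/

section perturbation
open Matrix

theorem abs_sub_le_of_near_one {D : ℕ} {M : Matrix (Fin D) (Fin D) ℝ} {η R : ℝ}
    (hM : ∀ a b, |M a b - (1 : Matrix (Fin D) (Fin D) ℝ) a b| ≤ η) (hη : 0 ≤ η) (hD : D * η ≤ 1 / 2)
    {u r : Fin D → ℝ} (h : M *ᵥ u = r) (hr : ∀ a, |r a| ≤ R) (a : Fin D) :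
    |u a - r a| ≤ 2 * D * η * R := by
  have hne : (Finset.univ : Finset (Fin D)).Nonempty := ⟨a, Finset.mem_univ _⟩
  obtain ⟨a₀, -, ha₀⟩ := Finset.exists_max_image Finset.univ (fun a => |u a|) hne
  have hdiff : ∀ a, |u a - r a| ≤ D * η * |u a₀| := by
    intro a
    have e : u a - r a = -∑ b, (M a b - (1 : Matrix (Fin D) (Fin D) ℝ) a b) * u b := by
      simp only [sub_mul, Finset.sum_sub_distrib, Matrix.one_apply, ite_mul, one_mul, zero_mul,
        Finset.sum_ite_eq, Finset.mem_univ, if_true, ← h, mulVec, dotProduct]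
      ring
    rw [e, abs_neg]
    calc |∑ b, (M a b - (1 : Matrix (Fin D) (Fin D) ℝ) a b) * u b|
        ≤ ∑ b : Fin D, η * |u a₀| := (Finset.abs_sum_le_sum_abs _ _).trans
          (Finset.sum_le_sum fun b _ => by
            rw [abs_mul]
            exact mul_le_mul (hM a b) (ha₀ b (Finset.mem_univ _)) (abs_nonneg _) hη)
      _ = D * η * |u a₀| := by simp [mul_assoc]
  have h1 := hdiff a₀
  have h2 : |u a₀| ≤ |u a₀ - r a₀| + |r a₀| := by
    simpa using abs_add_le (u a₀ - r a₀) (r a₀)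
  have h3 : D * η * |u a₀| ≤ 1 / 2 * |u a₀| := mul_le_mul_of_nonneg_right hD (abs_nonneg _)
  have h4 : |u a₀| ≤ 2 * R := by linarith [hr a₀]
  calc |u a - r a| ≤ D * η * |u a₀| := hdiff a
    _ ≤ D * η * (2 * R) := mul_le_mul_of_nonneg_left h4 (by positivity)
    _ = _ := by ring

theorem isUnit_det_of_near_one {D : ℕ} {M : Matrix (Fin D) (Fin D) ℝ} {η : ℝ}
    (hM : ∀ a b, |M a b - (1 : Matrix (Fin D) (Fin D) ℝ) a b| ≤ η) (hη : 0 ≤ η)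
    (hD : D * η ≤ 1 / 2) : IsUnit M.det := by
  rw [isUnit_iff_ne_zero]
  intro h
  obtain ⟨u, hu, h0⟩ := Matrix.exists_mulVec_eq_zero_iff.2 h
  refine hu (funext fun a => ?_)
  have := abs_sub_le_of_near_one hM hη hD h0 (R := 0) (by simp) a
  simpa using this

theorem abs_fitVector_sub_le {D m : ℕ} (hm : 0 < m) {Z : ℕ → Fin D → ℝ} {l : Fin D}
    (hl : ∀ i < m, Z i l = 1) {B η : ℝ} (hB : 1 ≤ B) (hZ : ∀ i < m, ∀ a, |Z i a| ≤ B)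
    {T : Fin D → Fin D → Fin D → ℝ} (hTl : ∀ a b, T a b l = (1 : Matrix (Fin D) (Fin D) ℝ) a b)
    (hη : 0 ≤ η) (hD : D * η ≤ 1 / 2)
    (hT : ∀ a b c, |(m : ℝ)⁻¹ * ∑ i ∈ Finset.range m, Z i a * Z i b * Z i c - T a b c| ≤ η) :
    IsUnit (gramMatrix m Z).det ∧
      ∀ c, |m * fitVector m Z c - ∑ a, T c a a| ≤ 7 * D ^ 3 * B ^ 3 * η := by
  have hm0 : (m : ℝ) ≠ 0 := by positivity
  obtain ⟨M, hMdef⟩ : ∃ M, M = (m : ℝ)⁻¹ • gramMatrix m Z := ⟨_, rfl⟩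
  have hG : gramMatrix m Z = (m : ℝ) • M := by rw [hMdef, smul_smul, mul_inv_cancel₀ hm0, one_smul]
  have hM : ∀ a b, |M a b - (1 : Matrix (Fin D) (Fin D) ℝ) a b| ≤ η := by
    intro a b
    have := hT a b l
    rw [hTl] at this
    convert this using 3
    rw [hMdef, Matrix.smul_apply, smul_eq_mul, gramMatrix, Matrix.sum_apply]
    congr 1
    refine Finset.sum_congr rfl fun i hi => ?_
    rw [vecMulVec_apply, hl i (Finset.mem_range.1 hi), mul_one]
  have hMdet := isUnit_det_of_near_one hM hη hD
  have hGdet : IsUnit (gramMatrix m Z).det := by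
    rw [hG, det_smul]
    exact (IsUnit.mk0 _ (pow_ne_zero _ hm0)).mul hMdet
  refine ⟨hGdet, ?_⟩
  obtain ⟨Q, hQdef⟩ : ∃ Q, Q = M⁻¹ := ⟨_, rfl⟩
  have hGinv : (gramMatrix m Z)⁻¹ = (m : ℝ)⁻¹ • Q := by
    refine Matrix.inv_eq_right_inv ?_
    rw [hG, hQdef, Matrix.smul_mul, Matrix.mul_smul, smul_smul, mul_inv_cancel₀ hm0, one_smul,
      Matrix.mul_nonsing_inv _ hMdet]
  obtain ⟨lev, hlev⟩ : ∃ lev : ℕ → ℝ, lev = fun i => Z i ⬝ᵥ (Q *ᵥ Z i) := ⟨_, rfl⟩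
  obtain ⟨r, hr⟩ : ∃ r : Fin D → ℝ, r = (m : ℝ)⁻¹ • ∑ i ∈ Finset.range m, lev i • Z i := ⟨_, rfl⟩
  obtain ⟨u, hu⟩ : ∃ u : Fin D → ℝ, u = Q *ᵥ r := ⟨_, rfl⟩
  have hfit : ∀ c, m * fitVector m Z c = u c := by
    intro c
    have : fitVector m Z = (m : ℝ)⁻¹ • u := by
      rw [fitVector, hGinv, hu, hr, smul_mulVec, mulVec_smul, hlev]
      congr 1
      simp only [smul_mulVec, dotProduct_smul, smul_eq_mul, mul_smul, ← Finset.smul_sum,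
        mulVec_smul]
    rw [this, Pi.smul_apply, smul_eq_mul, mul_inv_cancel_left₀ hm0]
  have hMu : M *ᵥ u = r := by
    rw [hu, hQdef, mulVec_mulVec, Matrix.mul_nonsing_inv _ hMdet, one_mulVec]
  have hQ : ∀ a b, |Q a b - (1 : Matrix (Fin D) (Fin D) ℝ) a b| ≤ 2 * D * η := by
    intro a b
    have := abs_sub_le_of_near_one hM hη hD (u := fun a => Q a b)
      (r := fun a => (1 : Matrix (Fin D) (Fin D) ℝ) a b) (R := 1) ?_ ?_ a
    · simpa using this
    · funext a
      have := congrFun (congrFun (Matrix.mul_nonsing_inv _ hMdet) a) b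
      rw [Matrix.mul_apply] at this
      rw [← this, hQdef]; rfl
    · intro a
      rw [Matrix.one_apply]; split_ifs <;> simp
  have hQ2 : ∀ a b, |Q a b| ≤ 2 := by
    intro a b
    have h1 := hQ a b
    have h2 : |(1 : Matrix (Fin D) (Fin D) ℝ) a b| ≤ 1 := by
      rw [Matrix.one_apply]; split_ifs <;> simp
    have h3 := abs_add_le (Q a b - (1 : Matrix (Fin D) (Fin D) ℝ) a b)
      ((1 : Matrix (Fin D) (Fin D) ℝ) a b)
    rw [sub_add_cancel] at h3
    linarith
  have quad : ∀ (N : Matrix (Fin D) (Fin D) ℝ) (K : ℝ), (∀ a b, |N a b| ≤ K) → ∀ i < m,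
      |Z i ⬝ᵥ (N *ᵥ Z i)| ≤ D ^ 2 * (K * B ^ 2) := by
    intro N K hN i hi
    rw [dotProduct]
    calc |∑ a, Z i a * (N *ᵥ Z i) a| ≤ ∑ a : Fin D, B * (D * (K * B)) := by
          refine (Finset.abs_sum_le_sum_abs _ _).trans (Finset.sum_le_sum fun a _ => ?_)
          rw [abs_mul]
          refine mul_le_mul (hZ i hi a) ?_ (abs_nonneg _) (by linarith)
          rw [mulVec, dotProduct]
          calc |∑ b, N a b * Z i b| ≤ ∑ b : Fin D, K * B := by
                refine (Finset.abs_sum_le_sum_abs _ _).trans (Finset.sum_le_sum fun b _ => ?_)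
                rw [abs_mul]
                exact mul_le_mul (hN a b) (hZ i hi b) (abs_nonneg _) ((abs_nonneg _).trans (hN a b))
            _ = D * (K * B) := by simp
      _ = D ^ 2 * (K * B ^ 2) := by simp; ring
  have avg : ∀ (f : ℕ → ℝ) (K : ℝ), (∀ i < m, |f i| ≤ K) →
      |(m : ℝ)⁻¹ * ∑ i ∈ Finset.range m, f i| ≤ K := by
    intro f K hf
    rw [abs_mul, abs_of_pos (by positivity), inv_mul_le_iff₀ (by positivity)]
    calc |∑ i ∈ Finset.range m, f i| ≤ ∑ i ∈ Finset.range m, K :=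
          (Finset.abs_sum_le_sum_abs _ _).trans
            (Finset.sum_le_sum fun i hi => hf i (Finset.mem_range.1 hi))
      _ = m * K := by simp
  have hrc : ∀ c, r c = (m : ℝ)⁻¹ * ∑ i ∈ Finset.range m, lev i * Z i c := by
    intro c; simp [hr, Finset.sum_apply]
  have hrB : ∀ c, |r c| ≤ 2 * D ^ 2 * B ^ 3 := by
    intro c
    rw [hrc]
    refine avg _ _ fun i hi => ?_
    rw [abs_mul, hlev]
    calc _ ≤ (D ^ 2 * (2 * B ^ 2)) * B :=
          mul_le_mul (quad Q 2 hQ2 i hi) (hZ i hi c) (abs_nonneg _) (by positivity)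
      _ = _ := by ring
  intro c
  rw [hfit]
  have h1 := abs_sub_le_of_near_one hM hη hD hMu hrB c
  have h2 : |r c - ∑ a, (m : ℝ)⁻¹ * ∑ i ∈ Finset.range m, Z i c * Z i a * Z i a| ≤
      2 * D ^ 3 * B ^ 3 * η := by
    rw [hrc, ← Finset.mul_sum, ← mul_sub, Finset.sum_comm, ← Finset.sum_sub_distrib]
    refine avg _ _ fun i hi => ?_
    have e : lev i * Z i c - ∑ a, Z i c * Z i a * Z i a =
        (Z i ⬝ᵥ ((Q - 1) *ᵥ Z i)) * Z i c := by
      rw [sub_mulVec, one_mulVec, dotProduct_sub, sub_mul, hlev]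
      congr 1
      rw [dotProduct, Finset.sum_mul]
      exact Finset.sum_congr rfl fun a _ => by ring
    rw [e, abs_mul]
    calc _ ≤ (D ^ 2 * ((2 * D * η) * B ^ 2)) * B :=
          mul_le_mul (quad (Q - 1) _ (fun a b => by simpa using hQ a b) i hi) (hZ i hi c)
            (abs_nonneg _) (by positivity)
      _ = _ := by ring
  have h3 : |∑ a, (m : ℝ)⁻¹ * ∑ i ∈ Finset.range m, Z i c * Z i a * Z i a - ∑ a, T c a a| ≤
      D * η := by
    rw [← Finset.sum_sub_distrib]
    calc _ ≤ ∑ a : Fin D, η :=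
          (Finset.abs_sum_le_sum_abs _ _).trans (Finset.sum_le_sum fun a _ => hT c a a)
      _ = D * η := by simp
  have hD1 : (1 : ℝ) ≤ D := by
    have : 0 < D := c.pos
    exact_mod_cast this
  have hB3 : 1 ≤ B ^ 3 := one_le_pow₀ hB
  have hDD : (D : ℝ) ≤ D ^ 3 := le_self_pow₀ hD1 (by norm_num)
  have h4 : D * η ≤ D ^ 3 * B ^ 3 * η := by
    refine mul_le_mul_of_nonneg_right (hDD.trans ?_) hη
    exact le_mul_of_one_le_right (by positivity) hB3
  have h5 : |u c - ∑ a, T c a a| ≤ |u c - r c| +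
      |r c - ∑ a, (m : ℝ)⁻¹ * ∑ i ∈ Finset.range m, Z i c * Z i a * Z i a| +
      |∑ a, (m : ℝ)⁻¹ * ∑ i ∈ Finset.range m, Z i c * Z i a * Z i a - ∑ a, T c a a| := by
    have := abs_add_le (u c - r c) (r c - ∑ a, (m : ℝ)⁻¹ * ∑ i ∈ Finset.range m, Z i c * Z i a * Z i a)
    have h' := abs_add_le (u c - ∑ a, (m : ℝ)⁻¹ * ∑ i ∈ Finset.range m, Z i c * Z i a * Z i a)
      (∑ a, (m : ℝ)⁻¹ * ∑ i ∈ Finset.range m, Z i c * Z i a * Z i a - ∑ a, T c a a)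
    simp only [sub_add_sub_cancel] at this h'
    linarith
  have e : 2 * D * η * (2 * D ^ 2 * B ^ 3) = 4 * (D ^ 3 * B ^ 3 * η) := by ring
  rw [e] at h1
  linarith

end perturbation

/-! ## The standard normal distribution above a threshold -/

section truncated
open Set Filter Topology Real

/-- The density of the standard normal distribution. -/
noncomputable def stdPDF (x : ℝ) : ℝ := gaussianPDFReal 0 1 x

theorem stdPDF_eq (x : ℝ) : stdPDF x = (√(2 * π))⁻¹ * exp (-x ^ 2 / 2) := by
  simp [stdPDF, gaussianPDFReal]

theorem stdPDF_pos (x : ℝ) : 0 < stdPDF x := gaussianPDFReal_pos 0 1 x one_ne_zero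

theorem hasDerivAt_stdPDF (x : ℝ) : HasDerivAt stdPDF (-x * stdPDF x) x := by
  have h : HasDerivAt (fun x : ℝ => -x ^ 2 / 2) (-x) x :=
    (((hasDerivAt_pow 2 x).neg).div_const 2).congr_deriv (by simp; ring)
  have h' := (h.exp).const_mul (√(2 * π))⁻¹
  simp only [funext stdPDF_eq]
  exact h'.congr_deriv (by ring)

theorem integrable_stdGaussian_iff {f : ℝ → ℝ} :
    Integrable f (gaussianReal 0 1) ↔ Integrable fun x => stdPDF x * f x := by
  rw [gaussianReal_of_var_ne_zero 0 one_ne_zero,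
    integrable_withDensity_iff_integrable_smul' (measurable_gaussianPDF 0 1)
      (ae_of_all _ fun x => gaussianPDF_lt_top)]
  simp [stdPDF, toReal_gaussianPDF]

theorem setIntegral_stdGaussian {f : ℝ → ℝ} {s : Set ℝ} (hs : MeasurableSet s) :
    ∫ x in s, f x ∂(gaussianReal 0 1) = ∫ x in s, stdPDF x * f x := by
  rw [← integral_indicator hs, integral_gaussianReal_eq_integral_smul one_ne_zero,
    ← integral_indicator hs]
  congr 1
  funext x
  by_cases hx : x ∈ s <;> simp [hx, stdPDF]

/-- Integration by parts against the standard normal distribution above `t`. -/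
theorem setIntegral_Ici_stein {f f' : ℝ → ℝ} (t : ℝ) (hf : ∀ x, HasDerivAt f (f' x) x)
    (h1 : Integrable f (gaussianReal 0 1)) (h2 : Integrable f' (gaussianReal 0 1))
    (h3 : Integrable (fun x => x * f x) (gaussianReal 0 1)) :
    ∫ x in Ici t, f' x ∂(gaussianReal 0 1) - ∫ x in Ici t, x * f x ∂(gaussianReal 0 1) =
      -(stdPDF t * f t) := by
  have hd : ∀ x, HasDerivAt (fun x => stdPDF x * f x)
      (stdPDF x * f' x - stdPDF x * (x * f x)) x := fun x =>
    ((hasDerivAt_stdPDF x).mul (hf x)).congr_deriv (by ring)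
  rw [integrable_stdGaussian_iff] at h1 h2 h3
  have hlim := tendsto_zero_of_hasDerivAt_of_integrableOn_Ioi (a := t) (fun x _ => hd x)
    (h2.sub h3).integrableOn h1.integrableOn
  have := integral_Ioi_of_hasDerivAt_of_tendsto' (a := t) (fun x _ => hd x)
    (h2.sub h3).integrableOn hlim
  rw [setIntegral_stdGaussian measurableSet_Ici, setIntegral_stdGaussian measurableSet_Ici,
    integral_Ici_eq_integral_Ioi, integral_Ici_eq_integral_Ioi, ← integral_sub h2.integrableOn
      h3.integrableOn, this, zero_sub]

/-- The standard normal distribution conditioned on being at least `t`. -/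
noncomputable def truncLaw (t : ℝ) : Measure ℝ := cond (gaussianReal 0 1) (Ici t)

theorem stdGaussian_Ici_ne_zero (t : ℝ) : gaussianReal 0 1 (Ici t) ≠ 0 := by
  intro h
  have := gaussianReal_absolutelyContinuous' 0 one_ne_zero h
  simp at this

theorem stdGaussian_Ici_pos (t : ℝ) : 0 < (gaussianReal 0 1).real (Ici t) :=
  ENNReal.toReal_pos (stdGaussian_Ici_ne_zero t) (measure_ne_top _ _)

instance isProbabilityMeasure_truncLaw (t : ℝ) : IsProbabilityMeasure (truncLaw t) :=
  cond_isProbabilityMeasure (stdGaussian_Ici_ne_zero t)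

theorem integral_truncLaw (t : ℝ) (f : ℝ → ℝ) :
    ∫ x, f x ∂(truncLaw t) =
      ((gaussianReal 0 1).real (Ici t))⁻¹ * ∫ x in Ici t, f x ∂(gaussianReal 0 1) := by
  rw [truncLaw, ProbabilityTheory.cond, integral_smul_measure, smul_eq_mul, ENNReal.toReal_inv]; rfl

theorem integrable_truncLaw {f : ℝ → ℝ} (h : Integrable f (gaussianReal 0 1)) (t : ℝ) :
    Integrable f (truncLaw t) :=
  h.integrableOn.integrable.smul_measure (by simpa using stdGaussian_Ici_ne_zero t)

theorem ae_truncLaw (t : ℝ) : ∀ᵐ x ∂(truncLaw t), t ≤ x := by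
  have h := ae_restrict_mem (μ := gaussianReal 0 1) (measurableSet_Ici (a := t))
  exact Measure.ae_smul_measure h _

/-- The mean of the standard normal distribution above `t`. -/
noncomputable def hazard (t : ℝ) : ℝ := stdPDF t / (gaussianReal 0 1).real (Ici t)

theorem hazard_pos (t : ℝ) : 0 < hazard t := div_pos (stdPDF_pos t) (stdGaussian_Ici_pos t)

theorem truncLaw_stein {f f' : ℝ → ℝ} (t : ℝ) (hf : ∀ x, HasDerivAt f (f' x) x)
    (h1 : Integrable f (gaussianReal 0 1)) (h2 : Integrable f' (gaussianReal 0 1))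
    (h3 : Integrable (fun x => x * f x) (gaussianReal 0 1)) :
    ∫ x, x * f x ∂(truncLaw t) = ∫ x, f' x ∂(truncLaw t) + hazard t * f t := by
  rw [integral_truncLaw, integral_truncLaw, hazard]
  have := setIntegral_Ici_stein t hf h1 h2 h3
  have hpos := stdGaussian_Ici_pos t
  field_simp
  linarith

theorem integrable_pow_stdGaussian (k : ℕ) : Integrable (fun x : ℝ => x ^ k) (gaussianReal 0 1) :=
  integrable_pow_of_mem_interior_integrableExpSet (X := fun x => x)
    (by simp [integrableExpSet_fun_id_gaussianReal]) k

theorem integrable_pow_truncLaw (t : ℝ) (k : ℕ) : Integrable (fun x : ℝ => x ^ k) (truncLaw t) :=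
  integrable_truncLaw (integrable_pow_stdGaussian k) t

theorem integrable_id_truncLaw (t : ℝ) : Integrable (fun x : ℝ => x) (truncLaw t) := by
  simpa using integrable_pow_truncLaw t 1

theorem truncLaw_mean (t : ℝ) : ∫ x, x ∂(truncLaw t) = hazard t := by
  have := truncLaw_stein (f := fun _ => 1) (f' := fun _ => 0) t (fun x => hasDerivAt_const x 1)
    (integrable_const _) (integrable_const _) (by simpa using integrable_pow_stdGaussian 1)
  simpa using this

theorem truncLaw_sq (t : ℝ) : ∫ x, x ^ 2 ∂(truncLaw t) = 1 + t * hazard t := by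
  have := truncLaw_stein (f := fun x => x) (f' := fun _ => 1) t (fun x => hasDerivAt_id x)
    (by simpa using integrable_pow_stdGaussian 1) (integrable_const _)
    (by simpa [sq] using integrable_pow_stdGaussian 2)
  simpa [sq, mul_comm] using this

theorem truncLaw_cube (t : ℝ) : ∫ x, x ^ 3 ∂(truncLaw t) = 2 * hazard t + t ^ 2 * hazard t := by
  have := truncLaw_stein (f := fun x => x ^ 2) (f' := fun x => 2 * x) t
    (fun x => by simpa using hasDerivAt_pow 2 x)
    (integrable_pow_stdGaussian 2) (by simpa using (integrable_pow_stdGaussian 1).const_mul 2)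
    (by simpa [pow_succ'] using integrable_pow_stdGaussian 3)
  rw [integral_const_mul, truncLaw_mean, mul_comm (hazard t)] at this
  rw [← this]
  congr 1; funext x; ring

theorem integrable_cubic_truncLaw (t a b c e : ℝ) :
    Integrable (fun x => a * x ^ 3 + b * x ^ 2 + c * x + e) (truncLaw t) :=
  ((((integrable_pow_truncLaw t 3).const_mul a).add ((integrable_pow_truncLaw t 2).const_mul b)).add
    ((integrable_id_truncLaw t).const_mul c)).add (integrable_const e)

theorem integral_cubic_truncLaw (t a b c e : ℝ) :
    ∫ x, (a * x ^ 3 + b * x ^ 2 + c * x + e) ∂(truncLaw t) =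
      a * (2 * hazard t + t ^ 2 * hazard t) + b * (1 + t * hazard t) + c * hazard t + e := by
  have i3 := (integrable_pow_truncLaw t 3).const_mul a
  have i2 := (integrable_pow_truncLaw t 2).const_mul b
  have i1 := (integrable_id_truncLaw t).const_mul c
  have h := integral_add ((i3.add i2).add i1) (integrable_const e)
  rw [integral_add' (i3.add i2) i1, integral_add' i3 i2, integral_const_mul, integral_const_mul,
    integral_const_mul, truncLaw_cube, truncLaw_sq, truncLaw_mean] at h
  simpa using h

theorem truncLaw_var (t : ℝ) :
    ∫ x, (x - hazard t) ^ 2 ∂(truncLaw t) = 1 + t * hazard t - hazard t ^ 2 := by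
  have h := integral_cubic_truncLaw t 0 1 (-2 * hazard t) (hazard t ^ 2)
  rw [show (fun x : ℝ => (x - hazard t) ^ 2) =
    fun x => 0 * x ^ 3 + 1 * x ^ 2 + -2 * hazard t * x + hazard t ^ 2 by funext x; ring, h]
  ring

theorem truncLaw_third (t : ℝ) : ∫ x, (x - hazard t) ^ 3 ∂(truncLaw t) =
    hazard t * (2 * hazard t ^ 2 - 3 * t * hazard t + t ^ 2 - 1) := by
  have h := integral_cubic_truncLaw t 1 (-3 * hazard t) (3 * hazard t ^ 2) (-hazard t ^ 3)
  rw [show (fun x : ℝ => (x - hazard t) ^ 3) = fun x =>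
    1 * x ^ 3 + -3 * hazard t * x ^ 2 + 3 * hazard t ^ 2 * x + -hazard t ^ 3 by funext x; ring, h]
  ring

theorem excess_eq (t b : ℝ) : (fun x : ℝ => (x - t) * (x - t - b) ^ 2) = fun x =>
    1 * x ^ 3 + -(3 * t + 2 * b) * x ^ 2 + (b ^ 2 + 4 * t * b + 3 * t ^ 2) * x +
      (-t ^ 3 - 2 * t ^ 2 * b - t * b ^ 2) := by
  funext x; ring

theorem integrable_excess (t b : ℝ) :
    Integrable (fun x => (x - t) * (x - t - b) ^ 2) (truncLaw t) := by
  rw [excess_eq]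
  exact integrable_cubic_truncLaw t _ _ _ _

theorem truncLaw_excess (t b : ℝ) : ∫ x, (x - t) * (x - t - b) ^ 2 ∂(truncLaw t) =
    (2 * hazard t + t ^ 2 * hazard t - 3 * t - t ^ 3) - 2 * b * (1 - t * hazard t + t ^ 2) +
      b ^ 2 * (hazard t - t) := by
  rw [excess_eq, integral_cubic_truncLaw]
  ring

theorem measureReal_Icc_stdGaussian_le {c t : ℝ} (hc : ∀ x, t ≤ x → stdPDF x ≤ c) {a b : ℝ}
    (hab : a ≤ b) : (gaussianReal 0 1).real (Ici t ∩ Icc a b) ≤ c * (b - a) := by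
  have hc0 : 0 ≤ c := (stdPDF_pos t).le.trans (hc t le_rfl)
  have e : (gaussianReal 0 1).real (Ici t ∩ Icc a b) = ∫ x in Ici t ∩ Icc a b, stdPDF x := by
    have := setIntegral_stdGaussian (f := fun _ => 1) (s := Ici t ∩ Icc a b)
      (measurableSet_Ici.inter measurableSet_Icc)
    simpa using this
  rw [e]
  have hvol : volume (Ici t ∩ Icc a b) ≤ ENNReal.ofReal (b - a) :=
    (measure_mono inter_subset_right).trans_eq Real.volume_Icc
  have := norm_setIntegral_le_of_norm_le_const (μ := volume) (s := Ici t ∩ Icc a b) (C := c)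
    (f := stdPDF) (hvol.trans_lt ENNReal.ofReal_lt_top) fun x hx => by
      rw [Real.norm_eq_abs, abs_of_pos (stdPDF_pos x)]; exact hc x hx.1
  rw [Real.norm_eq_abs] at this
  refine (le_abs_self _).trans (this.trans (mul_le_mul_of_nonneg_left ?_ hc0))
  exact ENNReal.toReal_le_of_le_ofReal (by linarith) hvol

theorem truncLaw_real_Icc_le {c t : ℝ} (hc : ∀ x, t ≤ x → stdPDF x ≤ c) {a b : ℝ} (hab : a ≤ b) :
    (truncLaw t).real (Icc a b) ≤ c / (gaussianReal 0 1).real (Ici t) * (b - a) := by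
  have h := measureReal_Icc_stdGaussian_le hc hab
  rw [truncLaw, measureReal_def, cond_apply measurableSet_Ici, ENNReal.toReal_mul,
    ENNReal.toReal_inv]
  rw [measureReal_def] at h
  calc _ ≤ ((gaussianReal 0 1) (Ici t)).toReal⁻¹ * (c * (b - a)) :=
        mul_le_mul_of_nonneg_left h (by positivity)
    _ = _ := by rw [measureReal_def]; ring

theorem sqrt_two_pi_bounds : 2 ≤ √(2 * π) ∧ √(2 * π) ≤ 2.6 := by
  constructor
  · refine Real.le_sqrt_of_sq_le ?_
    nlinarith [Real.pi_gt_three]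
  · rw [Real.sqrt_le_left (by norm_num)]
    nlinarith [Real.pi_lt_d2]

theorem stdPDF_le_half (x : ℝ) : stdPDF x ≤ 1 / 2 := by
  rw [stdPDF_eq]
  have h1 : exp (-x ^ 2 / 2) ≤ 1 := Real.exp_le_one_iff.2 (by nlinarith [sq_nonneg x])
  have h2 : (√(2 * π))⁻¹ ≤ 2⁻¹ := inv_anti₀ (by norm_num) sqrt_two_pi_bounds.1
  calc (√(2 * π))⁻¹ * exp (-x ^ 2 / 2) ≤ 2⁻¹ * 1 := by gcongr
    _ = 1 / 2 := by norm_num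

theorem stdPDF_anti {t x : ℝ} (ht : 0 ≤ t) (hx : t ≤ x) : stdPDF x ≤ stdPDF t := by
  rw [stdPDF_eq, stdPDF_eq]
  gcongr

theorem half_le_stdGaussian_Ici {t : ℝ} (ht : t ≤ 0) : 1 / 2 ≤ (gaussianReal 0 1).real (Ici t) := by
  have h1 : (gaussianReal 0 1).real (Iic 0) = (gaussianReal 0 1).real (Ici (0 : ℝ)) := by
    have := gaussianReal_map_neg (μ := 0) (v := 1)
    rw [neg_zero] at this
    conv_lhs => rw [← this, map_measureReal_apply measurable_neg measurableSet_Iic]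
    congr 1
    ext x; simp
  have h2 : (1 : ℝ) ≤ (gaussianReal 0 1).real (Iic 0) + (gaussianReal 0 1).real (Ici (0 : ℝ)) := by
    have := measureReal_union_le (μ := gaussianReal 0 1) (Iic (0 : ℝ)) (Ici 0)
    rwa [Iic_union_Ici, probReal_univ] at this
  have h3 : (gaussianReal 0 1).real (Ici (0 : ℝ)) ≤ (gaussianReal 0 1).real (Ici t) :=
    measureReal_mono (Ici_subset_Ici.2 ht)
  linarith

/-- An upper bound for the density of `truncLaw t`. -/
noncomputable def truncBound (t : ℝ) : ℝ := if t ≤ 0 then 1 else hazard t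

theorem truncBound_pos (t : ℝ) : 0 < truncBound t := by
  rw [truncBound]; split_ifs
  · exact one_pos
  · exact hazard_pos t

theorem truncLaw_real_Icc_le_truncBound (t : ℝ) {a b : ℝ} (hab : a ≤ b) :
    (truncLaw t).real (Icc a b) ≤ truncBound t * (b - a) := by
  rw [truncBound]
  split_ifs with ht
  · refine (truncLaw_real_Icc_le (fun x _ => stdPDF_le_half x) hab).trans
      (mul_le_mul_of_nonneg_right ?_ (by linarith))
    rw [div_le_one (stdGaussian_Ici_pos t)]
    exact half_le_stdGaussian_Ici ht
  · exact truncLaw_real_Icc_le (fun x hx => stdPDF_anti (not_le.1 ht).le hx) hab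

theorem truncLaw_var_ge (t : ℝ) :
    1 / (32 * truncBound t ^ 2) ≤ 1 + t * hazard t - hazard t ^ 2 := by
  have hM := truncBound_pos t
  obtain ⟨v, hv⟩ : ∃ v, v = 1 / (4 * truncBound t) := ⟨_, rfl⟩
  have hv0 : 0 < v := by rw [hv]; positivity
  have h1 : (truncLaw t).real (Icc (hazard t - v) (hazard t + v)) ≤ 1 / 2 := by
    refine (truncLaw_real_Icc_le_truncBound t (by linarith)).trans_eq ?_
    rw [hv]; field_simp; norm_num
  have h2 : 1 / 2 ≤ (truncLaw t).real (Icc (hazard t - v) (hazard t + v))ᶜ := by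
    rw [probReal_compl_eq_one_sub measurableSet_Icc]; linarith
  rw [← truncLaw_var]
  have hint : Integrable (fun x => (x - hazard t) ^ 2) (truncLaw t) := by
    rw [show (fun x : ℝ => (x - hazard t) ^ 2) =
      fun x => 0 * x ^ 3 + 1 * x ^ 2 + -2 * hazard t * x + hazard t ^ 2 by funext x; ring]
    exact integrable_cubic_truncLaw t _ _ _ _
  have h3 : ∫ x, (Icc (hazard t - v) (hazard t + v))ᶜ.indicator (fun _ => v ^ 2) x ∂(truncLaw t) ≤
      ∫ x, (x - hazard t) ^ 2 ∂(truncLaw t) := by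
    refine integral_mono ((integrable_const _).indicator measurableSet_Icc.compl) hint fun x => ?_
    by_cases hx : x ∈ (Icc (hazard t - v) (hazard t + v))ᶜ
    · simp only [indicator_of_mem hx]
      have : v ≤ |x - hazard t| := by
        by_contra! h
        rw [abs_lt] at h
        exact hx ⟨by linarith, by linarith⟩
      rw [← sq_abs (x - hazard t)]
      gcongr
    · simp only [indicator_of_notMem hx]; positivity
  rw [integral_indicator_const _ measurableSet_Icc.compl, smul_eq_mul] at h3
  calc 1 / (32 * truncBound t ^ 2) = 1 / 2 * v ^ 2 := by rw [hv]; field_simp; norm_num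
    _ ≤ _ := (mul_le_mul_of_nonneg_right h2 (by positivity)).trans h3

/-- The standard deviation of `truncLaw t`. -/
noncomputable def truncStd (t : ℝ) : ℝ := √(1 + t * hazard t - hazard t ^ 2)

theorem truncStd_sq (t : ℝ) : truncStd t ^ 2 = 1 + t * hazard t - hazard t ^ 2 := by
  refine Real.sq_sqrt (le_trans ?_ (truncLaw_var_ge t))
  have := truncBound_pos t
  positivity

theorem truncStd_pos (t : ℝ) : 0 < truncStd t := by
  refine Real.sqrt_pos.2 (lt_of_lt_of_le ?_ (truncLaw_var_ge t))
  have := truncBound_pos t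
  positivity

theorem lt_hazard (t : ℝ) : t < hazard t := by
  by_contra! h
  have h1 := truncStd_sq t
  have h2 := truncStd_pos t
  have h3 : ∫ x, (x - t) ∂(truncLaw t) = hazard t - t := by
    rw [integral_sub (integrable_id_truncLaw t) (integrable_const _), truncLaw_mean]; simp
  have h4 : 0 ≤ ∫ x, (x - t) ∂(truncLaw t) :=
    integral_nonneg_of_ae ((ae_truncLaw t).mono fun x hx => by simpa using hx)
  have h5 : ∫ x, (x - t) ∂(truncLaw t) = 0 := by linarith
  have ht : hazard t = t := by linarith
  replace h5 := (integral_eq_zero_iff_of_nonneg_ae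
    ((ae_truncLaw t).mono fun x hx => by simpa using hx)
    ((integrable_id_truncLaw t).sub (integrable_const t))).1 h5
  have h6 : ∫ x, (x - hazard t) ^ 2 ∂(truncLaw t) = 0 := by
    rw [← integral_zero ℝ ℝ (μ := truncLaw t)]
    refine integral_congr_ae (h5.mono fun x hx => ?_)
    change x - t = 0 at hx
    have : x - hazard t = 0 := by linarith
    simp [this]
  rw [truncLaw_var] at h6
  nlinarith

/-- The variance of the size-biased excess, times the mean excess squared. -/
theorem truncLaw_skew_ge (t : ℝ) : (hazard t - t) / (432 * truncBound t ^ 3) ≤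
    2 * hazard t ^ 2 - 3 * t * hazard t + t ^ 2 - 1 := by
  have hM := truncBound_pos t
  have ha : 0 < hazard t - t := by linarith [lt_hazard t]
  obtain ⟨b, hb⟩ : ∃ b, b = (1 - t * hazard t + t ^ 2) / (hazard t - t) := ⟨_, rfl⟩
  have hba : b * (hazard t - t) = 1 - t * hazard t + t ^ 2 := by rw [hb]; field_simp
  have hD : 2 * hazard t ^ 2 - 3 * t * hazard t + t ^ 2 - 1 =
      (hazard t - t) * ∫ x, (x - t) * (x - t - b) ^ 2 ∂(truncLaw t) := by
    rw [truncLaw_excess]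
    linear_combination (2 * (1 - t * hazard t + t ^ 2) - (b * (hazard t - t) +
      (1 - t * hazard t + t ^ 2))) * hba
  rw [hD, div_eq_mul_inv]
  refine mul_le_mul_of_nonneg_left ?_ ha.le
  obtain ⟨u, hu⟩ : ∃ u, u = 1 / (6 * truncBound t) := ⟨_, rfl⟩
  have hu0 : 0 < u := by rw [hu]; positivity
  obtain ⟨s, hs⟩ : ∃ s, s = (Icc t (t + u) ∪ Icc (t + b - u) (t + b + u))ᶜ := ⟨_, rfl⟩
  have hsm : MeasurableSet s := by
    rw [hs]; exact (measurableSet_Icc.union measurableSet_Icc).compl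
  have h1 : 1 / 2 ≤ (truncLaw t).real s := by
    rw [hs, probReal_compl_eq_one_sub (measurableSet_Icc.union measurableSet_Icc)]
    have h1 := measureReal_union_le (μ := truncLaw t) (Icc t (t + u)) (Icc (t + b - u) (t + b + u))
    have h2 := truncLaw_real_Icc_le_truncBound t (a := t) (b := t + u) (by linarith)
    have h3 := truncLaw_real_Icc_le_truncBound t (a := t + b - u) (b := t + b + u) (by linarith)
    have h4 : truncBound t * u = 1 / 6 := by rw [hu]; field_simp
    nlinarith
  have h3 : ∫ x, s.indicator (fun _ => u ^ 3) x ∂(truncLaw t) ≤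
      ∫ x, (x - t) * (x - t - b) ^ 2 ∂(truncLaw t) := by
    refine integral_mono_ae ((integrable_const _).indicator hsm) (integrable_excess t b) ?_
    filter_upwards [ae_truncLaw t] with x hxt
    by_cases hx : x ∈ s
    · simp only [indicator_of_mem hx]
      rw [hs, mem_compl_iff, mem_union, not_or] at hx
      have h1 : u ≤ x - t := by
        by_contra! h
        exact hx.1 ⟨hxt, by linarith⟩
      have h2 : u ≤ |x - t - b| := by
        by_contra! h
        rw [abs_lt] at h
        exact hx.2 ⟨by linarith, by linarith⟩
      rw [← sq_abs (x - t - b), pow_succ' u 2]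
      gcongr
    · simp only [indicator_of_notMem hx]
      exact mul_nonneg (by linarith) (sq_nonneg _)
  rw [integral_indicator_const _ hsm, smul_eq_mul] at h3
  calc (432 * truncBound t ^ 3)⁻¹ = 1 / 2 * u ^ 3 := by rw [hu]; field_simp; norm_num
    _ ≤ _ := (mul_le_mul_of_nonneg_right h1 (by positivity)).trans h3

end truncated

section truncated
open Set Filter Topology Real

theorem excess_skew_eq (t : ℝ) : 2 * hazard t ^ 2 - 3 * t * hazard t + t ^ 2 - 1 =
    (hazard t - t) ^ 2 - truncStd t ^ 2 := by
  rw [truncStd_sq]; ring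

theorem truncStd_le_excess (t : ℝ) : truncStd t ≤ hazard t - t := by
  have h := truncLaw_skew_ge t
  have hM := truncBound_pos t
  have ha : 0 < hazard t - t := by linarith [lt_hazard t]
  have h0 : 0 < (hazard t - t) / (432 * truncBound t ^ 3) := by positivity
  rw [excess_skew_eq] at h
  exact le_of_sq_le_sq (by linarith) ha.le

theorem hazard_mul_excess (t : ℝ) : hazard t * (hazard t - t) = 1 - truncStd t ^ 2 := by
  rw [truncStd_sq]; ring

theorem truncStd_le_one (t : ℝ) : truncStd t ≤ 1 := by
  have h1 := hazard_mul_excess t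
  have h2 := mul_pos (hazard_pos t) (sub_pos.2 (lt_hazard t))
  have h3 := truncStd_pos t
  nlinarith

/-- The density of the standardized truncated normal distribution at its left end. -/
noncomputable def endDensity (t : ℝ) : ℝ := hazard t * truncStd t

theorem endDensity_pos (t : ℝ) : 0 < endDensity t := mul_pos (hazard_pos t) (truncStd_pos t)

theorem endDensity_le_one (t : ℝ) : endDensity t ≤ 1 := by
  have h1 := hazard_mul_excess t
  have h2 := mul_le_mul_of_nonneg_left (truncStd_le_excess t) (hazard_pos t).le
  rw [endDensity]
  nlinarith [sq_nonneg (truncStd t)]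

theorem truncBound_mul_truncStd_le (t : ℝ) : truncBound t * truncStd t ≤ 1 := by
  rw [truncBound]
  split_ifs
  · simpa using truncStd_le_one t
  · exact endDensity_le_one t

/-- The third moment of the standardized truncated normal distribution. -/
noncomputable def skewness (t : ℝ) : ℝ :=
  hazard t * (2 * hazard t ^ 2 - 3 * t * hazard t + t ^ 2 - 1) / truncStd t ^ 3

theorem skewness_ge (t : ℝ) : endDensity t / 432 ≤ skewness t := by
  have hM := truncBound_pos t
  have hρ := truncStd_pos t
  have h1 : truncStd t ^ 3 * truncBound t ^ 3 ≤ 1 := by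
    rw [← mul_pow, mul_comm]
    exact pow_le_one₀ (by positivity) (truncBound_mul_truncStd_le t)
  have h2 : truncStd t ^ 4 / 432 ≤ 2 * hazard t ^ 2 - 3 * t * hazard t + t ^ 2 - 1 := by
    refine le_trans ?_ (truncLaw_skew_ge t)
    rw [div_le_div_iff₀ (by norm_num) (by positivity)]
    have h3 : truncStd t * (truncStd t ^ 3 * truncBound t ^ 3) ≤ truncStd t * 1 :=
      mul_le_mul_of_nonneg_left h1 hρ.le
    have := truncStd_le_excess t
    nlinarith
  rw [skewness, endDensity, le_div_iff₀ (by positivity)]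
  calc hazard t * truncStd t / 432 * truncStd t ^ 3 = hazard t * (truncStd t ^ 4 / 432) := by ring
    _ ≤ _ := mul_le_mul_of_nonneg_left h2 (hazard_pos t).le

theorem stdGaussian_Iio_le_of_nonpos {t : ℝ} (ht : t ≤ 0) :
    (gaussianReal 0 1).real (Iio t) ≤ 2.6 * stdPDF t := by
  have e : (gaussianReal 0 1).real (Iio t) = ∫ x in Iio t, stdPDF x := by
    have := setIntegral_stdGaussian (f := fun _ => 1) (s := Iio t) measurableSet_Iio
    simpa using this
  have hpos := stdPDF_pos t
  have hint := (integrable_gaussianPDFReal t 1).const_mul (√(2 * π) * stdPDF t)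
  rw [e]
  calc ∫ x in Iio t, stdPDF x
      ≤ ∫ x in Iio t, √(2 * π) * stdPDF t * gaussianPDFReal t 1 x := by
        refine setIntegral_mono_on (integrable_gaussianPDFReal 0 1).integrableOn hint.integrableOn
          measurableSet_Iio fun x hx => ?_
        have hx : x < t := hx
        have hs : 0 < √(2 * π) := by positivity
        rw [stdPDF_eq, stdPDF_eq, gaussianPDFReal]
        have : exp (-x ^ 2 / 2) ≤ exp (-t ^ 2 / 2) * exp (-(x - t) ^ 2 / 2) := by
          rw [← Real.exp_add, Real.exp_le_exp]
          nlinarith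
        calc (√(2 * π))⁻¹ * exp (-x ^ 2 / 2)
            ≤ (√(2 * π))⁻¹ * (exp (-t ^ 2 / 2) * exp (-(x - t) ^ 2 / 2)) := by gcongr
          _ = _ := by
            simp only [NNReal.coe_one, mul_one]
            field_simp
    _ ≤ ∫ x, √(2 * π) * stdPDF t * gaussianPDFReal t 1 x :=
        setIntegral_le_integral hint (ae_of_all _ fun x =>
          mul_nonneg (by positivity) (gaussianPDFReal_nonneg _ _ _))
    _ = √(2 * π) * stdPDF t := by
        rw [integral_const_mul, integral_gaussianPDFReal_eq_one t one_ne_zero, mul_one]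
    _ ≤ 2.6 * stdPDF t := mul_le_mul_of_nonneg_right sqrt_two_pi_bounds.2 hpos.le

theorem stdGaussian_Iio_le (t : ℝ) : (gaussianReal 0 1).real (Iio t) ≤ 16 * endDensity t := by
  have hvar := truncLaw_var_ge t
  have hρ := truncStd_pos t
  have hl := hazard_pos t
  rw [← truncStd_sq] at hvar
  by_cases ht : t ≤ 0
  · rw [truncBound, if_pos ht] at hvar
    have h1 : 1 / 6 ≤ truncStd t := le_of_sq_le_sq (by norm_num at hvar ⊢; linarith) hρ.le
    have h2 : stdPDF t ≤ hazard t := by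
      rw [hazard, le_div_iff₀ (stdGaussian_Ici_pos t)]
      exact mul_le_of_le_one_right (stdPDF_pos t).le measureReal_le_one
    have h3 := stdGaussian_Iio_le_of_nonpos ht
    have h4 : hazard t * (1 / 6) ≤ endDensity t := mul_le_mul_of_nonneg_left h1 hl.le
    linarith
  · rw [truncBound, if_neg ht, div_le_iff₀ (by positivity)] at hvar
    have h1 : 1 / 6 ≤ endDensity t := by
      refine le_of_sq_le_sq ?_ (endDensity_pos t).le
      rw [endDensity]
      nlinarith
    have h2 : (gaussianReal 0 1).real (Iio t) ≤ 1 := measureReal_le_one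
    linarith

theorem integrable_exp_stdGaussian (h : ℝ) :
    Integrable (fun x => exp (h * x)) (gaussianReal 0 1) := integrable_exp_mul_gaussianReal h

theorem integrable_mul_exp_stdGaussian (h : ℝ) :
    Integrable (fun x => x * exp (h * x)) (gaussianReal 0 1) := by
  have := integrable_pow_mul_exp_of_mem_interior_integrableExpSet (X := fun x : ℝ => x)
    (μ := gaussianReal 0 1) (v := h) (by simp [integrableExpSet_fun_id_gaussianReal]) 1
  simpa using this

theorem truncLaw_exp_le (t : ℝ) : ∫ x, exp (hazard t / 2 * (x - t)) ∂(truncLaw t) ≤ 2 := by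
  obtain ⟨h, hh⟩ : ∃ h, h = hazard t / 2 := ⟨_, rfl⟩
  have hl := hazard_pos t
  obtain ⟨f, hf⟩ : ∃ f : ℝ → ℝ, f = fun x => exp (h * (x - t)) := ⟨_, rfl⟩
  have e : ∀ x, f x = exp (-(h * t)) * exp (h * x) := fun x => by
    simp only [hf, ← Real.exp_add]; congr 1; ring
  have i1 : Integrable f (gaussianReal 0 1) := by
    rw [funext e]; exact (integrable_exp_stdGaussian h).const_mul _
  have i2 : Integrable (fun x => x * f x) (gaussianReal 0 1) := by
    have : (fun x => x * f x) = fun x => exp (-(h * t)) * (x * exp (h * x)) := by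
      funext x; rw [e]; ring
    rw [this]; exact (integrable_mul_exp_stdGaussian h).const_mul _
  have hd : ∀ x, HasDerivAt f (h * f x) x := fun x => by
    rw [hf]
    exact ((((hasDerivAt_id x).sub_const t).const_mul h).exp).congr_deriv (by simp; ring)
  have hst := truncLaw_stein t hd i1 (i1.const_mul h) i2
  rw [integral_const_mul] at hst
  have hft : f t = 1 := by simp [hf]
  rw [hft, mul_one] at hst
  have j1 := integrable_truncLaw i1 t
  have j2 := integrable_truncLaw i2 t
  have hmono : 0 ≤ ∫ x, (x - hazard t) * (f x - f (hazard t)) ∂(truncLaw t) := by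
    refine integral_nonneg fun x => ?_
    have hfm : Monotone f := by
      rw [hf]; intro a b hab
      exact Real.exp_le_exp.2 (mul_le_mul_of_nonneg_left (by linarith) (by rw [hh]; positivity))
    rcases le_total x (hazard t) with hx | hx
    · exact mul_nonneg_of_nonpos_of_nonpos (by linarith) (by linarith [hfm hx])
    · exact mul_nonneg (by linarith) (by linarith [hfm hx])
  have hexp : ∫ x, (x - hazard t) * (f x - f (hazard t)) ∂(truncLaw t) =
      ∫ x, x * f x ∂(truncLaw t) - hazard t * ∫ x, f x ∂(truncLaw t) := by
    have e2 : (fun x => (x - hazard t) * (f x - f (hazard t))) = fun x =>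
        (x * f x - hazard t * f x) - (f (hazard t) * x - f (hazard t) * hazard t) := by
      funext x; ring
    have k1 := (integrable_id_truncLaw t).const_mul (f (hazard t))
    have h3 := integral_sub (j2.sub (j1.const_mul (hazard t)))
      (k1.sub (integrable_const (f (hazard t) * hazard t)))
    rw [integral_sub' j2 (j1.const_mul _), integral_sub' k1 (integrable_const _),
      integral_const_mul, integral_const_mul, truncLaw_mean] at h3
    rw [e2]
    simpa using h3
  rw [hexp, hst, hh] at hmono
  have : ∫ x, f x ∂(truncLaw t) ≤ 2 := by nlinarith
  rw [hf, hh] at this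
  exact this

/-- A probability distribution on `ℝ` with mean `0`, variance `1`, third moment `κ` and
exponential tails. -/
structure IsStandardized (ν : Measure ℝ) (h κ : ℝ) : Prop where
  integrable_exp : Integrable (fun z => exp (h * |z|)) ν
  exp_le : ∫ z, exp (h * |z|) ∂ν ≤ 4
  mean : ∫ z, z ∂ν = 0
  sq : ∫ z, z ^ 2 ∂ν = 1
  cube : ∫ z, z ^ 3 ∂ν = κ

theorem isStandardized_stdGaussian {h : ℝ} (h1 : h ≤ 1 / 2) :
    IsStandardized (gaussianReal 0 1) h 0 := by
  have hle : ∀ z : ℝ, exp (h * |z|) ≤ exp (1 / 2 * z) + exp (-(1 / 2) * z) := by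
    intro z
    have h2 : h * |z| ≤ 1 / 2 * |z| := mul_le_mul_of_nonneg_right h1 (abs_nonneg z)
    rcases abs_cases z with ⟨hz, -⟩ | ⟨hz, -⟩
    · rw [hz] at h2 ⊢
      linarith [Real.exp_le_exp.2 h2, Real.exp_pos (-(1 / 2) * z)]
    · rw [hz] at h2 ⊢
      rw [show 1 / 2 * -z = -(1 / 2) * z by ring] at h2
      linarith [Real.exp_le_exp.2 h2, Real.exp_pos (1 / 2 * z)]
  have hi := (integrable_exp_stdGaussian (1 / 2)).add (integrable_exp_stdGaussian (-(1 / 2)))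
  have hint : Integrable (fun z => exp (h * |z|)) (gaussianReal 0 1) := by
    refine hi.mono' (by fun_prop) (ae_of_all _ fun z => ?_)
    rw [Real.norm_eq_abs, abs_of_pos (Real.exp_pos _)]
    exact hle z
  have hmgf : ∀ s : ℝ, ∫ x, exp (s * x) ∂(gaussianReal 0 1) = exp (s ^ 2 / 2) := by
    intro s
    have := congrFun (mgf_id_gaussianReal (μ := 0) (v := 1)) s
    simpa [mgf] using this
  refine ⟨hint, ?_, ?_, ?_, ?_⟩
  · refine (integral_mono hint hi hle).trans ?_
    rw [integral_add' (integrable_exp_stdGaussian _) (integrable_exp_stdGaussian _), hmgf, hmgf]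
    have : exp ((1 / 2 : ℝ) ^ 2 / 2) ≤ 2 := by
      have h3 : exp ((1 / 2 : ℝ) ^ 2 / 2) ≤ exp (1 / 2) := Real.exp_le_exp.2 (by norm_num)
      have h4 : exp (1 / 2 : ℝ) ^ 2 = exp 1 := by rw [← Real.exp_nat_mul]; norm_num
      have h5 := Real.exp_one_lt_d9
      nlinarith [Real.exp_pos (1 / 2 : ℝ)]
    rw [show (-(1 / 2 : ℝ)) ^ 2 = (1 / 2) ^ 2 by ring]
    linarith
  · exact integral_id_gaussianReal
  · have h1 := variance_eq_integral (μ := gaussianReal 0 1) (X := fun x => x) (by fun_prop)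
    rw [variance_fun_id_gaussianReal, integral_id_gaussianReal] at h1
    simpa using h1.symm
  · have h1 := integral_map (μ := gaussianReal 0 1) (φ := fun x : ℝ => -x) (f := fun x => x ^ 3)
      (by fun_prop) (by fun_prop)
    rw [gaussianReal_map_neg, neg_zero] at h1
    have h2 : ∫ x : ℝ, (-x) ^ 3 ∂(gaussianReal 0 1) = -∫ x, x ^ 3 ∂(gaussianReal 0 1) := by
      rw [← integral_neg]; congr 1; funext x; ring
    linarith

/-- The standardization of `truncLaw t`. -/
noncomputable def standardize (t x : ℝ) : ℝ := (x - hazard t) / truncStd t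

theorem measurable_standardize (t : ℝ) : Measurable (standardize t) := by
  unfold standardize; fun_prop

theorem isStandardized_truncLaw (t : ℝ) :
    IsStandardized ((truncLaw t).map (standardize t)) (endDensity t / 2) (skewness t) := by
  have hρ := truncStd_pos t
  have hl := hazard_pos t
  have hm := (measurable_standardize t).aemeasurable (μ := truncLaw t)
  have hbound : ∀ x, t ≤ x → exp (endDensity t / 2 * |standardize t x|) ≤
      2 * exp (hazard t / 2 * (x - t)) := by
    intro x hx
    have e1 : endDensity t / 2 * |standardize t x| = hazard t / 2 * |x - hazard t| := by
      rw [standardize, endDensity, abs_div, abs_of_pos hρ]; field_simp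
    have e2 : |x - hazard t| ≤ (x - t) + (hazard t - t) := by
      have := lt_hazard t
      rw [abs_le]; constructor <;> linarith
    have e3 : hazard t / 2 * (hazard t - t) ≤ 1 / 2 := by
      have := hazard_mul_excess t
      nlinarith [sq_nonneg (truncStd t)]
    have e4 : exp (1 / 2 : ℝ) ≤ 2 := by
      have h4 : exp (1 / 2 : ℝ) ^ 2 = exp 1 := by rw [← Real.exp_nat_mul]; norm_num
      have h5 := Real.exp_one_lt_d9
      nlinarith [Real.exp_pos (1 / 2 : ℝ)]
    rw [e1]
    calc exp (hazard t / 2 * |x - hazard t|) ≤ exp (1 / 2 + hazard t / 2 * (x - t)) := by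
          rw [Real.exp_le_exp]
          have := mul_le_mul_of_nonneg_left e2 (by positivity : 0 ≤ hazard t / 2)
          linarith
      _ ≤ 2 * exp (hazard t / 2 * (x - t)) := by
          rw [Real.exp_add]; gcongr
  have hi : Integrable (fun x => 2 * exp (hazard t / 2 * (x - t))) (truncLaw t) := by
    refine Integrable.const_mul (integrable_truncLaw ?_ t) 2
    have e : (fun x => exp (hazard t / 2 * (x - t))) = fun x =>
        exp (-(hazard t / 2 * t)) * exp (hazard t / 2 * x) := by
      funext x; rw [← Real.exp_add]; congr 1; ring
    rw [e]
    exact (integrable_exp_stdGaussian _).const_mul _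
  have hint : Integrable (fun x => exp (endDensity t / 2 * |standardize t x|)) (truncLaw t) := by
    refine hi.mono' ?_ ?_
    · have := measurable_standardize t
      fun_prop
    · filter_upwards [ae_truncLaw t] with x hx
      rw [Real.norm_eq_abs, abs_of_pos (Real.exp_pos _)]
      exact hbound x hx
  refine ⟨?_, ?_, ?_, ?_, ?_⟩
  · rw [integrable_map_measure (by fun_prop) hm]
    exact hint
  · rw [integral_map hm (by fun_prop)]
    calc _ ≤ ∫ x, 2 * exp (hazard t / 2 * (x - t)) ∂(truncLaw t) :=
          integral_mono_ae hint hi ((ae_truncLaw t).mono hbound)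
      _ ≤ 4 := by
          rw [integral_const_mul]
          linarith [truncLaw_exp_le t]
  · rw [integral_map hm (by fun_prop)]
    simp only [standardize]
    rw [integral_div, integral_sub (integrable_id_truncLaw t) (integrable_const _), truncLaw_mean]
    simp
  · rw [integral_map hm (by fun_prop)]
    simp only [standardize, div_pow]
    rw [integral_div, truncLaw_var, ← truncStd_sq, div_self (by positivity)]
  · rw [integral_map hm (by fun_prop)]
    simp only [standardize, div_pow]
    rw [integral_div, truncLaw_third, skewness]

end truncated

/-! ## Standardizing coordinates -/

section coordinates
open Set Matrix

theorem cond_pi {ι : Type*} [Fintype ι] {μ : ι → Measure ℝ} [∀ i, IsProbabilityMeasure (μ i)]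
    {s : ι → Set ℝ} (hs : ∀ i, MeasurableSet (s i)) (h0 : ∀ i, μ i (s i) ≠ 0) :
    ProbabilityTheory.cond (Measure.pi μ) (univ.pi s) =
      Measure.pi fun i => ProbabilityTheory.cond (μ i) (s i) := by
  have : ∀ i, IsProbabilityMeasure (ProbabilityTheory.cond (μ i) (s i)) := fun i =>
    cond_isProbabilityMeasure (h0 i)
  refine (Measure.pi_eq fun r hr => ?_).symm
  rw [cond_apply (MeasurableSet.univ_pi hs), Measure.pi_pi, ← Set.pi_inter_distrib, Measure.pi_pi]
  simp only [cond_apply (hs _)]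
  rw [Finset.prod_mul_distrib, ENNReal.prod_inv_distrib]
  intro i _ j _ _
  exact .inl (h0 i)

variable {e : ℕ}

/-- Independent coordinates of which the first has law `ν` and the others are standard normal. -/
noncomputable def coordLaw (ν : Measure ℝ) (i : Fin (e + 1)) : Measure ℝ :=
  if i = 0 then ν else gaussianReal 0 1

instance isProbabilityMeasure_coordLaw (ν : Measure ℝ) [IsProbabilityMeasure ν] (i : Fin (e + 1)) :
    IsProbabilityMeasure (coordLaw ν i) := by
  rw [coordLaw]; split_ifs <;> infer_instance

noncomputable def prodLaw (e : ℕ) (ν : Measure ℝ) : Measure (Fin (e + 1) → ℝ) :=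
  Measure.pi (coordLaw ν)

instance isProbabilityMeasure_prodLaw (ν : Measure ℝ) [IsProbabilityMeasure ν] :
    IsProbabilityMeasure (prodLaw e ν) := by
  rw [prodLaw]; infer_instance

theorem prodLaw_stdGaussian :
    prodLaw e (gaussianReal 0 1) = Measure.pi fun _ => gaussianReal 0 1 := by
  rw [prodLaw]
  congr 1
  funext i
  rw [coordLaw, ite_self]

theorem cond_prodLaw (t : ℝ) : ProbabilityTheory.cond (prodLaw e (gaussianReal 0 1))
    {g | t ≤ g 0} = prodLaw e (truncLaw t) := by
  have h1 : {g : Fin (e + 1) → ℝ | t ≤ g 0} = univ.pi fun i => if i = 0 then Ici t else univ := by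
    ext g
    simp only [mem_ofPred_eq, mem_univ_pi]
    constructor
    · intro h i; split_ifs with hi
      · rw [hi]; exact h
      · trivial
    · intro h; simpa using h 0
  rw [h1, prodLaw_stdGaussian, cond_pi, prodLaw]
  · congr 1
    funext i
    rw [coordLaw]
    split_ifs
    · rfl
    · simp
  · intro i; split_ifs
    · exact measurableSet_Ici
    · exact MeasurableSet.univ
  · intro i; split_ifs
    · exact stdGaussian_Ici_ne_zero t
    · simp

theorem map_prodLaw (ν : Measure ℝ) [IsProbabilityMeasure ν] {f : ℝ → ℝ} (hf : Measurable f) :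
    (prodLaw e ν).map (fun g i => if i = 0 then f (g i) else g i) = prodLaw e (ν.map f) := by
  have hfm : ∀ i : Fin (e + 1), Measurable fun x : ℝ => if i = 0 then f x else x := fun i => by
    split_ifs <;> fun_prop
  have hp : ∀ i : Fin (e + 1), IsProbabilityMeasure
      ((coordLaw ν i).map fun x => if i = 0 then f x else x) := fun i =>
    Measure.isProbabilityMeasure_map (hfm i).aemeasurable
  rw [prodLaw, Measure.pi_map_pi (f := fun (i : Fin (e + 1)) (x : ℝ) => if i = 0 then f x else x)
    fun i => (hfm i).aemeasurable, prodLaw]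
  congr 1
  funext i
  rw [coordLaw, coordLaw]
  split_ifs <;> simp

/-- The point `v` in homogeneous coordinates. -/
def homog {d : ℕ} (v : Fin d → ℝ) : Fin (d + 1) → ℝ := Fin.snoc v 1

theorem exists_homog_mulVec {d : ℕ} (c : EuclideanSpace ℝ (Fin d))
    (f : (Fin d → ℝ) ≃ₗ[ℝ] EuclideanSpace ℝ (Fin d)) :
    ∃ B : Matrix (Fin (d + 1)) (Fin (d + 1)) ℝ, IsUnit B.det ∧
      ∀ z, homog (c + f z : EuclideanSpace ℝ (Fin d)).ofLp = B *ᵥ homog z := by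
  obtain ⟨F, hF⟩ : ∃ F : (Fin (d + 1) → ℝ) →ₗ[ℝ] (Fin (d + 1) → ℝ), ∀ v, F v =
      Fin.snoc (v (Fin.last d) • c + f (fun i => v i.castSucc) : EuclideanSpace ℝ (Fin d)).ofLp
        (v (Fin.last d)) := by
    refine ⟨{
      toFun := fun v => Fin.snoc (α := fun _ => ℝ)
        (v (Fin.last d) • c + f (fun i : Fin d => v i.castSucc) : EuclideanSpace ℝ (Fin d)).ofLp
        (v (Fin.last d))
      map_add' := ?_
      map_smul' := ?_ }, fun v => rfl⟩
    · intro u v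
      beta_reduce
      have : (fun i : Fin d => (u + v) i.castSucc) =
        (fun i : Fin d => u i.castSucc) + fun i : Fin d => v i.castSucc := rfl
      rw [this, map_add]
      funext a
      induction a using Fin.lastCases with
      | last => simp only [Fin.snoc_last, Pi.add_apply]
      | cast i =>
        simp only [Fin.snoc_castSucc, Pi.add_apply, PiLp.add_apply, PiLp.smul_apply, smul_eq_mul]
        ring
    · intro r v
      beta_reduce
      have : (fun i : Fin d => (r • v) i.castSucc) = r • fun i : Fin d => v i.castSucc := rfl
      rw [this, map_smul]
      funext a
      induction a using Fin.lastCases with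
      | last => simp only [Fin.snoc_last, Pi.smul_apply, RingHom.id_apply]
      | cast i =>
        simp only [Fin.snoc_castSucc, Pi.smul_apply, RingHom.id_apply, PiLp.add_apply,
          PiLp.smul_apply, smul_eq_mul]
        ring
  refine ⟨LinearMap.toMatrix' F, ?_, fun z => ?_⟩
  · rw [isUnit_iff_ne_zero]
    intro h
    obtain ⟨v, hv, h0⟩ := Matrix.exists_mulVec_eq_zero_iff.2 h
    rw [LinearMap.toMatrix'_mulVec, hF] at h0
    have h1 : v (Fin.last d) = 0 := by simpa using congrFun h0 (Fin.last d)
    have h2 : f (fun i => v i.castSucc) = 0 := by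
      ext i
      have := congrFun h0 i.castSucc
      simpa [h1] using this
    rw [map_eq_zero_iff f f.injective] at h2
    refine hv (funext fun a => ?_)
    induction a using Fin.lastCases with
    | last => exact h1
    | cast i => exact congrFun h2 i
  · rw [LinearMap.toMatrix'_mulVec, hF]
    simp [homog]

/-- Scaling the first coordinate. -/
noncomputable def scaleZero {ρ : ℝ} (hρ : ρ ≠ 0) : (Fin (e + 1) → ℝ) ≃ₗ[ℝ] (Fin (e + 1) → ℝ) :=
  LinearEquiv.piCongrRight fun i =>
    LinearEquiv.smulOfNeZero ℝ ℝ (if i = 0 then ρ else 1) (by split_ifs <;> simp [hρ])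

theorem scaleZero_apply {ρ : ℝ} (hρ : ρ ≠ 0) (z : Fin (e + 1) → ℝ) (i : Fin (e + 1)) :
    scaleZero hρ z i = if i = 0 then ρ * z i else z i := by
  change (if i = 0 then ρ else 1) * z i = _
  split_ifs <;> simp

open scoped MatrixOrder in
theorem sqrt_mul_sqrt_of_posDef {d : ℕ} {Sig : Matrix (Fin d) (Fin d) ℝ} (h : Sig.PosDef) :
    CFC.sqrt Sig * CFC.sqrt Sig = Sig :=
  CFC.sqrt_mul_sqrt_self _ h.posSemidef.nonneg

open scoped MatrixOrder in
theorem isSelfAdjoint_cfcSqrt {d : ℕ} (Sig : Matrix (Fin d) (Fin d) ℝ) :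
    IsSelfAdjoint (CFC.sqrt Sig) :=
  (CFC.sqrt_nonneg Sig).isSelfAdjoint

open scoped MatrixOrder in
/-- A Gaussian distribution is the image of independent standard normal coordinates under an affine
isomorphism that takes a given halfspace to a halfspace of the first coordinate. -/
theorem exists_stdGaussian_coordinates (μ : EuclideanSpace ℝ (Fin (e + 1)))
    {Sig : Matrix (Fin (e + 1)) (Fin (e + 1)) ℝ} (hSig : Sig.PosDef)
    {S : Set (EuclideanSpace ℝ (Fin (e + 1)))} (hS : IsHalfspace S) :
    ∃ (t : ℝ) (f : (Fin (e + 1) → ℝ) ≃ₗ[ℝ] EuclideanSpace ℝ (Fin (e + 1))),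
      (∀ g, μ + f g ∈ S ↔ t ≤ g 0) ∧
      multivariateGaussian μ Sig = (prodLaw e (gaussianReal 0 1)).map fun g => μ + f g := by
  obtain ⟨w, τ, hw, rfl⟩ := hS
  obtain ⟨A, hA⟩ : ∃ A, A = CFC.sqrt Sig := ⟨_, rfl⟩
  have hA2 : A * A = Sig := by
    rw [hA, sqrt_mul_sqrt_of_posDef hSig]
  have hAsymm : Aᵀ = A := by
    have : IsSelfAdjoint A := by
      rw [hA]
      exact isSelfAdjoint_cfcSqrt Sig
    simpa [IsSelfAdjoint, star_eq_conjTranspose] using this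
  have hAinj : ∀ v : Fin (e + 1) → ℝ, A *ᵥ v = 0 → v = 0 := by
    intro v hv
    have h1 : Sig *ᵥ v = 0 := by rw [← hA2, ← mulVec_mulVec, hv, mulVec_zero]
    have h2 := congrArg (fun y => Sig⁻¹ *ᵥ y) h1
    have hu : IsUnit Sig.det := isUnit_iff_ne_zero.2 hSig.det_pos.ne'
    simpa [mulVec_mulVec, nonsing_inv_mul _ hu] using h2
  obtain ⟨T, hT⟩ : ∃ T, T = toEuclideanCLM (n := Fin (e + 1)) (𝕜 := ℝ) A := ⟨_, rfl⟩
  have hTinj : Function.Injective (T.toLinearMap : EuclideanSpace ℝ (Fin (e + 1)) →ₗ[ℝ] EuclideanSpace ℝ (Fin (e + 1))) := by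
    rw [← LinearMap.ker_eq_bot, LinearMap.ker_eq_bot']
    intro x hx
    have h1 : A *ᵥ x.ofLp = 0 := by
      have := congrArg WithLp.ofLp hx
      rw [hT] at this
      simpa using this
    ext i
    exact congrFun (hAinj _ h1) i
  have hTadj : ∀ x y, inner ℝ x (T y) = inner ℝ (T x) y := by
    intro x y
    rw [hT, inner_toEuclideanCLM, real_inner_comm, inner_toEuclideanCLM, dotProduct_mulVec,
      ← mulVec_transpose, hAsymm, dotProduct_comm]
  obtain ⟨w', hw'⟩ : ∃ w', w' = T w := ⟨_, rfl⟩
  have hw'0 : w' ≠ 0 := by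
    intro h
    have : w = 0 := hTinj (by simpa [← hw'] using h)
    rw [this, norm_zero] at hw
    exact zero_ne_one hw
  have hn : 0 < ‖w'‖ := norm_pos_iff.2 hw'0
  obtain ⟨e₀, he₀⟩ : ∃ e₀ : EuclideanSpace ℝ (Fin (e + 1)), e₀ = EuclideanSpace.single 0 1 :=
    ⟨_, rfl⟩
  obtain ⟨R, hR⟩ : ∃ R : EuclideanSpace ℝ (Fin (e + 1)) ≃ₗᵢ[ℝ] EuclideanSpace ℝ (Fin (e + 1)),
      R e₀ = ‖w'‖⁻¹ • w' := by
    refine ⟨_, Submodule.reflection_sub ?_⟩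
    rw [he₀, norm_smul, norm_inv, norm_norm, inv_mul_cancel₀ hn.ne']
    simp
  let f : (Fin (e + 1) → ℝ) ≃ₗ[ℝ] EuclideanSpace ℝ (Fin (e + 1)) :=
    ((WithLp.linearEquiv 2 ℝ (Fin (e + 1) → ℝ)).symm.trans R.toLinearEquiv).trans
      (LinearEquiv.ofInjectiveEndo _ hTinj)
  have hf : ∀ g, f g = T (R (WithLp.toLp 2 g)) := fun g => rfl
  refine ⟨(τ - inner ℝ w μ) / ‖w'‖, f, fun g => ?_, ?_⟩
  · rw [superlevelSet, Set.mem_ofPred_eq, inner_add_right, hf, hTadj, ← hw']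
    have h1 : inner ℝ w' (R (WithLp.toLp 2 g)) = ‖w'‖ * g 0 := by
      have : w' = ‖w'‖ • R e₀ := by rw [hR, smul_smul, mul_inv_cancel₀ hn.ne', one_smul]
      conv_lhs => rw [this]
      rw [real_inner_smul_left, R.inner_map_map, he₀, EuclideanSpace.inner_single_left]
      simp
    rw [h1, div_le_iff₀ hn]
    constructor <;> intro h <;> linarith
  · rw [multivariateGaussian, prodLaw_stdGaussian, ← stdGaussian_map R, ← map_pi_eq_stdGaussian,
      Measure.map_map (by fun_prop) (by fun_prop), Measure.map_map (by fun_prop) (by fun_prop),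
      ← hA, ← hT]
    rfl

/-- Coordinates in which the conditional distribution is standardized. -/
theorem exists_standardized_coordinates (μ : EuclideanSpace ℝ (Fin (e + 1)))
    {Sig : Matrix (Fin (e + 1)) (Fin (e + 1)) ℝ} (hSig : Sig.PosDef)
    {S : Set (EuclideanSpace ℝ (Fin (e + 1)))} (hS : IsHalfspace S) :
    ∃ (t : ℝ) (c : EuclideanSpace ℝ (Fin (e + 1)))
      (f : (Fin (e + 1) → ℝ) ≃ₗ[ℝ] EuclideanSpace ℝ (Fin (e + 1))),
      (∀ z, c + f z ∈ S ↔ standardize t t ≤ z 0) ∧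
      multivariateGaussian μ Sig =
        (prodLaw e ((gaussianReal 0 1).map (standardize t))).map (fun z => c + f z) ∧
      truncatedGaussian μ Sig S =
        (prodLaw e ((truncLaw t).map (standardize t))).map (fun z => c + f z) := by
  obtain ⟨t, f, h1, h2⟩ := exists_stdGaussian_coordinates μ hSig hS
  have hρ := truncStd_pos t
  have hf : Measurable fun z => f z := (LinearMap.continuous_of_finiteDimensional f.toLinearMap).measurable
  have hst := measurable_standardize t
  have hscale : Measurable fun z => f (scaleZero (e := e) hρ.ne' z) :=
    hf.comp (LinearMap.continuous_of_finiteDimensional (scaleZero (e := e) hρ.ne').toLinearMap).measurable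
  have hm2 : Measurable fun z => μ + f (hazard t • Pi.single 0 1) +
      ((scaleZero (e := e) hρ.ne').trans f) z := hscale.const_add _
  have hsm : Measurable fun (g : Fin (e + 1) → ℝ) (i : Fin (e + 1)) =>
      if i = 0 then standardize t (g i) else g i := by
    refine measurable_pi_lambda _ fun i => ?_
    split_ifs <;> fun_prop
  have key : ∀ g : Fin (e + 1) → ℝ, μ + f (hazard t • Pi.single 0 1) +
      f (scaleZero hρ.ne' fun i => if i = 0 then standardize t (g i) else g i) = μ + f g := by
    intro g
    rw [add_assoc, ← map_add]
    congr 2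
    funext i
    rw [Pi.add_apply, scaleZero_apply]
    by_cases hi : i = 0
    · subst hi; simp [standardize]; field_simp; ring
    · simp [hi]
  refine ⟨t, μ + f (hazard t • Pi.single 0 1), (scaleZero hρ.ne').trans f, fun z => ?_, ?_, ?_⟩
  · rw [LinearEquiv.trans_apply, add_assoc, ← map_add, h1, Pi.add_apply, scaleZero_apply]
    rw [standardize, div_le_iff₀ hρ]
    simp only [Pi.smul_apply, Pi.single_eq_same, smul_eq_mul, mul_one, if_true]
    constructor <;> intro h <;> linarith
  · rw [h2, ← map_prodLaw _ hst, Measure.map_map hm2 hsm]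
    congr 1
    funext g
    exact (key g).symm
  · have hmeas : Measurable fun g => μ + f g := hf.const_add _
    have hSm : MeasurableSet S := by
      obtain ⟨w, τ, -, rfl⟩ := hS
      exact measurableSet_le measurable_const (by fun_prop)
    have h3 : truncatedGaussian μ Sig S =
        (prodLaw e (truncLaw t)).map fun g => μ + f g := by
      have hpre : (fun g => μ + f g) ⁻¹' S = {g | t ≤ g 0} := by
        ext g; exact h1 g
      rw [truncatedGaussian, ← cond_prodLaw, ProbabilityTheory.cond, ProbabilityTheory.cond, h2,
        Measure.restrict_map hmeas hSm, Measure.map_apply hmeas hSm, hpre, Measure.map_smul]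
    rw [h3, ← map_prodLaw _ hst, Measure.map_map hm2 hsm]
    congr 1
    funext g
    exact (key g).symm

end coordinates

/-! ## The learned halfspace when the empirical third moments are accurate -/

section deterministic
open Matrix

theorem gramMatrix_congr {D m : ℕ} {X Y : ℕ → Fin D → ℝ} (h : ∀ i < m, X i = Y i) :
    gramMatrix m X = gramMatrix m Y :=
  Finset.sum_congr rfl fun i hi => by rw [h i (Finset.mem_range.1 hi)]

theorem fitVector_congr {D m : ℕ} {X Y : ℕ → Fin D → ℝ} (h : ∀ i < m, X i = Y i) :
    fitVector m X = fitVector m Y := by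
  rw [fitVector, fitVector, gramMatrix_congr h]
  congr 1
  exact Finset.sum_congr rfl fun i hi => by rw [h i (Finset.mem_range.1 hi)]

/-- The samples in homogeneous coordinates, as a sequence. -/
def homogSample {n d : ℕ} (z : Fin n → Fin d → ℝ) (i : ℕ) : Fin (d + 1) → ℝ :=
  if h : i < n then homog (z ⟨i, h⟩) else 1

theorem homogSample_of_lt {n d : ℕ} (z : Fin n → Fin d → ℝ) {i : ℕ} (h : i < n) :
    homogSample z i = homog (z ⟨i, h⟩) := dif_pos h

theorem homogeneous_eq {n d : ℕ} (x : Fin n → EuclideanSpace ℝ (Fin d)) {i : ℕ} (h : i < n) :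
    (fun a : Fin (d + 1) => RealRAM.homogeneous x i a) = homog (x ⟨i, h⟩).ofLp := by
  funext a
  induction a using Fin.lastCases with
  | last => simp [RealRAM.homogeneous, homog]
  | cast j => simp [RealRAM.homogeneous, homog, h]

theorem homog_dotProduct {d : ℕ} (u : Fin (d + 1) → ℝ) (v : Fin d → ℝ) :
    u ⬝ᵥ homog v = ∑ j : Fin d, u j.castSucc * v j + u (Fin.last d) := by
  simp [dotProduct, Fin.sum_univ_castSucc, homog]

/-- The learned halfspace contains a point only if some sample of the second half has a smaller
score. -/
theorem exists_score_le {n d : ℕ} {x : Fin n → EuclideanSpace ℝ (Fin d)} (hn : 2 ≤ n)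
    {y : EuclideanSpace ℝ (Fin d)}
    (hy : y ∈ superlevelSet
        (WithLp.toLp 2 fun j : Fin d => fitted (d + 1) ((n + 1) / 2) (RealRAM.homogeneous x) j)
        (threshold d ((n + 1) / 2) n (RealRAM.homogeneous x))) :
    ∃ i : Fin n, ∑ j : Fin d, fitted (d + 1) ((n + 1) / 2) (RealRAM.homogeneous x) j * x i j ≤
      ∑ j : Fin d, fitted (d + 1) ((n + 1) / 2) (RealRAM.homogeneous x) j * y j := by
  have h1 : threshold d ((n + 1) / 2) n (RealRAM.homogeneous x) ≤
      ∑ j : Fin d, fitted (d + 1) ((n + 1) / 2) (RealRAM.homogeneous x) j * y j := by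
    refine le_trans hy (le_of_eq ?_)
    rw [PiLp.inner_apply]
    refine Finset.sum_congr rfl fun j _ => ?_
    simp [mul_comm]
  have h2 : ∃ i, ∃ h : i < n, threshold d ((n + 1) / 2) n (RealRAM.homogeneous x) =
      score d ((n + 1) / 2) (RealRAM.homogeneous x) i := by
    rcases minFrom_mem ((n + 1) / 2) (score d ((n + 1) / 2) (RealRAM.homogeneous x))
      (score d ((n + 1) / 2) (RealRAM.homogeneous x) (n - 1)) n with h | ⟨i, -, hi, h⟩
    · exact ⟨n - 1, by omega, h⟩
    · exact ⟨i, hi, h⟩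
  obtain ⟨i, hi, h⟩ := h2
  refine ⟨⟨i, hi⟩, le_trans (le_of_eq ?_) h1⟩
  rw [h, score, ← Fin.sum_univ_eq_sum_range
    (fun j => fitted (d + 1) ((n + 1) / 2) (RealRAM.homogeneous x) j * RealRAM.homogeneous x i j)]
  refine Finset.sum_congr rfl fun j _ => ?_
  simp [RealRAM.homogeneous, hi]

/-- The scores in affine coordinates. -/
theorem fitted_dotProduct_homog {n d m : ℕ} (hmn : m ≤ n) (c : EuclideanSpace ℝ (Fin d))
    (f : (Fin d → ℝ) ≃ₗ[ℝ] EuclideanSpace ℝ (Fin d)) {z : Fin n → Fin d → ℝ}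
    (hdet : IsUnit (gramMatrix m (homogSample z)).det) (y : Fin d → ℝ) :
    (fun a : Fin (d + 1) => fitted (d + 1) m
        (RealRAM.homogeneous fun i => c + f (z i)) a) ⬝ᵥ homog (c + f y).ofLp =
      fitVector m (homogSample z) ⬝ᵥ homog y := by
  obtain ⟨B, hB, hBz⟩ := exists_homog_mulVec c f
  have hX : ∀ i < m, (fun a : Fin (d + 1) => RealRAM.homogeneous (fun i => c + f (z i)) i a) =
      B *ᵥ homogSample z i := fun i hi => by
    rw [homogeneous_eq _ (hi.trans_le hmn), homogSample_of_lt _ (hi.trans_le hmn), hBz]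
  have hdet' : IsUnit (gramMatrix m fun i (a : Fin (d + 1)) =>
      RealRAM.homogeneous (fun i => c + f (z i)) i a).det := by
    rw [gramMatrix_congr hX, gramMatrix_mulVec, det_mul, det_mul, det_transpose]
    exact (hB.mul hdet).mul hB
  have hw : (fun a : Fin (d + 1) => fitted (d + 1) m
      (RealRAM.homogeneous fun i => c + f (z i)) a) = fitVector m fun i => B *ᵥ homogSample z i := by
    funext a
    rw [fitted_eq_fitVector hdet', fitVector_congr hX]
  rw [hw, hBz, fitVector_dotProduct_mulVec hB]

theorem le_of_mem_learned {n e m : ℕ} (hn : 2 ≤ n) (hm : m = (n + 1) / 2)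
    (c : EuclideanSpace ℝ (Fin (e + 1)))
    (f : (Fin (e + 1) → ℝ) ≃ₗ[ℝ] EuclideanSpace ℝ (Fin (e + 1))) {z : Fin n → Fin (e + 1) → ℝ}
    {T : Fin (e + 2) → Fin (e + 2) → Fin (e + 2) → ℝ} {κ B η η' A : ℝ}
    (hTl : ∀ a b, T a b (Fin.last _) = (1 : Matrix (Fin (e + 2)) (Fin (e + 2)) ℝ) a b)
    (hT0 : ∑ a, T (Fin.castSucc 0) a a = κ)
    (hTj : ∀ j : Fin (e + 1), j ≠ 0 → ∑ a, T j.castSucc a a = 0)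
    (hB : 1 ≤ B) (hzB : ∀ i j, |z i j| ≤ B) (hzA : ∀ i, A ≤ z i 0)
    (hη : 0 ≤ η) (hηd : ((e + 2 : ℕ) : ℝ) * η ≤ 1 / 2)
    (hT : ∀ a b c, |(m : ℝ)⁻¹ * ∑ i ∈ Finset.range m,
      homogSample z i a * homogSample z i b * homogSample z i c - T a b c| ≤ η)
    (hη' : 7 * ((e + 2 : ℕ) : ℝ) ^ 3 * B ^ 3 * η ≤ η') (hκ : η' ≤ κ / 2) (hκ0 : 0 < κ)
    {y : Fin (e + 1) → ℝ} (hy : ∀ j, j ≠ 0 → |y j| ≤ B)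
    (hmem : c + f y ∈ superlevelSet
        (WithLp.toLp 2 fun j : Fin (e + 1) =>
          fitted (e + 2) m (RealRAM.homogeneous fun i => c + f (z i)) j)
        (threshold (e + 1) m n (RealRAM.homogeneous fun i => c + f (z i)))) :
    A - 4 * e * η' * B / κ ≤ y 0 := by
  have hm0 : 0 < m := by omega
  have hmn : m ≤ n := by omega
  have hml : ∀ i < m, homogSample z i (Fin.last _) = 1 := fun i hi => by
    rw [homogSample_of_lt z (hi.trans_le hmn), homog, Fin.snoc_last]
  have hmB : ∀ i < m, ∀ a, |homogSample z i a| ≤ B := fun i hi a => by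
    rw [homogSample_of_lt z (hi.trans_le hmn), homog]
    induction a using Fin.lastCases with
    | last => rw [Fin.snoc_last]; simpa using hB
    | cast j => rw [Fin.snoc_castSucc]; exact hzB _ _
  obtain ⟨hdet, hu⟩ := abs_fitVector_sub_le hm0 hml hB hmB hTl hη hηd hT
  obtain ⟨i, hi⟩ := exists_score_le hn (hm ▸ hmem)
  rw [← hm] at hi
  have h1 := fitted_dotProduct_homog hmn c f hdet y
  have h2 := fitted_dotProduct_homog hmn c f hdet (z i)
  rw [homog_dotProduct] at h1 h2
  have h3 : fitVector m (homogSample z) ⬝ᵥ homog (z i) ≤ fitVector m (homogSample z) ⬝ᵥ homog y := by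
    rw [← h1, ← h2]
    simpa using hi
  rw [homog_dotProduct, homog_dotProduct, add_le_add_iff_right, Fin.sum_univ_succ,
    Fin.sum_univ_succ] at h3
  obtain ⟨u, hu'⟩ : ∃ u : Fin (e + 2) → ℝ, ∀ a, u a = m * fitVector m (homogSample z) a :=
    ⟨_, fun a => rfl⟩
  have hm0' : (0 : ℝ) < m := Nat.cast_pos.2 hm0
  have h4 := mul_le_mul_of_nonneg_left h3 hm0'.le
  rw [mul_add, mul_add, Finset.mul_sum, Finset.mul_sum] at h4
  simp only [← mul_assoc, ← hu'] at h4 hu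
  have hu0 : |u (Fin.castSucc 0) - κ| ≤ η' := by
    have := hu (Fin.castSucc 0)
    rw [hT0] at this
    exact this.trans hη'
  have huj : ∀ j : Fin e, |u (Fin.castSucc j.succ)| ≤ η' := fun j => by
    have := hu (Fin.castSucc j.succ)
    rw [hTj _ (Fin.succ_ne_zero j), sub_zero] at this
    exact this.trans hη'
  have hη'0 : 0 ≤ η' := (abs_nonneg _).trans hu0
  have h5 : ∑ j : Fin e, (u (Fin.castSucc j.succ) * y j.succ -
      u (Fin.castSucc j.succ) * z i j.succ) ≤ ∑ _j : Fin e, η' * (2 * B) := by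
    refine Finset.sum_le_sum fun j _ => ?_
    rw [← mul_sub]
    refine (le_abs_self _).trans ?_
    rw [abs_mul]
    refine mul_le_mul (huj j) ?_ (abs_nonneg _) hη'0
    have := abs_sub (y j.succ) (z i j.succ)
    linarith [hy _ (Fin.succ_ne_zero j), hzB i j.succ]
  rw [Finset.sum_sub_distrib, Finset.sum_const, Finset.card_univ, Fintype.card_fin,
    nsmul_eq_mul] at h5
  have h6 := (abs_le.1 hu0).1
  have h7 : κ / 2 ≤ u (Fin.castSucc 0) := by linarith
  have h8 : -(2 * e * η' * B) ≤ u (Fin.castSucc 0) * (y 0 - z i 0) := by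
    rw [mul_sub]; linarith
  have h9 : -(4 * e * η' * B / κ) ≤ y 0 - z i 0 := by
    rcases le_or_gt 0 (y 0 - z i 0) with h | h
    · have : 0 ≤ 4 * e * η' * B / κ := by positivity
      linarith
    · rw [neg_le_iff_add_nonneg, ← sub_le_iff_le_add, zero_sub, neg_le_iff_add_nonneg,
        ← neg_le_iff_add_nonneg', le_div_iff₀ hκ0]
      have := mul_le_mul_of_nonpos_right h7 h.le
      linarith
  linarith [hzA i]

end deterministic

/-! ## Third moments of standardized coordinates and their concentration -/

section moments
open Real

variable {e : ℕ} {ν : Measure ℝ} {h κ : ℝ}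

namespace IsStandardized

theorem abs_pow_le_exp (h0 : 0 < h) {k : ℕ} (z : ℝ) :
    |z| ^ k ≤ (k.factorial / h ^ k : ℝ) * exp (h * |z|) := by
  have h1 := Real.pow_div_factorial_le_exp (h * |z|) (by positivity) k
  rw [mul_pow, div_le_iff₀ (by positivity)] at h1
  rw [div_mul_eq_mul_div, le_div_iff₀ (by positivity)]
  linarith

theorem integral_tail_le (hν : IsStandardized ν h κ) (h0 : 0 < h) (B : ℝ) :
    Integrable (fun z => if B < |z| then |z| ^ 3 else 0) ν ∧
    ∫ z, (if B < |z| then |z| ^ 3 else 0) ∂ν ≤ 192 / h ^ 3 * exp (-(h * B / 2)) := by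
  have hle : ∀ z : ℝ, (if B < |z| then |z| ^ 3 else 0) ≤
      48 / h ^ 3 * exp (-(h * B / 2)) * exp (h * |z|) := by
    intro z
    split_ifs with hz
    · have h1 := abs_pow_le_exp (half_pos h0) (k := 3) z
      have h2 : exp (h / 2 * |z|) ≤ exp (-(h * B / 2)) * exp (h * |z|) := by
        rw [← Real.exp_add]
        refine Real.exp_le_exp.2 ?_
        nlinarith
      calc |z| ^ 3 ≤ 48 / h ^ 3 * exp (h / 2 * |z|) := by
            refine h1.trans (le_of_eq ?_)
            norm_num [Nat.factorial]
            field_simp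
            norm_num
        _ ≤ 48 / h ^ 3 * (exp (-(h * B / 2)) * exp (h * |z|)) :=
            mul_le_mul_of_nonneg_left h2 (by positivity)
        _ = _ := by ring
    · positivity
  have hm : Measurable fun z : ℝ => if B < |z| then |z| ^ 3 else 0 :=
    Measurable.ite (measurableSet_lt measurable_const (by fun_prop)) (by fun_prop) measurable_const
  have hi : Integrable (fun z => if B < |z| then |z| ^ 3 else 0) ν := by
    refine (hν.integrable_exp.const_mul (48 / h ^ 3 * exp (-(h * B / 2)))).mono'
      hm.aestronglyMeasurable (.of_forall fun z => ?_)
    rw [Real.norm_of_nonneg (by split_ifs <;> positivity)]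
    exact hle z
  refine ⟨hi, (integral_mono hi (hν.integrable_exp.const_mul _) hle).trans ?_⟩
  rw [integral_const_mul]
  calc _ ≤ 48 / h ^ 3 * exp (-(h * B / 2)) * 4 :=
        mul_le_mul_of_nonneg_left hν.exp_le (by positivity)
    _ = _ := by ring

theorem measure_lt_abs_le (hν : IsStandardized ν h κ) (h0 : 0 < h) (B : ℝ) :
    ν {z | B < |z|} ≤ ENNReal.ofReal (4 * exp (-(h * B))) := by
  have h1 := mul_meas_ge_le_lintegral₀ (μ := ν) (f := fun z => ENNReal.ofReal (exp (h * |z|)))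
    (by fun_prop) (ENNReal.ofReal (exp (h * B)))
  rw [← ofReal_integral_eq_lintegral_ofReal hν.integrable_exp (.of_forall fun z => by positivity)]
    at h1
  have h2 := h1.trans (ENNReal.ofReal_le_ofReal hν.exp_le)
  rw [mul_comm, ← ENNReal.le_div_iff_mul_le (.inl (by simp [exp_pos])) (.inl (by simp)),
    ← ENNReal.ofReal_div_of_pos (exp_pos _)] at h2
  refine (measure_mono fun z hz => ?_).trans (h2.trans (le_of_eq ?_))
  · exact ENNReal.ofReal_le_ofReal (Real.exp_le_exp.2
      (mul_le_mul_of_nonneg_left (le_of_lt hz) h0.le))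
  · rw [Real.exp_neg, div_eq_mul_inv]

end IsStandardized

theorem isStandardized_coordLaw (hν : IsStandardized ν h κ) (h1 : h ≤ 1 / 2) (i : Fin (e + 1)) :
    IsStandardized (coordLaw ν i) h (if i = 0 then κ else 0) := by
  rw [coordLaw]
  split_ifs
  · exact hν
  · exact isStandardized_stdGaussian h1

variable [IsProbabilityMeasure ν]

theorem map_eval_prodLaw (i : Fin (e + 1)) :
    (prodLaw e ν).map (fun z => z i) = coordLaw ν i :=
  (measurePreserving_eval (coordLaw (e := e) ν) i).map_eq

theorem integral_eval_prodLaw {f : ℝ → ℝ} (hf : Measurable f) (i : Fin (e + 1)) :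
    ∫ z, f (z i) ∂(prodLaw e ν) = ∫ x, f x ∂(coordLaw ν i) := by
  rw [← map_eval_prodLaw i, integral_map (measurable_pi_apply i).aemeasurable hf.aestronglyMeasurable]

theorem integrable_eval_prodLaw {f : ℝ → ℝ} (hf : Measurable f) {i : Fin (e + 1)}
    (h : Integrable f (coordLaw ν i)) : Integrable (fun z => f (z i)) (prodLaw e ν) := by
  rw [← map_eval_prodLaw i, integrable_map_measure hf.aestronglyMeasurable
    (measurable_pi_apply i).aemeasurable] at h
  exact h

theorem integral_eval_mul_eval_prodLaw {f g : ℝ → ℝ} (hf : Measurable f) (hg : Measurable g)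
    {i j : Fin (e + 1)} (hij : i ≠ j) :
    ∫ z, f (z i) * g (z j) ∂(prodLaw e ν) =
      (∫ x, f x ∂(coordLaw ν i)) * ∫ x, g x ∂(coordLaw ν j) := by
  have hI : iIndepFun (fun (i : Fin (e + 1)) (z : Fin (e + 1) → ℝ) => z i) (prodLaw e ν) :=
    iIndepFun_pi (X := fun _ x => x) fun i => aemeasurable_id
  rw [(hI.indepFun hij).integral_fun_comp_mul_comp
    (measurable_pi_apply i).aemeasurable (measurable_pi_apply j).aemeasurable
    hf.aestronglyMeasurable hg.aestronglyMeasurable, integral_eval_prodLaw hf,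
    integral_eval_prodLaw hg]

/-- The third moments in homogeneous coordinates. -/
noncomputable def thirdMoment (e : ℕ) (ν : Measure ℝ) (a b c : Fin (e + 2)) : ℝ :=
  ∫ z, homog z a * homog z b * homog z c ∂(prodLaw e ν)

theorem thirdMoment_last (hν : IsStandardized ν h κ) (h1 : h ≤ 1 / 2) (a b : Fin (e + 2)) :
    thirdMoment e ν a b (Fin.last _) = (1 : Matrix (Fin (e + 2)) (Fin (e + 2)) ℝ) a b := by
  have hst := fun i : Fin (e + 1) => isStandardized_coordLaw hν h1 i
  have h0 : ∀ i : Fin (e + 1), ∫ z, z i ∂(prodLaw e ν) = 0 := fun i => by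
    rw [integral_eval_prodLaw (f := fun x => x) measurable_id, (hst i).mean]
  rw [thirdMoment, Matrix.one_apply]
  simp only [homog, Fin.snoc_last, mul_one]
  induction a using Fin.lastCases with
  | last =>
    induction b using Fin.lastCases with
    | last => simp
    | cast j =>
      simp only [Fin.snoc_last, Fin.snoc_castSucc, one_mul, h0]
      rw [if_neg (Fin.castSucc_lt_last j).ne']
  | cast i =>
    induction b using Fin.lastCases with
    | last =>
      simp only [Fin.snoc_last, Fin.snoc_castSucc, mul_one, h0]
      rw [if_neg (Fin.castSucc_lt_last i).ne]
    | cast j =>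
      simp only [Fin.snoc_castSucc, Fin.castSucc_inj]
      split_ifs with hij
      · subst hij
        simp only [← sq]
        rw [integral_eval_prodLaw (f := fun x => x ^ 2) (by fun_prop), (hst i).sq]
      · rw [integral_eval_mul_eval_prodLaw (f := fun x => x) (g := fun x => x) measurable_id
          measurable_id hij, (hst i).mean, zero_mul]

theorem sum_thirdMoment (hν : IsStandardized ν h κ) (h1 : h ≤ 1 / 2) (i : Fin (e + 1)) :
    ∑ a, thirdMoment e ν i.castSucc a a = if i = 0 then κ else 0 := by
  have hst := fun i : Fin (e + 1) => isStandardized_coordLaw hν h1 i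
  rw [Fin.sum_univ_castSucc, Finset.sum_eq_single i]
  · have h3 : thirdMoment e ν i.castSucc (Fin.last _) (Fin.last _) = 0 := by
      rw [thirdMoment_last hν h1, Matrix.one_apply, if_neg (Fin.castSucc_lt_last i).ne]
    rw [h3, add_zero, thirdMoment]
    simp only [homog, Fin.snoc_castSucc]
    have : ∀ z : Fin (e + 1) → ℝ, z i * z i * z i = z i ^ 3 := fun z => by ring
    simp only [this]
    rw [integral_eval_prodLaw (f := fun x => x ^ 3) (by fun_prop), (hst i).cube]
  · intro j _ hj
    rw [thirdMoment]
    simp only [homog, Fin.snoc_castSucc, mul_assoc]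
    rw [integral_eval_mul_eval_prodLaw (f := fun x => x) (g := fun x => x * x) measurable_id
      (by fun_prop) hj.symm, (hst i).mean, zero_mul]
  · simp

/-- The product of three numbers, replaced by `0` if one of them is large. -/
noncomputable def clippedProd (B x y z : ℝ) : ℝ :=
  if |x| ≤ B ∧ |y| ≤ B ∧ |z| ≤ B then x * y * z else 0

theorem abs_clippedProd_le {B : ℝ} (hB : 0 ≤ B) (x y z : ℝ) : |clippedProd B x y z| ≤ B ^ 3 := by
  rw [clippedProd]
  split_ifs with h
  · rw [abs_mul, abs_mul]
    calc |x| * |y| * |z| ≤ B * B * B := by gcongr; exacts [h.1, h.2.1, h.2.2]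
      _ = B ^ 3 := by ring
  · rw [abs_zero]; positivity

theorem measurable_clippedProd (B : ℝ) :
    Measurable fun v : ℝ × ℝ × ℝ => clippedProd B v.1 v.2.1 v.2.2 := by
  have hx : Measurable fun v : ℝ × ℝ × ℝ => |v.1| := by fun_prop
  have hy : Measurable fun v : ℝ × ℝ × ℝ => |v.2.1| := by fun_prop
  have hz : Measurable fun v : ℝ × ℝ × ℝ => |v.2.2| := by fun_prop
  refine Measurable.ite ?_ (by fun_prop) measurable_const
  exact (measurableSet_le hx measurable_const).inter
    ((measurableSet_le hy measurable_const).inter (measurableSet_le hz measurable_const))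

/-- The cube of a large number. -/
noncomputable def tailCube (B x : ℝ) : ℝ := if B < |x| then |x| ^ 3 else 0

theorem abs_sub_clippedProd_le {B : ℝ} (x y z : ℝ) :
    |x * y * z - clippedProd B x y z| ≤ tailCube B x + tailCube B y + tailCube B z := by
  have hnn : ∀ x, 0 ≤ tailCube B x := fun x => by rw [tailCube]; split_ifs <;> positivity
  rw [clippedProd]
  split_ifs with h
  · rw [sub_self, abs_zero]; linarith [hnn x, hnn y, hnn z]
  · rw [sub_zero, abs_mul, abs_mul]
    have key : ∀ {a b c : ℝ}, 0 ≤ a → 0 ≤ b → a ≤ c → b ≤ c → a * b * c ≤ c ^ 3 := by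
      intro a b c ha hb hac hbc
      have hc : 0 ≤ c := ha.trans hac
      calc a * b * c ≤ c * c * c := by gcongr
        _ = c ^ 3 := by ring
    have hx := abs_nonneg x
    have hy := abs_nonneg y
    have hz := abs_nonneg z
    have hlt : ∀ {u : ℝ}, (|x| ≤ |u| ∧ |y| ≤ |u| ∧ |z| ≤ |u|) → tailCube B u = |u| ^ 3 := by
      intro u hu
      rw [tailCube, if_pos]
      by_contra! hle
      exact h ⟨hu.1.trans hle, hu.2.1.trans hle, hu.2.2.trans hle⟩
    rcases le_total |x| |y| with h1 | h1
    · rcases le_total |y| |z| with h2 | h2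
      · have := key hx hy (h1.trans h2) h2
        linarith [hlt ⟨h1.trans h2, h2, le_rfl⟩, hnn x, hnn y]
      · have := key hx hz h1 h2
        have h3 : |x| * |y| * |z| = |x| * |z| * |y| := by ring
        linarith [hlt ⟨h1, le_rfl, h2⟩, hnn x, hnn z]
    · rcases le_total |x| |z| with h2 | h2
      · have := key hx hy h2 (h1.trans h2)
        linarith [hlt ⟨h2, h1.trans h2, le_rfl⟩, hnn x, hnn y]
      · have := key hy hz h1 h2
        have h3 : |x| * |y| * |z| = |y| * |z| * |x| := by ring
        linarith [hlt ⟨le_rfl, h1, h2⟩, hnn y, hnn z]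

theorem measurable_homog (a : Fin (e + 2)) :
    Measurable fun z : Fin (e + 1) → ℝ => homog z a := by
  simp only [homog]
  induction a using Fin.lastCases with
  | last => simp only [Fin.snoc_last]; exact measurable_const
  | cast j => simp only [Fin.snoc_castSucc]; fun_prop

theorem tailCube_homog_le (hν : IsStandardized ν h κ) (h0 : 0 < h) (h1 : h ≤ 1 / 2) {B : ℝ}
    (hB : 1 ≤ B) (a : Fin (e + 2)) :
    Integrable (fun z => tailCube B (homog z a)) (prodLaw e ν) ∧
    ∫ z, tailCube B (homog z a) ∂(prodLaw e ν) ≤ 192 / h ^ 3 * exp (-(h * B / 2)) := by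
  induction a using Fin.lastCases with
  | last =>
    simp only [homog, Fin.snoc_last, tailCube, abs_one, if_neg hB.not_gt]
    exact ⟨integrable_zero _ _ _, by rw [integral_zero]; positivity⟩
  | cast j =>
    have hm : Measurable (tailCube B) :=
      Measurable.ite (measurableSet_lt measurable_const (by fun_prop)) (by fun_prop)
        measurable_const
    have := (isStandardized_coordLaw hν h1 j).integral_tail_le h0 B
    simp only [homog, Fin.snoc_castSucc]
    exact ⟨integrable_eval_prodLaw hm this.1, (integral_eval_prodLaw hm j).trans_le this.2⟩

theorem integrable_homog_mul (hν : IsStandardized ν h κ) (h0 : 0 < h) (h1 : h ≤ 1 / 2)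
    (a b c : Fin (e + 2)) :
    Integrable (fun z => homog z a * homog z b * homog z c) (prodLaw e ν) := by
  have hm := fun a : Fin (e + 2) => measurable_homog a
  have ht := fun a => (tailCube_homog_le (e := e) hν h0 h1 le_rfl a).1
  refine (((integrable_const (1 : ℝ)).add (ht a)).add ((ht b).add (ht c))).mono'
    (((hm a).mul (hm b)).mul (hm c)).aestronglyMeasurable (.of_forall fun z => ?_)
  have h2 := abs_sub_clippedProd_le (B := 1) (homog z a) (homog z b) (homog z c)
  have h3 := abs_clippedProd_le zero_le_one (homog z a) (homog z b) (homog z c)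
  have h4 := abs_sub_abs_le_abs_sub (homog z a * homog z b * homog z c)
    (clippedProd 1 (homog z a) (homog z b) (homog z c))
  simp only [Pi.add_apply, Real.norm_eq_abs]
  linarith

/-- The expectation of the clipped product. -/
noncomputable def clippedMoment (e : ℕ) (ν : Measure ℝ) (B : ℝ) (a b c : Fin (e + 2)) : ℝ :=
  ∫ z, clippedProd B (homog z a) (homog z b) (homog z c) ∂(prodLaw e ν)

theorem measurable_clippedProd_homog (B : ℝ) (a b c : Fin (e + 2)) :
    Measurable fun z : Fin (e + 1) → ℝ => clippedProd B (homog z a) (homog z b) (homog z c) :=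
  (measurable_clippedProd B).comp
    ((measurable_homog a).prodMk ((measurable_homog b).prodMk (measurable_homog c)))

theorem abs_thirdMoment_sub_clippedMoment_le (hν : IsStandardized ν h κ) (h0 : 0 < h)
    (h1 : h ≤ 1 / 2) {B : ℝ} (hB : 1 ≤ B) (a b c : Fin (e + 2)) :
    |thirdMoment e ν a b c - clippedMoment e ν B a b c| ≤
      3 * (192 / h ^ 3 * exp (-(h * B / 2))) := by
  have ht := fun a => tailCube_homog_le (e := e) hν h0 h1 hB a
  have hi : Integrable (fun z => clippedProd B (homog z a) (homog z b) (homog z c))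
      (prodLaw e ν) :=
    (integrable_const (B ^ 3)).mono' (measurable_clippedProd_homog B a b c).aestronglyMeasurable
      (.of_forall fun z => abs_clippedProd_le (by positivity) _ _ _)
  rw [thirdMoment, clippedMoment, ← integral_sub (integrable_homog_mul hν h0 h1 a b c) hi]
  have h2 : ∫ z, (tailCube B (homog z a) + tailCube B (homog z b) + tailCube B (homog z c))
      ∂(prodLaw e ν) = _ := integral_add ((ht a).1.add (ht b).1) (ht c).1
  rw [integral_add (ht a).1 (ht b).1] at h2
  refine abs_integral_le_integral_abs.trans
    ((integral_mono (((integrable_homog_mul hν h0 h1 a b c).sub hi).abs)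
      (((ht a).1.add (ht b).1).add (ht c).1) fun z => abs_sub_clippedProd_le _ _ _).trans ?_)
  simp only [Pi.add_apply]
  rw [h2]
  linarith [(ht a).2, (ht b).2, (ht c).2]

end moments

section concentration
open Real

/-- The indices of the first `m` samples. -/
def firstIndices (n m : ℕ) : Finset (Fin n) := Finset.univ.filter fun i => i.val < m

theorem sum_firstIndices {n m : ℕ} (hmn : m ≤ n) {g : Fin n → ℝ} {G : ℕ → ℝ}
    (hg : ∀ i : Fin n, G i = g i) : ∑ i ∈ Finset.range m, G i = ∑ i ∈ firstIndices n m, g i := by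
  refine (Finset.sum_bij (fun i _ => i.val) ?_ ?_ ?_ ?_).symm
  · intro i hi
    simpa [firstIndices] using hi
  · intro i _ j _ h
    exact Fin.ext h
  · intro i hi
    have := Finset.mem_range.1 hi
    exact ⟨⟨i, this.trans_le hmn⟩, by simpa [firstIndices] using this, rfl⟩
  · intro i _
    exact (hg i).symm

theorem card_firstIndices {n m : ℕ} (hmn : m ≤ n) : ((firstIndices n m).card : ℝ) = m := by
  have := sum_firstIndices (g := fun _ => 1) (G := fun _ => 1) hmn fun _ => rfl
  simpa using this.symm

variable {Ω : Type*} [MeasurableSpace Ω] {P : Measure Ω} [IsProbabilityMeasure P]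

/-- Hoeffding's inequality for one side. -/
theorem measure_le_sum_sub_le {F : Ω → ℝ} (hF : Measurable F) {M : ℝ} (hM : ∀ ω, |F ω| ≤ M)
    {n m : ℕ} (hmn : m ≤ n) {s : ℝ} (hs : 0 ≤ s) :
    (Measure.pi fun _ : Fin n => P).real
      {z | m * s ≤ ∑ i ∈ firstIndices n m, (F (z i) - ∫ ω, F ω ∂P)} ≤
      exp (-(m * s ^ 2 / (2 * M ^ 2))) := by
  have hI : iIndepFun (fun (i : Fin n) (z : Fin n → Ω) => F (z i) - ∫ ω, F ω ∂P)
      (Measure.pi fun _ : Fin n => P) :=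
    iIndepFun_pi (X := fun _ ω => F ω - ∫ ω, F ω ∂P) fun i => (hF.sub_const _).aemeasurable
  have hsub : ∀ i : Fin n, HasSubgaussianMGF (fun z : Fin n → Ω => F (z i) - ∫ ω, F ω ∂P)
      ((‖M - -M‖₊ / 2) ^ 2) (Measure.pi fun _ : Fin n => P) := by
    intro i
    have h1 := hasSubgaussianMGF_of_mem_Icc (μ := P) (X := F) hF.aemeasurable
      (.of_forall fun ω => abs_le.1 (hM ω))
    have h2 : (Measure.pi fun _ : Fin n => P).map (fun z => z i) = P :=
      (measurePreserving_eval (fun _ : Fin n => P) i).map_eq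
    have h3 := HasSubgaussianMGF.of_map (μ := Measure.pi fun _ : Fin n => P)
      (Y := fun z : Fin n → Ω => z i) (X := fun ω => F ω - ∫ ω, F ω ∂P)
      (measurable_pi_apply i).aemeasurable (by rw [h2]; exact h1)
    exact h3
  refine (HasSubgaussianMGF.measure_sum_ge_le_of_iIndepFun hI (s := firstIndices n m)
    (fun i _ => hsub i) (by positivity)).trans (le_of_eq ?_)
  congr 1
  rw [Finset.sum_const, nsmul_eq_mul]
  push_cast
  rw [card_firstIndices hmn]
  rcases eq_or_ne (m : ℝ) 0 with h0 | h0
  · simp [h0]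
  rcases eq_or_ne M 0 with hM0 | hM0
  · simp [hM0]
  have h4 : ‖M - -M‖ ^ 2 = (2 * M) ^ 2 := by rw [Real.norm_eq_abs, sq_abs]; ring
  rw [div_pow, h4]
  field_simp

/-- Hoeffding's inequality. -/
theorem measure_lt_abs_average_sub_le {F : Ω → ℝ} (hF : Measurable F) {M : ℝ}
    (hM : ∀ ω, |F ω| ≤ M) {n m : ℕ} (hm : 0 < m) (hmn : m ≤ n) {s : ℝ} (hs : 0 ≤ s) :
    (Measure.pi fun _ : Fin n => P)
      {z | s < |(m : ℝ)⁻¹ * ∑ i ∈ firstIndices n m, F (z i) - ∫ ω, F ω ∂P|} ≤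
      ENNReal.ofReal (2 * exp (-(m * s ^ 2 / (2 * M ^ 2)))) := by
  have h1 := measure_le_sum_sub_le (P := P) hF hM hmn hs
  have h2 := measure_le_sum_sub_le (P := P) (F := fun ω => -F ω) hF.neg
    (M := M) (fun ω => by rw [abs_neg]; exact hM ω) hmn hs
  rw [← ENNReal.ofReal_le_ofReal_iff (exp_pos _).le, ofReal_measureReal] at h1 h2
  rw [two_mul, ENNReal.ofReal_add (exp_pos _).le (exp_pos _).le]
  refine (measure_mono ?_).trans ((measure_union_le _ _).trans (add_le_add h1 h2))
  intro z hz
  have hm' : (0 : ℝ) < m := Nat.cast_pos.2 hm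
  have h3 : m * ((m : ℝ)⁻¹ * ∑ i ∈ firstIndices n m, F (z i) - ∫ ω, F ω ∂P) =
      ∑ i ∈ firstIndices n m, (F (z i) - ∫ ω, F ω ∂P) := by
    rw [Finset.sum_sub_distrib, Finset.sum_const, nsmul_eq_mul, card_firstIndices hmn]
    field_simp
  rw [Set.mem_ofPred_eq] at hz
  rcases lt_abs.1 hz with h | h
  · left
    rw [Set.mem_ofPred_eq]
    rw [← h3]
    exact mul_le_mul_of_nonneg_left h.le hm'.le
  · right
    rw [Set.mem_ofPred_eq]
    have h4 : ∑ i ∈ firstIndices n m, (-F (z i) - ∫ ω, -F ω ∂P) =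
        -∑ i ∈ firstIndices n m, (F (z i) - ∫ ω, F ω ∂P) := by
      rw [integral_neg, ← Finset.sum_neg_distrib]
      exact Finset.sum_congr rfl fun i _ => by ring
    rw [h4, ← h3, ← mul_neg]
    exact mul_le_mul_of_nonneg_left h.le hm'.le

variable {e : ℕ} {ν : Measure ℝ} [IsProbabilityMeasure ν] {h κ : ℝ}

theorem measure_pi_lt_abs_le (hν : IsStandardized ν h κ) (h0 : 0 < h) (h1 : h ≤ 1 / 2) {n : ℕ}
    (B : ℝ) (i : Fin n) (j : Fin (e + 1)) :
    (Measure.pi fun _ : Fin n => prodLaw e ν) {z | B < |z i j|} ≤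
      ENNReal.ofReal (4 * exp (-(h * B))) := by
  have hm : MeasurableSet {x : ℝ | B < |x|} := measurableSet_lt measurable_const (by fun_prop)
  have h2 : (Measure.pi fun _ : Fin n => prodLaw e ν).map (fun z => z i) = prodLaw e ν :=
    (measurePreserving_eval (fun _ : Fin n => prodLaw e ν) i).map_eq
  have h3 := (isStandardized_coordLaw hν h1 j).measure_lt_abs_le h0 B
  rwa [← map_eval_prodLaw j, Measure.map_apply (measurable_pi_apply j) hm, ← h2,
    Measure.map_apply (measurable_pi_apply i) (hm.preimage (measurable_pi_apply j))] at h3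

/-- The samples are bounded, and their third moments are close to the expected ones. -/
def Accurate (e : ℕ) (ν : Measure ℝ) {n : ℕ} (m : ℕ) (B η : ℝ) (z : Fin n → Fin (e + 1) → ℝ) :
    Prop :=
  (∀ i j, |z i j| ≤ B) ∧ ∀ a b c, |(m : ℝ)⁻¹ * ∑ i ∈ Finset.range m,
    homogSample z i a * homogSample z i b * homogSample z i c - thirdMoment e ν a b c| ≤ η

theorem measure_not_accurate_le (hν : IsStandardized ν h κ) (h0 : 0 < h) (h1 : h ≤ 1 / 2)
    {n m : ℕ} (hm : 0 < m) (hmn : m ≤ n) {B η : ℝ} (hB : 1 ≤ B) (hη : 0 ≤ η)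
    (hbias : 3 * (192 / h ^ 3 * exp (-(h * B / 2))) ≤ η / 2) :
    (Measure.pi fun _ : Fin n => prodLaw e ν) {z | ¬ Accurate e ν m B η z} ≤
      ENNReal.ofReal (n * (e + 1 : ℕ) * (4 * exp (-(h * B))) +
        (e + 2 : ℕ) ^ 3 * (2 * exp (-(m * (η / 2) ^ 2 / (2 * (B ^ 3) ^ 2))))) := by
  have hsub : {z : Fin n → Fin (e + 1) → ℝ | ¬ Accurate e ν m B η z} ⊆
      (⋃ q : Fin n × Fin (e + 1), {z | B < |z q.1 q.2|}) ∪
      ⋃ q : Fin (e + 2) × Fin (e + 2) × Fin (e + 2), {z | η / 2 < |(m : ℝ)⁻¹ *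
        ∑ i ∈ firstIndices n m, clippedProd B (homog (z i) q.1) (homog (z i) q.2.1)
          (homog (z i) q.2.2) - clippedMoment e ν B q.1 q.2.1 q.2.2|} := by
    intro z hz
    by_contra hcon
    rw [Set.mem_union, not_or, Set.mem_iUnion, Set.mem_iUnion, not_exists, not_exists] at hcon
    have hzB : ∀ i j, |z i j| ≤ B := fun i j => not_lt.1 (hcon.1 (i, j))
    refine hz ⟨hzB, fun a b c => ?_⟩
    have h2 := hcon.2 (a, b, c)
    simp only [Set.mem_ofPred_eq, not_lt] at h2
    have h3 := abs_thirdMoment_sub_clippedMoment_le (e := e) hν h0 h1 hB a b c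
    have hhB : ∀ i a, |homog (z i) a| ≤ B := fun i a => by
      rw [homog]
      induction a using Fin.lastCases with
      | last => rw [Fin.snoc_last]; simpa using hB
      | cast j => rw [Fin.snoc_castSucc]; exact hzB _ _
    have h4 : ∑ i ∈ Finset.range m,
        homogSample z i a * homogSample z i b * homogSample z i c =
        ∑ i ∈ firstIndices n m, clippedProd B (homog (z i) a) (homog (z i) b) (homog (z i) c) := by
      refine sum_firstIndices hmn fun i => ?_
      rw [homogSample_of_lt z i.2, clippedProd, if_pos ⟨hhB i a, hhB i b, hhB i c⟩]
    rw [h4]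
    refine (abs_sub_le _ (clippedMoment e ν B a b c) _).trans ?_
    rw [abs_sub_comm (clippedMoment e ν B a b c)]
    linarith
  refine (measure_mono hsub).trans ((measure_union_le _ _).trans ?_)
  rw [ENNReal.ofReal_add (by positivity) (by positivity)]
  refine add_le_add ?_ ?_
  · refine (measure_iUnion_fintype_le _ _).trans
      ((Finset.sum_le_sum fun q _ => measure_pi_lt_abs_le hν h0 h1 B q.1 q.2).trans (le_of_eq ?_))
    rw [Finset.sum_const, Finset.card_univ, Fintype.card_prod, Fintype.card_fin, Fintype.card_fin,
      nsmul_eq_mul, ← Nat.cast_mul, ENNReal.ofReal_mul (p := ((n * (e + 1) : ℕ) : ℝ)) (by positivity),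
      ENNReal.ofReal_natCast]
  · refine (measure_iUnion_fintype_le _ _).trans
      ((Finset.sum_le_sum fun q _ => measure_lt_abs_average_sub_le
        (measurable_clippedProd_homog B q.1 q.2.1 q.2.2)
        (fun z => abs_clippedProd_le (zero_le_one.trans hB) _ _ _) hm hmn
        (by positivity)).trans (le_of_eq ?_))
    rw [Finset.sum_const, Finset.card_univ, Fintype.card_prod, Fintype.card_prod,
      Fintype.card_fin, nsmul_eq_mul, ← Nat.cast_pow,
      ENNReal.ofReal_mul (p := (((e + 2) ^ 3 : ℕ) : ℝ)) (by positivity), ENNReal.ofReal_natCast]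
    congr 2
    ring

end concentration

/-! ## Validation of a threshold on fresh samples -/

section validation
open Set

variable {Ω : Type*} [MeasurableSpace Ω]

theorem measure_lt_measure_Iio_le (ν : Measure ℝ) [IsProbabilityMeasure ν] {ε : ℝ≥0∞} :
    ν {a | ε < ν (Iio a)} ≤ 1 - ε := by
  have hup : IsUpperSet {a | ε < ν (Iio a)} := fun a b hab ha =>
    lt_of_lt_of_le ha (measure_mono (Iio_subset_Iio hab))
  rw [hup.ordConnected.measurableSet.measure_eq_iSup_isCompact_of_ne_top (measure_ne_top _ _)]
  refine iSup₂_le fun K hKU => iSup_le fun hK => ?_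
  rcases K.eq_empty_or_nonempty with rfl | hne
  · simp
  have hmem := hK.sInf_mem hne
  have h1 : K ⊆ (Iio (sInf K))ᶜ := fun x hx => not_lt.2 (csInf_le hK.bddBelow hx)
  refine (measure_mono h1).trans ?_
  rw [prob_compl_eq_one_sub measurableSet_Iio]
  exact tsub_le_tsub_left (le_of_lt (hKU hmem)) _

theorem measure_lt_measure_lt_le (P : Measure Ω) [IsProbabilityMeasure P] {g : Ω → ℝ}
    (hg : Measurable g) {ε : ℝ≥0∞} : P {ω | ε < P {y | g y < g ω}} ≤ 1 - ε := by
  have : IsProbabilityMeasure (P.map g) := Measure.isProbabilityMeasure_map hg.aemeasurable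
  refine le_trans (le_of_eq ?_) (measure_lt_measure_Iio_le (P.map g) (ε := ε))
  have hup : IsUpperSet {a | ε < P.map g (Iio a)} := fun a b hab ha =>
    lt_of_lt_of_le ha (measure_mono (Iio_subset_Iio hab))
  rw [Measure.map_apply hg hup.ordConnected.measurableSet]
  congr 1
  ext ω
  simp only [mem_ofPred_eq, mem_preimage, Measure.map_apply hg measurableSet_Iio]
  rfl

/-- If a score depends on the first `m` samples only, then the mass of the points with a score
below those of all other samples is small. -/
theorem measure_validation_le (P : Measure Ω) [IsProbabilityMeasure P] {n m : ℕ} (hmn : m ≤ n)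
    (ω₀ : Ω) {g : (Fin n → Ω) → Ω → ℝ} (hg : Measurable fun q : (Fin n → Ω) × Ω => g q.1 q.2)
    (hcongr : ∀ x x', (∀ i : Fin n, i.val < m → x i = x' i) → g x = g x') (ε : ℝ≥0∞) :
    (Measure.pi fun _ : Fin n => P)
      {x | ε < P {y | ∀ i : Fin n, m ≤ i.val → g x y < g x (x i)}} ≤ (1 - ε) ^ (n - m) := by
  have hmp := measurePreserving_piEquivPiSubtypeProd (fun _ : Fin n => P)
    (fun i : Fin n => i.val < m)
  obtain ⟨E, hE⟩ : ∃ E : ({i : Fin n // i.val < m} → Ω) → Fin n → Ω,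
      E = fun u i => if h : i.val < m then u ⟨i, h⟩ else ω₀ := ⟨_, rfl⟩
  have hEm : Measurable E := by
    rw [hE]
    refine measurable_pi_lambda _ fun i => ?_
    by_cases h : i.val < m
    · simp only [h, dif_pos]; exact measurable_pi_apply _
    · simp only [h, dif_neg, not_false_iff]; exact measurable_const
  have hgE : Measurable fun q : ({i : Fin n // i.val < m} → Ω) × Ω => g (E q.1) q.2 :=
    hg.comp ((hEm.comp measurable_fst).prodMk measurable_snd)
  have hφ : Measurable fun q : ({i : Fin n // i.val < m} → Ω) × Ω =>
      P {y | g (E q.1) y < g (E q.1) q.2} := by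
    refine measurable_measure_prodMk_left
      (s := {r : (({i : Fin n // i.val < m} → Ω) × Ω) × Ω | g (E r.1.1) r.2 < g (E r.1.1) r.1.2})
      (measurableSet_lt ?_ ?_)
    · exact hgE.comp ((measurable_fst.comp measurable_fst).prodMk measurable_snd)
    · exact hgE.comp measurable_fst
  obtain ⟨A, hA⟩ : ∃ A : Set (({i : Fin n // i.val < m} → Ω) × ({i : Fin n // ¬ i.val < m} → Ω)),
      A = {q | ∀ i, ε < P {y | g (E q.1) y < g (E q.1) (q.2 i)}} := ⟨_, rfl⟩
  have hAm : MeasurableSet A := by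
    rw [hA, ofPred_forall]
    refine MeasurableSet.iInter fun i => measurableSet_lt measurable_const ?_
    exact hφ.comp (measurable_fst.prodMk ((measurable_pi_apply i).comp measurable_snd))
  have hsub : {x | ε < P {y | ∀ i : Fin n, m ≤ i.val → g x y < g x (x i)}} ⊆
      MeasurableEquiv.piEquivPiSubtypeProd (fun _ : Fin n => Ω) (fun i : Fin n => i.val < m) ⁻¹'
        A := by
    intro x hx
    rw [hA]
    intro i
    have hgx : g (E fun i => x i) = g x := hcongr _ _ fun i hi => by rw [hE]; exact dif_pos hi
    refine lt_of_lt_of_le hx (measure_mono fun y hy => ?_)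
    show g (E fun i => x i) y < g (E fun i => x i) (x i)
    rw [hgx]
    exact hy i (not_lt.1 i.2)
  refine (measure_mono hsub).trans ?_
  rw [hmp.measure_preimage hAm.nullMeasurableSet, Measure.prod_apply hAm]
  have hcard : Fintype.card {i : Fin n // ¬ i.val < m} = n - m := by
    rw [Fintype.card_subtype_compl, Fintype.card_fin]
    congr 1
    have := card_firstIndices hmn
    rw [Fintype.card_subtype]
    exact_mod_cast this
  have hle : ∀ u, (Measure.pi fun i : {i : Fin n // ¬ i.val < m} => P) (Prod.mk u ⁻¹' A) ≤
      (1 - ε) ^ (n - m) := by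
    intro u
    have hgu : Measurable (g (E u)) := hgE.comp (measurable_const.prodMk measurable_id)
    have hpi : Prod.mk u ⁻¹' A = univ.pi fun i : {i : Fin n // ¬ i.val < m} =>
        {ω | ε < P {y | g (E u) y < g (E u) ω}} := by
      ext v
      rw [hA, mem_univ_pi]
      rfl
    rw [hpi, Measure.pi_pi, Finset.prod_const, Finset.card_univ, hcard]
    exact pow_le_pow_left₀ zero_le (measure_lt_measure_lt_le P hgu) _
  calc _ ≤ ∫⁻ _u, (1 - ε) ^ (n - m) ∂(Measure.pi fun i : {i : Fin n // i.val < m} => P) :=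
        lintegral_mono hle
    _ = _ := by rw [lintegral_const, measure_univ, mul_one]

end validation

/-! ## The error of the learned halfspace -/

section congruence

theorem fitted_congr {D m : ℕ} {X Y : ℕ → ℕ → ℝ} (h : ∀ i < m, X i = Y i) :
    fitted D m X = fitted D m Y := by
  have h1 : rowGram m X = rowGram m Y := by
    funext a b
    exact Finset.sum_congr rfl fun i hi => by rw [h i (Finset.mem_range.1 hi)]
  funext a
  rw [fitted, fitted, h1]
  refine Finset.sum_congr rfl fun b _ => ?_
  congr 1
  exact Finset.sum_congr rfl fun i hi => by
    rw [leverage, leverage, h i (Finset.mem_range.1 hi)]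

variable {Ω : Type*} [MeasurableSpace Ω]

theorem measurable_sweep {N : Ω → ℕ → ℕ → ℝ} (hN : ∀ a b, Measurable fun ω => N ω a b) (k : ℕ) :
    ∀ a b, Measurable fun ω => sweep (N ω) k a b := by
  induction k with
  | zero => exact hN
  | succ k ih =>
    intro a b
    simp only [sweep, sweepStep]
    exact (ih a b).sub (((ih a k).add_const _).mul (((ih k b).sub_const _).div (ih k k)))

theorem measurable_fitted {X : Ω → ℕ → ℕ → ℝ} (hX : ∀ i a, Measurable fun ω => X ω i a)
    (D m a : ℕ) : Measurable fun ω => fitted D m (X ω) a := by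
  have h1 := measurable_sweep (N := fun ω => rowGram m (X ω)) (fun a b =>
    Finset.measurable_fun_sum _ fun i _ => (hX i a).mul (hX i b)) D
  refine Finset.measurable_fun_sum _ fun b _ => (h1 a b).mul ?_
  refine Finset.measurable_fun_sum _ fun i _ => (hX i b).mul ?_
  exact Finset.measurable_fun_sum _ fun p _ => Finset.measurable_fun_sum _ fun q _ =>
    ((hX i p).mul (h1 p q)).mul (hX i q)

end congruence

/-- The halfspace learned from the samples `x`. -/
noncomputable def learnedSet {n d : ℕ} (x : Fin n → EuclideanSpace ℝ (Fin d)) :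
    Set (EuclideanSpace ℝ (Fin d)) :=
  superlevelSet
    (WithLp.toLp 2 fun j : Fin d => fitted (d + 1) ((n + 1) / 2) (RealRAM.homogeneous x) j)
    (threshold d ((n + 1) / 2) n (RealRAM.homogeneous x))

theorem measurableSet_superlevelSet {d : ℕ} (w : EuclideanSpace ℝ (Fin d)) (τ : ℝ) :
    MeasurableSet (superlevelSet w τ) :=
  measurableSet_le measurable_const (by fun_prop)

/-- The linear functional fitted to the samples `x`. -/
noncomputable def learnedScore {n d : ℕ} (x : Fin n → EuclideanSpace ℝ (Fin d))
    (y : EuclideanSpace ℝ (Fin d)) : ℝ :=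
  ∑ j : Fin d, fitted (d + 1) ((n + 1) / 2) (RealRAM.homogeneous x) j * y j

theorem learnedScore_lt {n d : ℕ} {x : Fin n → EuclideanSpace ℝ (Fin d)}
    {y : EuclideanSpace ℝ (Fin d)} (hy : y ∉ learnedSet x) {i : Fin n} (hi : (n + 1) / 2 ≤ i.val) :
    learnedScore x y < learnedScore x (x i) := by
  have h1 : learnedScore x y < threshold d ((n + 1) / 2) n (RealRAM.homogeneous x) := by
    refine lt_of_le_of_lt (le_of_eq ?_) (not_le.1 hy)
    rw [PiLp.inner_apply]
    refine Finset.sum_congr rfl fun j _ => ?_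
    simp [mul_comm]
  refine h1.trans_le ((minFrom_le _ _ _ hi i.2).trans (le_of_eq ?_))
  rw [score, ← Fin.sum_univ_eq_sum_range
    (fun j => fitted (d + 1) ((n + 1) / 2) (RealRAM.homogeneous x) j * RealRAM.homogeneous x i j)]
  refine Finset.sum_congr rfl fun j _ => ?_
  simp [RealRAM.homogeneous]

theorem measurable_homogeneous {n d : ℕ} (i a : ℕ) :
    Measurable fun x : Fin n → EuclideanSpace ℝ (Fin d) => RealRAM.homogeneous x i a := by
  by_cases h : i < n ∧ a < d
  · simp only [RealRAM.homogeneous, h, and_self, dif_pos]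
    fun_prop
  · simp only [RealRAM.homogeneous, h, dif_neg, not_false_iff]
    exact measurable_const

theorem measure_compl_learnedSet_le {n d : ℕ} (P : Measure (EuclideanSpace ℝ (Fin d)))
    [IsProbabilityMeasure P] (ε : ℝ≥0∞) :
    (Measure.pi fun _ : Fin n => P) {x | ε < P (learnedSet x)ᶜ} ≤ (1 - ε) ^ (n - (n + 1) / 2) := by
  rcases Nat.eq_zero_or_pos n with hn | hn
  · subst hn
    simpa using prob_le_one
  have hg : Measurable fun q : (Fin n → EuclideanSpace ℝ (Fin d)) × EuclideanSpace ℝ (Fin d) =>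
      learnedScore q.1 q.2 := by
    refine Finset.measurable_fun_sum _ fun j _ => Measurable.mul ?_ (by fun_prop)
    exact (measurable_fitted measurable_homogeneous _ _ _).comp measurable_fst
  have hcongr : ∀ x x' : Fin n → EuclideanSpace ℝ (Fin d),
      (∀ i : Fin n, i.val < (n + 1) / 2 → x i = x' i) → learnedScore x = learnedScore x' := by
    intro x x' hx
    have : fitted (d + 1) ((n + 1) / 2) (RealRAM.homogeneous x) =
        fitted (d + 1) ((n + 1) / 2) (RealRAM.homogeneous x') := by
      refine fitted_congr fun i hi => ?_
      funext a
      have hin : i < n := by omega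
      rw [RealRAM.homogeneous, RealRAM.homogeneous]
      split_ifs with h
      · rw [hx ⟨i, hin⟩ hi]
      · rfl
    funext y
    rw [learnedScore, learnedScore, this]
  refine (measure_mono fun x hx => ?_).trans
    (measure_validation_le P (by omega : (n + 1) / 2 ≤ n) 0 hg hcongr ε)
  refine lt_of_lt_of_le hx (measure_mono ?_)
  intro y hy i hi
  exact learnedScore_lt hy hi

theorem measure_inter_le_cond {Ω : Type*} [MeasurableSpace Ω] (P : Measure Ω)
    [IsProbabilityMeasure P] {S : Set Ω} (hS : MeasurableSet S) (A : Set Ω) :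
    P (S ∩ A) ≤ ProbabilityTheory.cond P S A := by
  rw [cond_apply hS]
  exact le_mul_of_one_le_left zero_le (ENNReal.one_le_inv.2 prob_le_one)

section error
open Set

variable {e : ℕ}

theorem prodLaw_slab_le (t : ℝ) {ℓ : ℝ} (hℓ : 0 ≤ ℓ) :
    prodLaw e ((gaussianReal 0 1).map (standardize t))
      {z | z 0 ∈ Icc (standardize t t - ℓ) (standardize t t)} ≤ ENNReal.ofReal ℓ := by
  have hst := measurable_standardize t
  have hρ := truncStd_pos t
  have : IsProbabilityMeasure ((gaussianReal 0 1).map (standardize t)) :=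
    Measure.isProbabilityMeasure_map hst.aemeasurable
  have h1 : (prodLaw e ((gaussianReal 0 1).map (standardize t))).map (fun z => z 0) =
    (gaussianReal 0 1).map (standardize t) := (map_eval_prodLaw 0).trans (if_pos rfl)
  have h3 : prodLaw e ((gaussianReal 0 1).map (standardize t))
      {z | z 0 ∈ Icc (standardize t t - ℓ) (standardize t t)} =
      gaussianReal 0 1 (standardize t ⁻¹' Icc (standardize t t - ℓ) (standardize t t)) := by
    rw [← Measure.map_apply hst measurableSet_Icc]
    conv_rhs => rw [← h1]
    exact (Measure.map_apply (measurable_pi_apply 0) measurableSet_Icc).symm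
  have h4 : standardize t ⁻¹' Icc (standardize t t - ℓ) (standardize t t) ⊆
      Ici (t - truncStd t * ℓ) ∩ Icc (t - truncStd t * ℓ) t := by
    intro g hg
    rw [mem_preimage, mem_Icc, standardize, standardize] at hg
    have h5 : t - truncStd t * ℓ ≤ g := by
      have := hg.1
      rw [sub_le_iff_le_add, div_add' _ _ _ hρ.ne', div_le_div_iff_of_pos_right hρ] at this
      linarith
    have h6 := (div_le_div_iff_of_pos_right hρ).1 hg.2
    exact ⟨h5, h5, by linarith⟩
  rw [h3]
  refine (measure_mono h4).trans ?_
  rw [← ofReal_measureReal]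
  refine ENNReal.ofReal_le_ofReal ((measureReal_Icc_stdGaussian_le
    (fun x _ => stdPDF_le_half x) ?_).trans ?_)
  · nlinarith
  · nlinarith [truncStd_le_one t]

theorem prodLaw_stdGaussian_tail_le (t B : ℝ) {j : Fin (e + 1)} (hj : j ≠ 0) :
    prodLaw e ((gaussianReal 0 1).map (standardize t)) {z | B < |z j|} ≤
      ENNReal.ofReal (4 * Real.exp (-(1 / 2 * B))) := by
  have hst := measurable_standardize t
  have : IsProbabilityMeasure ((gaussianReal 0 1).map (standardize t)) :=
    Measure.isProbabilityMeasure_map hst.aemeasurable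
  have h1 := map_eval_prodLaw (e := e) (ν := (gaussianReal 0 1).map (standardize t)) j
  have h2 : coordLaw (e := e) ((gaussianReal 0 1).map (standardize t)) j = gaussianReal 0 1 :=
    if_neg hj
  have h3 := (isStandardized_stdGaussian le_rfl).measure_lt_abs_le (by norm_num) B
  have hm : MeasurableSet {x : ℝ | B < |x|} := measurableSet_lt measurable_const (by fun_prop)
  rwa [← h2, ← h1, Measure.map_apply (measurable_pi_apply j) hm] at h3

theorem measure_learnedSet_diff_le {n m : ℕ} (hn : 2 ≤ n) (hm : m = (n + 1) / 2)
    {N : Measure (EuclideanSpace ℝ (Fin (e + 1)))} {S : Set (EuclideanSpace ℝ (Fin (e + 1)))}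
    (hSm : MeasurableSet S) {t : ℝ} {c : EuclideanSpace ℝ (Fin (e + 1))}
    {f : (Fin (e + 1) → ℝ) ≃ₗ[ℝ] EuclideanSpace ℝ (Fin (e + 1))}
    (hS : ∀ z, c + f z ∈ S ↔ standardize t t ≤ z 0)
    (hN : N = (prodLaw e ((gaussianReal 0 1).map (standardize t))).map fun z => c + f z)
    {z : Fin n → Fin (e + 1) → ℝ} {B η η' : ℝ} (hB : 1 ≤ B)
    (hz : Accurate e ((truncLaw t).map (standardize t)) m B η z)
    (hzA : ∀ i, standardize t t ≤ z i 0) (hη : 0 ≤ η) (hηd : ((e + 2 : ℕ) : ℝ) * η ≤ 1 / 2)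
    (hη' : 7 * ((e + 2 : ℕ) : ℝ) ^ 3 * B ^ 3 * η ≤ η') (hκ : η' ≤ skewness t / 2) :
    N (learnedSet (fun i => c + f (z i)) \ S) ≤
      ENNReal.ofReal (4 * e * η' * B / skewness t + e * (4 * Real.exp (-(1 / 2 * B)))) := by
  have hp := endDensity_pos t
  have hp1 := endDensity_le_one t
  have hκ0 : 0 < skewness t := lt_of_lt_of_le (by positivity) (skewness_ge t)
  have hη'0 : 0 ≤ η' := le_trans (by positivity) hη'
  have : IsProbabilityMeasure ((truncLaw t).map (standardize t)) :=
    Measure.isProbabilityMeasure_map (measurable_standardize t).aemeasurable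
  have hst := isStandardized_truncLaw t
  have hh : endDensity t / 2 ≤ 1 / 2 := by linarith
  have hΦ : Measurable fun z => c + f z :=
    (LinearMap.continuous_of_finiteDimensional f.toLinearMap).measurable.const_add c
  have hsub : (fun z => c + f z) ⁻¹' (learnedSet (fun i => c + f (z i)) \ S) ⊆
      {y | y 0 ∈ Icc (standardize t t - 4 * e * η' * B / skewness t) (standardize t t)} ∪
      ⋃ j : Fin e, {y | B < |y j.succ|} := by
    rintro y ⟨hy1, hy2⟩
    by_contra hcon
    rw [mem_union, not_or, mem_iUnion, not_exists] at hcon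
    have hyB : ∀ j : Fin (e + 1), j ≠ 0 → |y j| ≤ B := by
      intro j hj
      obtain ⟨i, rfl⟩ := Fin.exists_succ_eq.2 hj
      exact not_lt.1 (hcon.2 i)
    refine hcon.1 ⟨?_, ?_⟩
    · refine le_of_mem_learned hn hm c f (thirdMoment_last hst hh) ?_ ?_ hB hz.1 hzA hη hηd hz.2
        hη' hκ hκ0 hyB ?_
      · rw [sum_thirdMoment hst hh, if_pos rfl]
      · intro j hj
        rw [sum_thirdMoment hst hh, if_neg hj]
      · rw [hm]; exact hy1
    · exact le_of_lt (not_le.1 fun h => hy2 ((hS y).2 h))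
  have hLm : MeasurableSet (learnedSet fun i => c + f (z i)) := measurableSet_superlevelSet _ _
  rw [hN, Measure.map_apply hΦ (hLm.diff hSm),
    ENNReal.ofReal_add (by positivity) (by positivity)]
  refine (measure_mono hsub).trans ((measure_union_le _ _).trans (add_le_add
    (prodLaw_slab_le t (by positivity)) ?_))
  refine (measure_iUnion_fintype_le _ _).trans ((Finset.sum_le_sum fun j _ =>
    prodLaw_stdGaussian_tail_le t B (Fin.succ_ne_zero j)).trans (le_of_eq ?_))
  rw [Finset.sum_const, Finset.card_univ, Fintype.card_fin, nsmul_eq_mul,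
    ENNReal.ofReal_mul (p := (e : ℝ)) (by positivity), ENNReal.ofReal_natCast]

/-- The failure probability of the learned halfspace on points outside of `S`. -/
theorem measure_learnedSet_diff_gt_le {n m : ℕ} (hn : 2 ≤ n) (hm : m = (n + 1) / 2)
    {N P : Measure (EuclideanSpace ℝ (Fin (e + 1)))} {S : Set (EuclideanSpace ℝ (Fin (e + 1)))}
    (hSm : MeasurableSet S) {t : ℝ} {c : EuclideanSpace ℝ (Fin (e + 1))}
    {f : (Fin (e + 1) → ℝ) ≃ₗ[ℝ] EuclideanSpace ℝ (Fin (e + 1))}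
    (hS : ∀ z, c + f z ∈ S ↔ standardize t t ≤ z 0)
    (hN : N = (prodLaw e ((gaussianReal 0 1).map (standardize t))).map fun z => c + f z)
    (hP : P = (prodLaw e ((truncLaw t).map (standardize t))).map fun z => c + f z)
    {B η η' h : ℝ} (hB : 1 ≤ B) (hη : 0 ≤ η) (hηd : ((e + 2 : ℕ) : ℝ) * η ≤ 1 / 2)
    (hη' : 7 * ((e + 2 : ℕ) : ℝ) ^ 3 * B ^ 3 * η ≤ η') (hκ : η' ≤ skewness t / 2)
    (hh : h = endDensity t / 2)
    (hbias : 3 * (192 / h ^ 3 * Real.exp (-(h * B / 2))) ≤ η / 2) :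
    (Measure.pi fun _ : Fin n => P) {x | ENNReal.ofReal (4 * e * η' * B / skewness t +
      e * (4 * Real.exp (-(1 / 2 * B)))) < N (learnedSet x \ S)} ≤
      ENNReal.ofReal (n * (e + 1 : ℕ) * (4 * Real.exp (-(h * B))) +
        (e + 2 : ℕ) ^ 3 * (2 * Real.exp (-(m * (η / 2) ^ 2 / (2 * (B ^ 3) ^ 2))))) := by
  have hp := endDensity_pos t
  have hp1 := endDensity_le_one t
  have hstm := measurable_standardize t
  have hprob : IsProbabilityMeasure ((truncLaw t).map (standardize t)) :=
    Measure.isProbabilityMeasure_map hstm.aemeasurable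
  obtain ⟨Q, hQ⟩ : ∃ Q, Q = prodLaw e ((truncLaw t).map (standardize t)) := ⟨_, rfl⟩
  have hQp : IsProbabilityMeasure Q := by rw [hQ]; infer_instance
  obtain ⟨Φ, hΦ⟩ : ∃ Φ : (Fin (e + 1) → ℝ) ≃ᵐ EuclideanSpace ℝ (Fin (e + 1)),
      ∀ z, Φ z = c + f z :=
    ⟨(f.toContinuousLinearEquiv.toHomeomorph.trans (Homeomorph.addLeft c)).toMeasurableEquiv,
      fun z => rfl⟩
  have hPΦ : P = Q.map Φ := by rw [hP, hQ, funext hΦ]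
  have hpi : (Measure.pi fun _ : Fin n => P) = (Measure.pi fun _ : Fin n => Q).map
      (MeasurableEquiv.piCongrRight fun _ : Fin n => Φ) := by
    have := Measure.isProbabilityMeasure_map (μ := Q) Φ.measurable.aemeasurable
    rw [hPΦ]
    exact (Measure.pi_map_pi (μ := fun _ : Fin n => Q) (f := fun _ => Φ)
      fun _ => Φ.measurable.aemeasurable).symm
  have hA : ∀ᵐ z ∂(Measure.pi fun _ : Fin n => Q), ∀ i, standardize t t ≤ z i 0 := by
    refine ae_all_iff.2 fun i => ?_
    have h1 : ∀ᵐ y ∂Q, standardize t t ≤ y 0 := by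
      have h2 : ∀ᵐ x ∂((truncLaw t).map (standardize t)), standardize t t ≤ x := by
        rw [ae_map_iff hstm.aemeasurable measurableSet_Ici]
        filter_upwards [ae_truncLaw t] with x hx
        exact div_le_div_of_nonneg_right (by linarith) (truncStd_pos t).le
      have h3 : (prodLaw e ((truncLaw t).map (standardize t))).map (fun z => z 0) =
        (truncLaw t).map (standardize t) := (map_eval_prodLaw 0).trans (if_pos rfl)
      rw [← h3] at h2
      rw [hQ]
      exact (ae_map_iff (f := fun z : Fin (e + 1) → ℝ => z 0)
        (measurable_pi_apply 0).aemeasurable measurableSet_Ici).1 h2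
    exact (measurePreserving_eval (fun _ : Fin n => Q) i).quasiMeasurePreserving.ae h1
  rw [hpi, MeasurableEquiv.map_apply]
  have hst : IsStandardized ((truncLaw t).map (standardize t)) h (skewness t) :=
    hh ▸ isStandardized_truncLaw t
  have hacc := measure_not_accurate_le (e := e) (n := n) (m := m) hst (by linarith) (by linarith)
    (by omega) (by omega) hB hη hbias
  rw [← hQ] at hacc
  refine le_trans (measure_mono_ae ?_) hacc
  filter_upwards [hA] with z hzA hz hacc
  change _ < N (learnedSet ((MeasurableEquiv.piCongrRight fun _ : Fin n => Φ) z) \ S) at hz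
  refine not_le.2 hz ?_
  have h4 : (MeasurableEquiv.piCongrRight fun _ : Fin n => Φ) z = fun i => c + f (z i) :=
    funext fun i => hΦ (z i)
  rw [h4]
  exact measure_learnedSet_diff_le hn hm hSm hS hN hB hacc hzA hη hηd hη' hκ

end error

/-! ## The number of samples -/

section sampleSize
open Real

theorem exp_neg_half_mul_le {h L r : ℝ} (hr : 0 < r) (hh : r⁻¹ ≤ h) (hL : 0 < L) (k : ℕ) :
    exp (-(h * L / 2)) ≤ k.factorial * (2 * r / L) ^ k := by
  have h1 : L / (2 * r) ≤ h * L / 2 := by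
    have := mul_le_mul_of_nonneg_right hh hL.le
    calc L / (2 * r) = r⁻¹ * L / 2 := by field_simp
      _ ≤ _ := by linarith
  have h2 := Real.pow_div_factorial_le_exp (L / (2 * r)) (by positivity) k
  have h3 : exp (-(h * L / 2)) ≤ (exp (L / (2 * r)))⁻¹ := by
    rw [← Real.exp_neg]
    exact Real.exp_le_exp.2 (neg_le_neg h1)
  refine h3.trans ((inv_anti₀ (by positivity) h2).trans (le_of_eq ?_))
  rw [inv_div, div_eq_mul_inv, ← inv_pow, inv_div]

variable {r L Λ : ℝ}

theorem const_mul_pow_le (hr : 2 ^ 15 ≤ r) (hL : r ^ 30 ≤ L) {c : ℝ} {j k : ℕ}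
    (hc : c ≤ (2 ^ 15) ^ j) (hk : j + k ≤ 30) : c * r ^ k ≤ L := by
  have hr0 : 0 ≤ r := le_trans (by positivity) hr
  have hr1 : 1 ≤ r := le_trans (by norm_num) hr
  calc c * r ^ k ≤ r ^ j * r ^ k := by
        refine mul_le_mul_of_nonneg_right (hc.trans ?_) (by positivity)
        exact pow_le_pow_left₀ (by positivity) hr j
    _ = r ^ (j + k) := (pow_add _ _ _).symm
    _ ≤ r ^ 30 := pow_le_pow_right₀ hr1 hk
    _ ≤ L := hL

theorem bias_le (hr : 2 ^ 15 ≤ r) (hL : r ^ 30 ≤ L) {h : ℝ} (hh : r⁻¹ ≤ h) :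
    3 * (192 / h ^ 3 * exp (-(h * L / 2))) ≤ (L ^ 5)⁻¹ / 2 := by
  have hr0 : 0 < r := lt_of_lt_of_le (by positivity) hr
  have hL1 : 1 ≤ L := (one_le_pow₀ (le_trans (by norm_num) hr)).trans hL
  have hL0 : 0 < L := by linarith
  have hh0 : 0 < h := lt_of_lt_of_le (by positivity) hh
  have h1 : 192 / h ^ 3 ≤ 192 * r ^ 3 := by
    rw [div_le_iff₀ (by positivity), mul_assoc, ← mul_pow]
    have : 1 ≤ r * h := by
      calc 1 = r * r⁻¹ := (mul_inv_cancel₀ hr0.ne').symm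
        _ ≤ r * h := mul_le_mul_of_nonneg_left hh hr0.le
    have := one_le_pow₀ this (n := 3)
    linarith
  have h2 := exp_neg_half_mul_le hr0 hh hL0 8
  have h3 : (2 * 3 * 192 * 40320 * 256 : ℝ) * r ^ 11 ≤ L :=
    const_mul_pow_le hr hL (j := 3) (by norm_num) (by norm_num)
  have h4 : L ≤ L ^ 3 := le_self_pow₀ hL1 (by norm_num)
  calc 3 * (192 / h ^ 3 * exp (-(h * L / 2)))
      ≤ 3 * (192 * r ^ 3 * (Nat.factorial 8 * (2 * r / L) ^ 8)) := by gcongr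
    _ = (2 * 3 * 192 * 40320 * 256 * r ^ 11) * (L ^ 5)⁻¹ / 2 / L ^ 3 := by
        norm_num [Nat.factorial]
        field_simp
        ring
    _ ≤ L ^ 3 * (L ^ 5)⁻¹ / 2 / L ^ 3 := by
        gcongr
        exact h3.trans h4
    _ = _ := by field_simp

theorem dimension_mul_le (hr : 2 ^ 15 ≤ r) (hL : r ^ 30 ≤ L) {D : ℝ} (hD : D ≤ 2 * r) :
    D * (L ^ 5)⁻¹ ≤ 1 / 2 := by
  have hr0 : 0 < r := lt_of_lt_of_le (by positivity) hr
  have hL1 : 1 ≤ L := (one_le_pow₀ (le_trans (by norm_num) hr)).trans hL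
  have h1 : 4 * r ^ 1 ≤ L := const_mul_pow_le hr hL (j := 1) (by norm_num) (by norm_num)
  have h2 : L ≤ L ^ 5 := le_self_pow₀ hL1 (by norm_num)
  rw [← div_eq_mul_inv, div_le_iff₀ (by positivity)]
  linarith

theorem fit_error_le (hr : 2 ^ 15 ≤ r) (hL : r ^ 30 ≤ L) {D : ℝ} (hD0 : 0 ≤ D) (hD : D ≤ 2 * r) :
    7 * D ^ 3 * L ^ 3 * (L ^ 5)⁻¹ ≤ 56 * r ^ 3 / L ^ 2 := by
  have hr0 : 0 < r := lt_of_lt_of_le (by positivity) hr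
  have hL0 : 0 < L := lt_of_lt_of_le (by positivity) hL
  calc 7 * D ^ 3 * L ^ 3 * (L ^ 5)⁻¹ ≤ 7 * (2 * r) ^ 3 * L ^ 3 * (L ^ 5)⁻¹ := by gcongr
    _ = _ := by field_simp; norm_num

theorem fit_error_le_skewness (hr : 2 ^ 15 ≤ r) (hL : r ^ 30 ≤ L) {κ : ℝ} (hκ : r⁻¹ ≤ κ) :
    56 * r ^ 3 / L ^ 2 ≤ κ / 2 := by
  have hr0 : 0 < r := lt_of_lt_of_le (by positivity) hr
  have hL1 : 1 ≤ L := (one_le_pow₀ (le_trans (by norm_num) hr)).trans hL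
  have h1 : 112 * r ^ 4 ≤ L := const_mul_pow_le hr hL (j := 1) (by norm_num) (by norm_num)
  have h2 : L ≤ L ^ 2 := le_self_pow₀ hL1 (by norm_num)
  calc 56 * r ^ 3 / L ^ 2 = 112 * r ^ 4 / L ^ 2 * r⁻¹ / 2 := by field_simp; norm_num
    _ ≤ 1 * r⁻¹ / 2 := by
        gcongr
        rw [div_le_one (by positivity)]
        exact h1.trans h2
    _ ≤ _ := by linarith

theorem error_le (hr : 2 ^ 15 ≤ r) (hL : r ^ 30 ≤ L) {κ ε d : ℝ} (hκ : r⁻¹ ≤ κ) (hε : 2 * r⁻¹ ≤ ε)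
    (hd0 : 0 ≤ d) (hd : d ≤ r) :
    4 * d * (56 * r ^ 3 / L ^ 2) * L / κ + d * (4 * exp (-(1 / 2 * L))) ≤ ε / 2 := by
  have hr0 : 0 < r := lt_of_lt_of_le (by positivity) hr
  have hr1 : r⁻¹ ≤ 1 := inv_le_one_of_one_le₀ (le_trans (by norm_num) hr)
  have hL0 : 0 < L := lt_of_lt_of_le (by positivity) hL
  have hκ0 : 0 < κ := lt_of_lt_of_le (by positivity) hκ
  have h1 : 448 * r ^ 6 ≤ L := const_mul_pow_le hr hL (j := 1) (by norm_num) (by norm_num)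
  have h2 : 16 * r ^ 3 ≤ L := const_mul_pow_le hr hL (j := 1) (by norm_num) (by norm_num)
  have h3 := exp_neg_half_mul_le hr0 hr1 hL0 1
  have h4 : exp (-(1 / 2 * L)) ≤ 2 * r / L := by
    refine le_trans (le_of_eq ?_) (h3.trans (le_of_eq ?_))
    · congr 1; ring
    · simp
  have h5 : κ⁻¹ ≤ r := inv_le_of_inv_le₀ hr0 hκ
  have h6 : 4 * d * (56 * r ^ 3 / L ^ 2) * L / κ ≤ r⁻¹ / 2 := by
    rw [div_eq_mul_inv _ κ]
    calc 4 * d * (56 * r ^ 3 / L ^ 2) * L * κ⁻¹ ≤ 4 * r * (56 * r ^ 3 / L ^ 2) * L * r := by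
          gcongr
      _ = (448 * r ^ 6) / L * r⁻¹ / 2 := by field_simp; norm_num
      _ ≤ 1 * r⁻¹ / 2 := by
          gcongr
          rwa [div_le_one hL0]
      _ = _ := by ring
  have h7 : d * (4 * exp (-(1 / 2 * L))) ≤ r⁻¹ / 2 := by
    calc d * (4 * exp (-(1 / 2 * L))) ≤ r * (4 * (2 * r / L)) := by gcongr
      _ = (16 * r ^ 3) / L * r⁻¹ / 2 := by field_simp; norm_num
      _ ≤ 1 * r⁻¹ / 2 := by
          gcongr
          rwa [div_le_one hL0]
      _ = _ := by ring
  linarith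

theorem exp_neg_le_of_log (hr : 2 ^ 15 ≤ r) (hΛ : r ^ 2 * Λ ≤ L) (hΛ0 : 0 ≤ Λ) {h : ℝ}
    (hh : r⁻¹ ≤ h) : exp (-(h * L / 2)) ≤ exp (-Λ) := by
  have hr0 : 0 < r := lt_of_lt_of_le (by positivity) hr
  have h1 : r⁻¹ * (r ^ 2 * Λ) ≤ h * L := mul_le_mul hh hΛ (by positivity) (le_trans (by positivity) hh)
  have h2 : r⁻¹ * (r ^ 2 * Λ) = r * Λ := by field_simp
  refine Real.exp_le_exp.2 (neg_le_neg ?_)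
  nlinarith

theorem tail_le (hr : 2 ^ 15 ≤ r) (hL : r ^ 30 ≤ L) (hΛ : r ^ 2 * Λ ≤ L) (hΛ0 : 0 ≤ Λ) {h d : ℝ}
    (hh : r⁻¹ ≤ h) (hd0 : 0 ≤ d) (hd : d ≤ r) :
    L ^ 17 * d * (4 * exp (-(h * L))) ≤ exp (-Λ) / 4 := by
  have hr0 : 0 < r := lt_of_lt_of_le (by positivity) hr
  have hL0 : 0 < L := lt_of_lt_of_le (by positivity) hL
  have h1 := exp_neg_half_mul_le hr0 hh hL0 18
  have h2 := exp_neg_le_of_log hr hΛ hΛ0 hh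
  have h3 : (16 * (Nat.factorial 18) * 2 ^ 18 : ℝ) * r ^ 19 ≤ L :=
    const_mul_pow_le hr hL (j := 6) (by norm_num [Nat.factorial]) (by norm_num)
  have h4 : exp (-(h * L)) = exp (-(h * L / 2)) * exp (-(h * L / 2)) := by
    rw [← Real.exp_add]; congr 1; ring
  rw [h4]
  calc L ^ 17 * d * (4 * (exp (-(h * L / 2)) * exp (-(h * L / 2))))
      ≤ L ^ 17 * r * (4 * (Nat.factorial 18 * (2 * r / L) ^ 18 * exp (-Λ))) := by gcongr
    _ = (16 * (Nat.factorial 18) * 2 ^ 18 * r ^ 19) / L * exp (-Λ) / 4 := by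
        field_simp
        ring
    _ ≤ 1 * exp (-Λ) / 4 := by
        gcongr
        rwa [div_le_one hL0]
    _ = _ := by ring

theorem deviation_le (hr : 2 ^ 15 ≤ r) (hL : r ^ 30 ≤ L) (hΛ : r ^ 2 * Λ ≤ L) (hΛ0 : 0 ≤ Λ)
    {m D : ℝ} (hm : L ^ 17 / 2 ≤ m) (hD0 : 0 ≤ D) (hD : D ≤ 2 * r) :
    D ^ 3 * (2 * exp (-(m * ((L ^ 5)⁻¹ / 2) ^ 2 / (2 * (L ^ 3) ^ 2)))) ≤ exp (-Λ) / 4 := by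
  have hr0 : 0 < r := lt_of_lt_of_le (by positivity) hr
  have hL0 : 0 < L := lt_of_lt_of_le (by positivity) hL
  have hr1 : r⁻¹ ≤ 1 / 16 := by
    rw [one_div]
    exact inv_anti₀ (by norm_num) (le_trans (by norm_num) hr)
  have h1 := exp_neg_half_mul_le hr0 hr1 hL0 1
  have h2 := exp_neg_le_of_log hr hΛ hΛ0 hr1
  have h3 : 128 * r ^ 4 ≤ L := const_mul_pow_le hr hL (j := 1) (by norm_num) (by norm_num)
  have h4 : exp (-(m * ((L ^ 5)⁻¹ / 2) ^ 2 / (2 * (L ^ 3) ^ 2))) ≤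
      exp (-(1 / 16 * L / 2)) * exp (-(1 / 16 * L / 2)) := by
    rw [← Real.exp_add]
    refine Real.exp_le_exp.2 ?_
    have : L ^ 17 / 2 * ((L ^ 5)⁻¹ / 2) ^ 2 / (2 * (L ^ 3) ^ 2) ≤
        m * ((L ^ 5)⁻¹ / 2) ^ 2 / (2 * (L ^ 3) ^ 2) := by gcongr
    have h5 : L ^ 17 / 2 * ((L ^ 5)⁻¹ / 2) ^ 2 / (2 * (L ^ 3) ^ 2) = L / 16 := by
      field_simp
      norm_num
    linarith
  rw [Nat.factorial_one, Nat.cast_one, one_mul, pow_one] at h1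
  calc D ^ 3 * (2 * exp (-(m * ((L ^ 5)⁻¹ / 2) ^ 2 / (2 * (L ^ 3) ^ 2))))
      ≤ (2 * r) ^ 3 * (2 * (exp (-(1 / 16 * L / 2)) * exp (-(1 / 16 * L / 2)))) := by gcongr
    _ ≤ (2 * r) ^ 3 * (2 * (2 * r / L * exp (-Λ))) := by gcongr
    _ = (128 * r ^ 4) / L * exp (-Λ) / 4 := by field_simp; norm_num
    _ ≤ 1 * exp (-Λ) / 4 := by
        gcongr
        rwa [div_le_one hL0]
    _ = _ := by ring

theorem validation_le (hr : 2 ^ 15 ≤ r) (hL : r ^ 30 ≤ L) (hΛ : r ^ 2 * Λ ≤ L) (hΛ0 : 0 ≤ Λ)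
    {ε : ℝ} (hε : 2 * r⁻¹ ≤ ε) (hε1 : ε ≤ 1) {k : ℕ} (hk : L ^ 17 / 4 ≤ k) :
    (1 - ε / 2) ^ k ≤ exp (-Λ) / 2 := by
  have hr0 : 0 < r := lt_of_lt_of_le (by positivity) hr
  have hL0 : 0 < L := lt_of_lt_of_le (by positivity) hL
  have hh : r⁻¹ ≤ ε / 2 := by linarith
  have hε0 : 0 < ε := lt_of_lt_of_le (by positivity) hε
  have h1 := exp_neg_half_mul_le hr0 hh hL0 1
  have h2 := exp_neg_le_of_log hr hΛ hΛ0 hh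
  have h3 : 4 * r ^ 1 ≤ L := const_mul_pow_le hr hL (j := 1) (by norm_num) (by norm_num)
  have h8 : 4 * r ^ 0 ≤ L := const_mul_pow_le hr hL (j := 1) (by norm_num) (by norm_num)
  have hkL : L ≤ k := by
    have h9 : L ^ 2 ≤ L ^ 17 := pow_le_pow_right₀ (by linarith) (by norm_num)
    nlinarith
  have h5 : (1 - ε / 2) ^ k ≤ exp (-(ε / 2 * L / 2)) * exp (-(ε / 2 * L / 2)) := by
    rw [← Real.exp_add]
    calc (1 - ε / 2) ^ k ≤ exp (-(ε / 2)) ^ k := by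
          refine pow_le_pow_left₀ (by linarith) ?_ k
          have := Real.add_one_le_exp (-(ε / 2))
          linarith
      _ = exp (k * -(ε / 2)) := (Real.exp_nat_mul _ _).symm
      _ ≤ _ := by
          refine Real.exp_le_exp.2 ?_
          nlinarith
  rw [Nat.factorial_one, Nat.cast_one, one_mul, pow_one] at h1
  calc (1 - ε / 2) ^ k ≤ exp (-(ε / 2 * L / 2)) * exp (-(ε / 2 * L / 2)) := h5
    _ ≤ 2 * r / L * exp (-Λ) := by gcongr
    _ = (4 * r ^ 1) / L * exp (-Λ) / 2 := by ring
    _ ≤ 1 * exp (-Λ) / 2 := by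
        gcongr
        rwa [div_le_one hL0]
    _ = _ := by ring

end sampleSize

/-! ## Correctness of the learner -/

theorem measure_compl_le_endDensity {e : ℕ} {N : Measure (EuclideanSpace ℝ (Fin (e + 1)))}
    {S : Set (EuclideanSpace ℝ (Fin (e + 1)))} (hSm : MeasurableSet S) {t : ℝ}
    {c : EuclideanSpace ℝ (Fin (e + 1))}
    {f : (Fin (e + 1) → ℝ) ≃ₗ[ℝ] EuclideanSpace ℝ (Fin (e + 1))}
    (hS : ∀ z, c + f z ∈ S ↔ standardize t t ≤ z 0)
    (hN : N = (prodLaw e ((gaussianReal 0 1).map (standardize t))).map fun z => c + f z) :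
    N Sᶜ ≤ ENNReal.ofReal (16 * endDensity t) := by
  have hst := measurable_standardize t
  have : IsProbabilityMeasure ((gaussianReal 0 1).map (standardize t)) :=
    Measure.isProbabilityMeasure_map hst.aemeasurable
  have hΦ : Measurable fun z => c + f z :=
    (LinearMap.continuous_of_finiteDimensional f.toLinearMap).measurable.const_add c
  have h1 : (prodLaw e ((gaussianReal 0 1).map (standardize t))).map (fun z => z 0) =
    (gaussianReal 0 1).map (standardize t) := (map_eval_prodLaw 0).trans (if_pos rfl)
  have h2 : (fun z => c + f z) ⁻¹' Sᶜ =
      (fun z : Fin (e + 1) → ℝ => z 0) ⁻¹' Set.Iio (standardize t t) := by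
    ext z
    rw [Set.mem_preimage, Set.mem_compl_iff, hS, Set.mem_preimage, Set.mem_Iio, not_le]
  rw [hN, Measure.map_apply hΦ hSm.compl, h2,
    ← Measure.map_apply (measurable_pi_apply 0) measurableSet_Iio, h1,
    Measure.map_apply hst measurableSet_Iio]
  have h3 : standardize t ⁻¹' Set.Iio (standardize t t) ⊆ Set.Iio t := by
    intro g hg
    have := (div_lt_div_iff_of_pos_right (truncStd_pos t)).1 hg
    exact (sub_lt_sub_iff_right _).1 this
  refine (measure_mono h3).trans ?_
  rw [← ofReal_measureReal]
  exact ENNReal.ofReal_le_ofReal (stdGaussian_Iio_le t)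

theorem measure_learnedSet_symmDiff_gt_le {e n : ℕ} (hn : 2 ≤ n)
    (μ : EuclideanSpace ℝ (Fin (e + 1))) {Sig : Matrix (Fin (e + 1)) (Fin (e + 1)) ℝ}
    (hSig : Sig.PosDef) {S : Set (EuclideanSpace ℝ (Fin (e + 1)))} (hS : IsHalfspace S)
    {ε δ r L Λ : ℝ} (hr : 2 ^ 15 ≤ r) (hL : r ^ 30 ≤ L) (hΛ : r ^ 2 * Λ ≤ L) (hΛ0 : 0 ≤ Λ)
    (hδ : Real.exp (-Λ) = δ) (hLn : L ^ 17 = n) (hε1 : ε ≤ 1) (hrε : 2 ^ 14 * r⁻¹ ≤ ε)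
    (hd : ((e + 1 : ℕ) : ℝ) ≤ r) :
    Measure.pi (fun _ : Fin n => truncatedGaussian μ Sig S)
      {x | ENNReal.ofReal ε < multivariateGaussian μ Sig (learnedSet x ∆ S)} ≤
      ENNReal.ofReal δ := by
  obtain ⟨t, c, f, hSt, hN, hP⟩ := exists_standardized_coordinates μ hSig hS
  have hSm : MeasurableSet S := by
    obtain ⟨w, τ, -, rfl⟩ := hS
    exact measurableSet_superlevelSet w τ
  obtain ⟨N, hN'⟩ : ∃ N, N = multivariateGaussian μ Sig := ⟨_, rfl⟩
  obtain ⟨P, hP'⟩ : ∃ P, P = truncatedGaussian μ Sig S := ⟨_, rfl⟩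
  have hNp : IsProbabilityMeasure N := by rw [hN']; infer_instance
  have hPc : P = ProbabilityTheory.cond N S := by rw [hP', hN']; rfl
  have hPp : IsProbabilityMeasure P := by
    have : IsProbabilityMeasure ((truncLaw t).map (standardize t)) :=
      Measure.isProbabilityMeasure_map (measurable_standardize t).aemeasurable
    rw [hP', hP]
    exact Measure.isProbabilityMeasure_map
      ((LinearMap.continuous_of_finiteDimensional f.toLinearMap).measurable.const_add c).aemeasurable
  rw [← hN'] at hN ⊢
  rw [← hP'] at hP ⊢
  have hr0 : 0 < r := lt_of_lt_of_le (by positivity) hr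
  have hri : 0 < r⁻¹ := inv_pos.2 hr0
  have hε0 : 0 < ε := lt_of_lt_of_le (by positivity) hrε
  have hε2 : 2 * r⁻¹ ≤ ε := by linarith
  have hL1 : 1 ≤ L := (one_le_pow₀ (le_trans (by norm_num) hr)).trans hL
  have hL0 : 0 < L := by linarith
  have hd' : (e : ℝ) ≤ r := by push_cast at hd; linarith
  have hD : ((e + 2 : ℕ) : ℝ) ≤ 2 * r := by
    push_cast at hd ⊢
    linarith
  have hval : (Measure.pi fun _ : Fin n => P)
      {x | ENNReal.ofReal (ε / 2) < P (learnedSet x)ᶜ} ≤ ENNReal.ofReal (δ / 2) := by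
    refine (measure_compl_learnedSet_le P _).trans ?_
    rw [← ENNReal.ofReal_one, ← ENNReal.ofReal_sub _ (by positivity),
      ← ENNReal.ofReal_pow (by linarith), ← hδ]
    refine ENNReal.ofReal_le_ofReal (validation_le hr hL hΛ hΛ0 hε2 hε1 ?_)
    have h1 : n ≤ 4 * (n - (n + 1) / 2) := by omega
    have h2 : (n : ℝ) ≤ 4 * ((n - (n + 1) / 2 : ℕ) : ℝ) := by exact_mod_cast h1
    rw [hLn]
    linarith
  have hout : (Measure.pi fun _ : Fin n => P)
      {x | ENNReal.ofReal (ε / 2) < N (learnedSet x \ S)} ≤ ENNReal.ofReal (δ / 2) := by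
    rcases le_or_gt (N Sᶜ) (ENNReal.ofReal (ε / 2)) with hcase | hcase
    · refine le_trans (le_of_eq ?_) zero_le
      rw [measure_eq_zero_iff_ae_notMem]
      exact .of_forall fun x hx => not_lt.2 ((measure_mono fun y hy => hy.2).trans hcase) hx
    · have hp : ε / 32 ≤ endDensity t := by
        have := hcase.trans_le (measure_compl_le_endDensity hSm hSt hN)
        have := (ENNReal.ofReal_lt_ofReal_iff_of_nonneg (by positivity)).1 this
        linarith
      have hh : r⁻¹ ≤ endDensity t / 2 := by linarith
      have hκ : r⁻¹ ≤ skewness t := by linarith [skewness_ge t]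
      have hbound := measure_learnedSet_diff_gt_le (n := n) hn rfl hSm hSt hN hP hL1
        (inv_nonneg.2 (pow_nonneg hL0.le 5)) (dimension_mul_le hr hL hD)
        (fit_error_le hr hL (Nat.cast_nonneg _) hD) (fit_error_le_skewness hr hL hκ) rfl
        (bias_le hr hL hh)
      refine (measure_mono fun x hx => ?_).trans (hbound.trans (ENNReal.ofReal_le_ofReal ?_))
      · exact lt_of_le_of_lt (ENNReal.ofReal_le_ofReal
          (error_le hr hL hκ hε2 (Nat.cast_nonneg e) hd')) hx
      · have hm : L ^ 17 / 2 ≤ (((n + 1) / 2 : ℕ) : ℝ) := by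
          have h1 : n ≤ 2 * ((n + 1) / 2) := by omega
          have h2 : (n : ℝ) ≤ 2 * (((n + 1) / 2 : ℕ) : ℝ) := by exact_mod_cast h1
          rw [hLn]
          linarith
        have h1 := tail_le hr hL hΛ hΛ0 hh (Nat.cast_nonneg (e + 1)) hd
        have h2 := deviation_le hr hL hΛ hΛ0 hm (Nat.cast_nonneg (e + 2)) hD
        rw [hLn] at h1
        linarith
  have hδ0 : 0 < δ := hδ ▸ Real.exp_pos _
  have hsub : {x : Fin n → EuclideanSpace ℝ (Fin (e + 1)) |
      ENNReal.ofReal ε < N (learnedSet x ∆ S)} ⊆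
      {x | ENNReal.ofReal (ε / 2) < P (learnedSet x)ᶜ} ∪
      {x | ENNReal.ofReal (ε / 2) < N (learnedSet x \ S)} := by
    intro x hx
    by_contra hcon
    rw [Set.mem_union, not_or] at hcon
    have h1 : P (learnedSet x)ᶜ ≤ ENNReal.ofReal (ε / 2) := not_lt.1 hcon.1
    have h2 : N (learnedSet x \ S) ≤ ENNReal.ofReal (ε / 2) := not_lt.1 hcon.2
    have h3 : N (S \ learnedSet x) ≤ ENNReal.ofReal (ε / 2) := by
      refine le_trans ?_ h1
      rw [hPc]
      exact measure_inter_le_cond N hSm _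
    rw [Set.mem_ofPred_eq] at hx
    refine not_le.2 hx ?_
    rw [← add_halves ε, ENNReal.ofReal_add (by positivity) (by positivity)]
    exact (measure_union_le _ _).trans (add_le_add h2 h3)
  refine (measure_mono hsub).trans ((measure_union_le _ _).trans ?_)
  rw [← add_halves δ, ENNReal.ofReal_add (by positivity) (by positivity)]
  exact add_le_add hval hout

theorem mainTheorem8 :
    ∃ (P : RealRAM.Program) (C a b K k : ℕ),
      ∀ (d n : ℕ) (α ε δ : ℝ), 1 ≤ d → 0 < α → 0 < ε → ε < 1 / 2 → 0 < δ → δ < 1 / 2 →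
        (C : ℝ) * ((d : ℝ) / ε) ^ a * Real.log (1 / δ) ^ b ≤ (n : ℝ) →
        (∀ x : Fin n → EuclideanSpace ℝ (Fin d), ∃ (t : ℕ) (s : RealRAM.Store),
          RealRAM.Runs P (RealRAM.input α ε δ x) t s ∧ t ≤ K * n ^ k) ∧
        ∀ (μ : EuclideanSpace ℝ (Fin d)) (Sig : Matrix (Fin d) (Fin d) ℝ)
          (Sstar : Set (EuclideanSpace ℝ (Fin d))),
          Sig.PosDef → IsHalfspace Sstar →
          ENNReal.ofReal α ≤ multivariateGaussian μ Sig Sstar →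
          Measure.pi (fun _ : Fin n => truncatedGaussian μ Sig Sstar)
            {x | ¬ ∃ (t : ℕ) (s : RealRAM.Store),
              RealRAM.Runs P (RealRAM.input α ε δ x) t s ∧
                multivariateGaussian μ Sig (RealRAM.outputSet d s ∆ Sstar) ≤ ENNReal.ofReal ε}
            ≤ ENNReal.ofReal δ := by
  obtain ⟨Q, hQ⟩ : ∃ Q : ℕ, (Q : ℝ) = 2 * (2 ^ 14) ^ 30 :=
    ⟨2 * (2 ^ 14) ^ 30, by push_cast; ring⟩
  refine ⟨RealRAM.learner, Q ^ 17, 510, 17, RealRAM.learner.size, 3,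
    fun d n α ε δ hd hα hε hε1 hδ hδ1 hn => ?_⟩
  obtain ⟨Λ, hΛ⟩ : ∃ Λ, Λ = Real.log (1 / δ) := ⟨_, rfl⟩
  have hΛ1 : 1 / 2 ≤ Λ := by
    have h1 : Real.log 2 ≤ Λ := by
      rw [hΛ]
      refine Real.log_le_log (by norm_num) ?_
      rw [le_div_iff₀ hδ]
      linarith
    linarith [Real.log_two_gt_d9]
  have hδΛ : Real.exp (-Λ) = δ := by
    rw [hΛ, one_div, Real.log_inv, neg_neg, Real.exp_log hδ]
  have hd1 : (1 : ℝ) ≤ d := by exact_mod_cast hd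
  obtain ⟨r, hr⟩ : ∃ r : ℝ, r = 2 ^ 14 * (d / ε) := ⟨_, rfl⟩
  have hdε : 2 * (d : ℝ) ≤ d / ε := by
    rw [le_div_iff₀ hε]
    nlinarith
  have hr15 : 2 ^ 15 ≤ r := by rw [hr]; linarith
  have hr0 : 0 < r := lt_of_lt_of_le (by positivity) hr15
  have hdr : (d : ℝ) ≤ r := by rw [hr]; linarith
  have hrε : 2 ^ 14 * r⁻¹ ≤ ε := by
    have : 2 ^ 14 * r⁻¹ = ε / d := by rw [hr]; field_simp
    rw [this]
    exact div_le_self hε.le hd1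
  obtain ⟨L, hL⟩ : ∃ L : ℝ, L = (n : ℝ) ^ ((17 : ℕ) : ℝ)⁻¹ := ⟨_, rfl⟩
  have hLn : L ^ 17 = n := by
    rw [hL]
    exact Real.rpow_inv_natCast_pow (Nat.cast_nonneg n) (by norm_num)
  have hLnn : 0 ≤ L := by rw [hL]; positivity
  have hL0 : 2 * r ^ 30 * Λ ≤ L := by
    refine le_of_pow_le_pow_left₀ (n := 17) (by norm_num) hLnn ?_
    rw [hLn]
    refine le_trans (le_of_eq ?_) hn
    rw [hr, ← hΛ, Nat.cast_pow, hQ]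
    ring
  have hr30 : r ^ 30 ≤ L := by
    have : 0 < r ^ 30 := by positivity
    nlinarith
  have hrΛ : r ^ 2 * Λ ≤ L := by
    have h1 : r ^ 2 ≤ r ^ 30 := pow_le_pow_right₀ (le_trans (by norm_num) hr15) (by norm_num)
    have h2 : r ^ 2 * Λ ≤ r ^ 30 * Λ := mul_le_mul_of_nonneg_right h1 (by linarith)
    have h3 : 0 ≤ r ^ 30 * Λ := mul_nonneg (by positivity) (by linarith)
    linarith
  have hdn : d + 1 ≤ n := by
    have h1 : 2 * r ^ 1 ≤ L := const_mul_pow_le hr15 hr30 (j := 1) (by norm_num) (by norm_num)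
    have h2 : L ≤ L ^ 17 := le_self_pow₀ (by linarith) (by norm_num)
    have h3 : ((d + 1 : ℕ) : ℝ) ≤ n := by
      rw [← hLn]
      push_cast
      linarith
    exact_mod_cast h3
  refine ⟨fun x => ?_, fun μ Sig Sstar hSig hS _ => ?_⟩
  · obtain ⟨t, s, h1, h2, -⟩ := RealRAM.learner_runs hd hdn α ε δ x
    exact ⟨t, s, h1, h2⟩
  · obtain ⟨e, rfl⟩ : ∃ e, d = e + 1 := ⟨d - 1, by omega⟩
    refine (measure_mono fun x hx => ?_).trans (measure_learnedSet_symmDiff_gt_le (by omega) μ hSig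
      hS hr15 hr30 hrΛ (by linarith) hδΛ hLn (by linarith) hrε hdr)
    rw [Set.mem_ofPred_eq]
    by_contra hle
    rw [not_lt] at hle
    refine hx ?_
    obtain ⟨t, s, h1, -, h2⟩ := RealRAM.learner_runs hd hdn α ε δ x
    refine ⟨t, s, h1, ?_⟩
    rw [h2]
    exact hle
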